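/- Let $\Bbbk$ be a commutative ring and $d$ an even integer; put $e=d-1$ (odd). An $e$-Batalin–Vilkovisky algebra is a unital graded commutative $\Bbbk$-algebra with a graded Lie bracket of degree $-e$ satisfying $[x,yz]=[x,y]z+(-1)^{\tilde y(\tilde x-e)}y[x,z]$ and an operator $\delta$ of degree $-e$ with $\delta^2=0$ and $\delta(ab)=\delta(a)b+(-1)^{\tilde a}a\delta(b)+(-1)^{\tilde a}[a,b]$ (tilde denotes degree). Let $\mathcal{BV}_{e}(n)$, $n\ge 0$, be the graded $\Bbbk$-module spanned, in the free $e$-Batalin–Vilkovisky algebra on generators $x_1,\dots,x_n$ of degree $0$, by the expressions containing each $x_i$ exactly once; these modules form a graded operad under substitution (with the Koszul sign rule), and $\mathcal{BV}_e:=\bigoplus_{n\ge0}\mathcal{BV}_e(n)$. For $x\in\mathcal{BV}_e(n)$ put $n_x=n-1$, $|x|=\tilde x+n-1$, $\deg x=|x|+1$, and $$x\circ y=\sum_{i=1}^{n}(-1)^{n_y(n-i)+n_x\tilde y}\,x(\underbrace{\mathrm{id},\dots,\mathrm{id}}_{i-1},y,\mathrm{id},\dots,\mathrm{id}),\qquad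 [x,y]=x\circ y-(-1)^{|x||y|}y\circ x .$$ With $m=x_1x_2\in\mathcal{BV}_e(2)$, the map $\partial x=[m,x]$ satisfies $\partial^2=0$ and raises $\deg$ by $1$; $(\mathcal{BV}_{d-1},\partial)$, graded by $\deg$, is the Hochschild complex. A star-partition of $\{1,\dots,n\}$ is a pair $(A,S)$ of a partition $A$ of $\{1,\dots,n\}$ and a subset $S\subset\{1,\dots,n\}$. Let $\mathcal{BV}_{d-1}(A,S,n)\subset\mathcal{BV}_{d-1}(n)$ be the span of the products of $\#A$ brackets, one for each block of $A$ and containing each index of this block exactly once, where the index $i$ occurs as $\delta(x_i)$ if $i\in S$ and as $x_i$ if $i\notin S$. Let $E_i\subset\mathcal{BV}_{d-1}$ be the sum of the $\mathcal{BV}_{d-1}(A,S,n)$ over all $n$ and all star-partitions $(A,S)$ of $\{1,\dots,n\}$ having exactly $i$ singleton blocks $\{j\}\in A$ with $j\notin S$, and let $F_1=\sum_{i\ge1}E_i$. **Proposition.** Both $E_0$ and $F_1$ are invariant under $\partial$, and the Hochschild complex $(\mathcal{BV}_{d-1},\partial)$ is the direct sum of its subcomplexes $(E_0,\partial)$ and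 $(F_1,\partial)$. The inclusion of $(E_0,\partial)$ into $(\mathcal{BV}_{d-1},\partial)$ is a chain homotopy equivalence (in particular, it induces an isomorphism in homology), and $(F_1,\partial)$ is contractible (in particular, acyclic). -/

import Mathlib

universe u

noncomputable section

namespace HochschildBV

/-- Formal expressions of `e`-Batalin-Vilkovisky algebras (for odd `e`) in generators
`x_0, x_1, x_2, …` of degree zero: the unit, the generators, products, brackets and the
operator `δ`. -/
inductive Word : Type
  | one : Word
  | var : ℕ → Word
  | mul : Word → Word → Word
  | br : Word → Word → Word
  | del : Word → Word

namespace Word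

/-- The number of brackets plus the number of operators `δ` in a word.  In a `e`-Batalin-Vilkovisky
algebra both the bracket and `δ` have degree `-e`, so a word of weight `w` has degree `-e * w`;
as `e` is odd, its parity is the parity of `w`. -/
def wt : Word → ℕ
  | one => 0
  | var _ => 0
  | mul a b => wt a + wt b
  | br a b => wt a + wt b + 1
  | del a => wt a + 1

/-- The multiset of indices of the generators occurring in a word. -/
def vars : Word → Multiset ℕ
  | one => 0
  | var j => {j}
  | mul a b => vars a + vars b
  | br a b => vars a + vars b
  | del a => vars a

/-- Renaming of the generators. -/
def rename (f : ℕ → ℕ) : Word → Word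
  | one => one
  | var j => var (f j)
  | mul a b => mul (rename f a) (rename f b)
  | br a b => br (rename f a) (rename f b)
  | del a => del (rename f a)

theorem wt_rename (f : ℕ → ℕ) (t : Word) : (t.rename f).wt = t.wt := by
  induction t <;> simp_all [rename, wt]

theorem vars_rename (f : ℕ → ℕ) (t : Word) : (t.rename f).vars = t.vars.map f := by
  induction t <;> simp_all [rename, vars]

end Word

variable (k : Type u) [CommRing k]

open Finsupp in
/-- The relations of `e`-Batalin-Vilkovisky algebras (`e` odd), where `(-1)^(degree of a)` is
written `(-1)^(a.wt)`: unital graded commutative associative multiplication, graded Lie bracket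
of odd degree, compatibility of the bracket with the multiplication, `δ² = 0` and
`δ(ab) = δ(a)b + (-1)^a aδ(b) + (-1)^a [a,b]`; closed under applying the operations. -/
inductive Relator : (Word →₀ k) → Prop
  | one_mul (a : Word) : Relator (single (.mul .one a) 1 - single a 1)
  | mul_comm (a b : Word) :
      Relator (single (.mul a b) 1 - (-1 : k) ^ (a.wt * b.wt) • single (.mul b a) 1)
  | mul_assoc (a b c : Word) :
      Relator (single (.mul (.mul a b) c) 1 - single (.mul a (.mul b c)) 1)
  | antisymm (a b : Word) :
      Relator (single (.br a b) 1 + (-1 : k) ^ ((a.wt + 1) * (b.wt + 1)) • single (.br b a) 1)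
  | jacobi (a b c : Word) :
      Relator (single (.br a (.br b c)) 1 - single (.br (.br a b) c) 1
        - (-1 : k) ^ ((a.wt + 1) * (b.wt + 1)) • single (.br b (.br a c)) 1)
  | leibniz (a b c : Word) :
      Relator (single (.br a (.mul b c)) 1 - single (.mul (.br a b) c) 1
        - (-1 : k) ^ (b.wt * (a.wt + 1)) • single (.mul b (.br a c)) 1)
  | del_del (a : Word) : Relator (single (.del (.del a)) 1)
  | del_mul (a b : Word) :
      Relator (single (.del (.mul a b)) 1 - single (.mul (.del a) b) 1
        - (-1 : k) ^ a.wt • single (.mul a (.del b)) 1 - (-1 : k) ^ a.wt • single (.br a b) 1)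
  | mul_left (a : Word) {r : Word →₀ k} : Relator r → Relator (r.mapDomain (Word.mul a))
  | mul_right (a : Word) {r : Word →₀ k} :
      Relator r → Relator (r.mapDomain fun t => Word.mul t a)
  | br_left (a : Word) {r : Word →₀ k} : Relator r → Relator (r.mapDomain (Word.br a))
  | br_right (a : Word) {r : Word →₀ k} : Relator r → Relator (r.mapDomain fun t => Word.br t a)
  | del {r : Word →₀ k} : Relator r → Relator (r.mapDomain Word.del)

/-- The submodule of relations in the free module on all words. -/
def relations : Submodule k (Word →₀ k) := Submodule.span k {r | Relator k r}

/-- The free `e`-Batalin-Vilkovisky algebra (`e` odd) on generators `x_0, x_1, …` of degree zero.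
Up to the choice of grading it does not depend on the odd number `e`. -/
abbrev FreeBV : Type u := (Word →₀ k) ⧸ relations k

/-- The class of a word in the free algebra. -/
def cls (t : Word) : FreeBV k := (relations k).mkQ (Finsupp.single t 1)

variable {k}

theorem FreeBV.hom_ext {M : Type*} [AddCommGroup M] [Module k M] {f g : FreeBV k →ₗ[k] M}
    (h : ∀ t, f (cls k t) = g (cls k t)) : f = g := by
  apply Submodule.linearMap_qext
  ext t
  exact h t

/-- A function on words extends to the free algebra as soon as its linear extension kills the
relators. -/
def FreeBV.lift {M : Type*} [AddCommGroup M] [Module k M] (f : Word → M)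
    (h : ∀ r, Relator k r → Finsupp.linearCombination k f r = 0) : FreeBV k →ₗ[k] M :=
  (relations k).liftQ (Finsupp.linearCombination k f)
    (Submodule.span_le.2 fun r hr => LinearMap.mem_ker.2 (h r hr))

@[simp] theorem FreeBV.lift_cls {M : Type*} [AddCommGroup M] [Module k M] (f : Word → M)
    (h : ∀ r, Relator k r → Finsupp.linearCombination k f r = 0) (t : Word) :
    FreeBV.lift f h (cls k t) = f t := by
  have : FreeBV.lift f h (cls k t)
      = Finsupp.linearCombination k f (Finsupp.single t 1) := rfl
  rw [this]; simp

theorem cls_relator {r : Word →₀ k} (h : Relator k r) :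
    Finsupp.linearCombination k (cls k) r = 0 := by
  have : Finsupp.linearCombination k (cls k) = (relations k).mkQ := by
    ext t; simp [cls]
  rw [this]
  exact (Submodule.Quotient.mk_eq_zero _).2 (Submodule.subset_span h)

theorem cls_relator_map {r : Word →₀ k} (f : Word → Word) (h : Relator k (r.mapDomain f)) :
    Finsupp.linearCombination k (fun t => cls k (f t)) r = 0 := by
  have := cls_relator h
  rw [Finsupp.linearCombination_mapDomain] at this
  exact this

/-- The operator `δ` of the free algebra. -/
def delL : FreeBV k →ₗ[k] FreeBV k :=
  FreeBV.lift (fun t => cls k (.del t)) fun _ h => cls_relator_map _ h.del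

/-- The multiplication of the free algebra. -/
def mulL : FreeBV k →ₗ[k] FreeBV k →ₗ[k] FreeBV k :=
  FreeBV.lift
    (fun a => FreeBV.lift (fun b => cls k (.mul a b)) fun _ h => cls_relator_map _ (h.mul_left a))
    fun r h => FreeBV.hom_ext fun b => by
      simpa [Finsupp.linearCombination_apply, Finsupp.sum, LinearMap.sum_apply]
        using cls_relator_map _ (h.mul_right b)

/-- The bracket of the free algebra. -/
def brL : FreeBV k →ₗ[k] FreeBV k →ₗ[k] FreeBV k :=
  FreeBV.lift
    (fun a => FreeBV.lift (fun b => cls k (.br a b)) fun _ h => cls_relator_map _ (h.br_left a))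
    fun r h => FreeBV.hom_ext fun b => by
      simpa [Finsupp.linearCombination_apply, Finsupp.sum, LinearMap.sum_apply]
        using cls_relator_map _ (h.br_right b)

@[simp] theorem delL_cls (a : Word) : delL (cls k a) = cls k (.del a) := by simp [delL]

@[simp] theorem mulL_cls (a b : Word) : mulL (cls k a) (cls k b) = cls k (.mul a b) := by
  simp [mulL]

@[simp] theorem brL_cls (a b : Word) : brL (cls k a) (cls k b) = cls k (.br a b) := by
  simp [brL]

theorem relator_rename (f : ℕ → ℕ) {r : Word →₀ k} (h : Relator k r) :
    Relator k (r.mapDomain (Word.rename f)) := by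
  have hs : ∀ (t : Word), (Finsupp.single t (1:k)).mapDomain (Word.rename f)
      = Finsupp.single (t.rename f) 1 := fun t => Finsupp.mapDomain_single
  have hsub : ∀ a b : Word →₀ k, (a - b).mapDomain (Word.rename f)
      = a.mapDomain (Word.rename f) - b.mapDomain (Word.rename f) :=
    fun a b => map_sub (Finsupp.lmapDomain k k (Word.rename f)) a b
  have hc : ∀ (g g' : Word → Word), (∀ t, (g t).rename f = g' (t.rename f)) →
      ∀ r : Word →₀ k, (r.mapDomain g).mapDomain (Word.rename f)
        = (r.mapDomain (Word.rename f)).mapDomain g' := by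
    intro g g' hg r
    rw [← Finsupp.mapDomain_comp, ← Finsupp.mapDomain_comp]
    congr 1
    funext t
    exact hg t
  induction h with
  | one_mul a => simpa [hs, hsub, Word.rename] using Relator.one_mul (a.rename f)
  | mul_comm a b =>
    simpa [hs, hsub, Word.rename, Finsupp.mapDomain_smul, Word.wt_rename] using
      Relator.mul_comm (k := k) (a.rename f) (b.rename f)
  | mul_assoc a b c =>
    simpa [hs, hsub, Word.rename] using
      Relator.mul_assoc (k := k) (a.rename f) (b.rename f) (c.rename f)
  | antisymm a b =>
    simpa [hs, hsub, Word.rename, Finsupp.mapDomain_add, Finsupp.mapDomain_smul,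
      Word.wt_rename] using Relator.antisymm (k := k) (a.rename f) (b.rename f)
  | jacobi a b c =>
    simpa [hs, hsub, Word.rename, Finsupp.mapDomain_smul, Word.wt_rename] using
      Relator.jacobi (k := k) (a.rename f) (b.rename f) (c.rename f)
  | leibniz a b c =>
    simpa [hs, hsub, Word.rename, Finsupp.mapDomain_smul, Word.wt_rename] using
      Relator.leibniz (k := k) (a.rename f) (b.rename f) (c.rename f)
  | del_del a => simpa [hs, Word.rename] using Relator.del_del (k := k) (a.rename f)
  | del_mul a b =>
    simpa [hs, hsub, Word.rename, Finsupp.mapDomain_smul, Word.wt_rename] using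
      Relator.del_mul (k := k) (a.rename f) (b.rename f)
  | mul_left a _ ih =>
    rw [hc _ (Word.mul (a.rename f)) (fun _ => rfl)]; exact ih.mul_left _
  | mul_right a _ ih =>
    rw [hc _ (fun t => Word.mul t (a.rename f)) (fun _ => rfl)]; exact ih.mul_right _
  | br_left a _ ih =>
    rw [hc _ (Word.br (a.rename f)) (fun _ => rfl)]; exact ih.br_left _
  | br_right a _ ih =>
    rw [hc _ (fun t => Word.br t (a.rename f)) (fun _ => rfl)]; exact ih.br_right _
  | del _ ih => rw [hc _ Word.del (fun _ => rfl)]; exact ih.del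

/-- Renaming of the generators in the free algebra. -/
def renameL (f : ℕ → ℕ) : FreeBV k →ₗ[k] FreeBV k :=
  FreeBV.lift (fun t => cls k (t.rename f)) fun _ h => cls_relator_map _ (relator_rename f h)

@[simp] theorem renameL_cls (f : ℕ → ℕ) (t : Word) :
    renameL f (cls k t) = cls k (t.rename f) := by simp [renameL]

/-- The new index of the generator `x_j` (`j ≠ i`) when an operation with `m` inputs is inserted
into the `i`-th input. -/
def newIndex (i m j : ℕ) : ℕ := if j < i then j else j + m - 1

variable (k) in
/-- Renumbering of a word without `x_i`; it is zero if `x_i` occurs. -/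
def avoid (i m : ℕ) : Word → FreeBV k
  | .one => cls k .one
  | .var j => if j = i then 0 else cls k (.var (newIndex i m j))
  | .mul a b => mulL (avoid i m a) (avoid i m b)
  | .br a b => brL (avoid i m a) (avoid i m b)
  | .del a => delL (avoid i m a)

variable (k) in
/-- Insertion of an element `y` of weight `v` with `m` inputs at the (only) occurrence of `x_i` in
a word, with the Koszul sign rule: `y` is moved to the left past all the odd symbols (brackets,
represented by their commas, and operators `δ`) on the right of `x_i`.
It is zero if `x_i` does not occur exactly once. -/
def plug (i m v : ℕ) : Word → FreeBV k →ₗ[k] FreeBV k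
  | .one => 0
  | .var j => if j = i then renameL (· + i) else 0
  | .mul a b => (-1 : k) ^ (v * b.wt) • (mulL.flip (avoid k i m b) ∘ₗ plug i m v a)
      + mulL (avoid k i m a) ∘ₗ plug i m v b
  | .br a b => (-1 : k) ^ (v * (b.wt + 1)) • (brL.flip (avoid k i m b) ∘ₗ plug i m v a)
      + brL (avoid k i m a) ∘ₗ plug i m v b
  | .del a => delL ∘ₗ plug i m v a

/-- `x` is a multiple of the class of a word of weight `w`. -/
def IsMono (w : ℕ) (x : FreeBV k) : Prop := ∃ (c : k) (t : Word), t.wt = w ∧ x = c • cls k t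

theorem exists_wt (w : ℕ) : ∃ t : Word, t.wt = w := by
  induction w with
  | zero => exact ⟨.one, rfl⟩
  | succ n ih => obtain ⟨t, rfl⟩ := ih; exact ⟨.del t, rfl⟩

theorem IsMono.zero (w : ℕ) : IsMono w (0 : FreeBV k) := by
  obtain ⟨t, ht⟩ := exists_wt w
  exact ⟨0, t, ht, by simp⟩

set_option linter.unusedSimpArgs false

namespace IsMono

variable {p q r : ℕ} {x y z : FreeBV k}

theorem smul (c : k) (hx : IsMono p x) : IsMono p (c • x) := by
  obtain ⟨c', t, ht, rfl⟩ := hx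
  exact ⟨c * c', t, ht, by rw [smul_smul]⟩

theorem cls (t : Word) : IsMono t.wt (cls k t) := ⟨1, t, rfl, by simp⟩

theorem mul (hx : IsMono p x) (hy : IsMono q y) : IsMono (p + q) (mulL x y) := by
  obtain ⟨c, t, rfl, rfl⟩ := hx
  obtain ⟨c', t', rfl, rfl⟩ := hy
  exact ⟨c * c', .mul t t', rfl, by simp [smul_smul, mul_comm]⟩

theorem br (hx : IsMono p x) (hy : IsMono q y) : IsMono (p + q + 1) (brL x y) := by
  obtain ⟨c, t, rfl, rfl⟩ := hx
  obtain ⟨c', t', rfl, rfl⟩ := hy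
  exact ⟨c * c', .br t t', rfl, by simp [smul_smul, mul_comm]⟩

theorem del (hx : IsMono p x) : IsMono (p + 1) (delL x) := by
  obtain ⟨c, t, rfl, rfl⟩ := hx
  exact ⟨c, .del t, rfl, by simp⟩

theorem one_mul (x : FreeBV k) : mulL (HochschildBV.cls k .one) x = x := by
  suffices mulL (HochschildBV.cls k .one) = LinearMap.id by rw [this]; rfl
  refine FreeBV.hom_ext fun t => ?_
  have := cls_relator (Relator.one_mul (k := k) t)
  simp only [map_sub, Finsupp.linearCombination_single, one_smul] at this
  simpa [sub_eq_zero] using this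

theorem mul_comm (hx : IsMono p x) (hy : IsMono q y) :
    mulL x y = (-1 : k) ^ (p * q) • mulL y x := by
  obtain ⟨c, t, rfl, rfl⟩ := hx
  obtain ⟨c', t', rfl, rfl⟩ := hy
  have := cls_relator (Relator.mul_comm (k := k) t t')
  simp only [map_sub, map_smul, Finsupp.linearCombination_single, one_smul, sub_eq_zero] at this
  simp only [map_smul, LinearMap.smul_apply, mulL_cls, this]
  module

theorem antisymm (hx : IsMono p x) (hy : IsMono q y) :
    brL x y = -((-1 : k) ^ ((p + 1) * (q + 1)) • brL y x) := by
  obtain ⟨c, t, rfl, rfl⟩ := hx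
  obtain ⟨c', t', rfl, rfl⟩ := hy
  have := cls_relator (Relator.antisymm (k := k) t t')
  simp only [map_add, map_smul, Finsupp.linearCombination_single, one_smul,
    add_eq_zero_iff_eq_neg] at this
  simp only [map_smul, LinearMap.smul_apply, brL_cls, this]
  module

theorem mul_assoc (x y z : FreeBV k) : mulL (mulL x y) z = mulL x (mulL y z) := by
  have h1 : ∀ a b : Word, mulL (mulL (HochschildBV.cls k a) (HochschildBV.cls k b))
      = mulL (HochschildBV.cls k a) ∘ₗ mulL (HochschildBV.cls k b) := fun a b =>
    FreeBV.hom_ext fun c => by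
      have := cls_relator (Relator.mul_assoc (k := k) a b c)
      simp only [map_sub, Finsupp.linearCombination_single, one_smul, sub_eq_zero] at this
      simpa using this
  have h2 : ∀ a : Word, mulL.flip z ∘ₗ mulL (HochschildBV.cls k a)
      = mulL (HochschildBV.cls k a) ∘ₗ mulL.flip z := fun a =>
    FreeBV.hom_ext fun b => LinearMap.congr_fun (h1 a b) z
  have h3 : mulL.flip z ∘ₗ mulL.flip y = mulL.flip (mulL y z) :=
    FreeBV.hom_ext fun a => LinearMap.congr_fun (h2 a) y
  exact LinearMap.congr_fun h3 x

theorem jacobi (hx : IsMono p x) (hy : IsMono q y) (z : FreeBV k) :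
    brL x (brL y z) = brL (brL x y) z + (-1 : k) ^ ((p + 1) * (q + 1)) • brL y (brL x z) := by
  obtain ⟨c, t, rfl, rfl⟩ := hx
  obtain ⟨c', t', rfl, rfl⟩ := hy
  suffices brL (k := k) (HochschildBV.cls k t) ∘ₗ brL (HochschildBV.cls k t')
      = brL (HochschildBV.cls k (.br t t')) + (-1 : k) ^ ((t.wt + 1) * (t'.wt + 1)) •
        brL (HochschildBV.cls k t') ∘ₗ brL (HochschildBV.cls k t) by
    have := LinearMap.congr_fun this z
    simp only [LinearMap.comp_apply, LinearMap.add_apply, LinearMap.smul_apply] at this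
    simp only [map_smul, LinearMap.smul_apply, brL_cls, this]
    module
  refine FreeBV.hom_ext fun a => ?_
  have := cls_relator (Relator.jacobi (k := k) t t' a)
  simp only [map_sub, map_smul, Finsupp.linearCombination_single, one_smul, sub_eq_iff_eq_add,
    zero_add] at this
  simp [this, add_comm]

theorem leibniz (hx : IsMono p x) (hy : IsMono q y) (z : FreeBV k) :
    brL x (mulL y z) = mulL (brL x y) z + (-1 : k) ^ (q * (p + 1)) • mulL y (brL x z) := by
  obtain ⟨c, t, rfl, rfl⟩ := hx
  obtain ⟨c', t', rfl, rfl⟩ := hy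
  suffices brL (k := k) (HochschildBV.cls k t) ∘ₗ mulL (HochschildBV.cls k t')
      = mulL (HochschildBV.cls k (.br t t')) + (-1 : k) ^ (t'.wt * (t.wt + 1)) •
        mulL (HochschildBV.cls k t') ∘ₗ brL (HochschildBV.cls k t) by
    have := LinearMap.congr_fun this z
    simp only [LinearMap.comp_apply, LinearMap.add_apply, LinearMap.smul_apply] at this
    simp only [map_smul, LinearMap.smul_apply, brL_cls, this]
    module
  refine FreeBV.hom_ext fun a => ?_
  have := cls_relator (Relator.leibniz (k := k) t t' a)
  simp only [map_sub, map_smul, Finsupp.linearCombination_single, one_smul, sub_eq_iff_eq_add,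
    zero_add] at this
  simp [this, add_comm]

theorem del_del (x : FreeBV k) : delL (delL x) = 0 := by
  suffices delL (k := k) ∘ₗ delL = 0 from LinearMap.congr_fun this x
  refine FreeBV.hom_ext fun a => ?_
  have := cls_relator (Relator.del_del (k := k) a)
  simp only [Finsupp.linearCombination_single, one_smul] at this
  simp [this]

theorem del_mul (hx : IsMono p x) (y : FreeBV k) :
    delL (mulL x y) = mulL (delL x) y + (-1 : k) ^ p • mulL x (delL y)
      + (-1 : k) ^ p • brL x y := by
  obtain ⟨c, t, rfl, rfl⟩ := hx
  suffices delL (k := k) ∘ₗ mulL (HochschildBV.cls k t) = mulL (HochschildBV.cls k (.del t))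
      + (-1 : k) ^ t.wt • mulL (HochschildBV.cls k t) ∘ₗ delL
      + (-1 : k) ^ t.wt • brL (HochschildBV.cls k t) by
    have := LinearMap.congr_fun this y
    simp only [LinearMap.comp_apply, LinearMap.add_apply, LinearMap.smul_apply] at this
    simp only [map_smul, LinearMap.smul_apply, delL_cls, this]
    module
  refine FreeBV.hom_ext fun a => ?_
  have := cls_relator (Relator.del_mul (k := k) t a)
  simp only [map_sub, map_smul, Finsupp.linearCombination_single, one_smul, sub_eq_iff_eq_add,
    zero_add] at this
  simp [this, add_comm, add_left_comm]

end IsMono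

theorem isMono_avoid (i m : ℕ) (t : Word) : IsMono t.wt (avoid k i m t) := by
  induction t with
  | one => exact IsMono.cls (k := k) .one
  | var j =>
    unfold avoid
    split_ifs
    · exact IsMono.zero _
    · exact IsMono.cls (k := k) (.var (newIndex i m j))
  | mul a b iha ihb => exact iha.mul ihb
  | br a b iha ihb => exact iha.br ihb
  | del a iha => exact iha.del

theorem avoid_eq_zero (i m : ℕ) (t : Word) (h : i ∈ t.vars) : avoid k i m t = 0 := by
  induction t with
  | one => simp [Word.vars] at h
  | var j =>
    have h' : j = i := by simpa [Word.vars, eq_comm] using h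
    simp [avoid, h']
  | mul a b iha ihb =>
    rcases Multiset.mem_add.1 h with h | h
    · simp [avoid, iha h]
    · simp [avoid, ihb h]
  | br a b iha ihb =>
    rcases Multiset.mem_add.1 h with h | h
    · simp [avoid, iha h]
    · simp [avoid, ihb h]
  | del a iha => simp [avoid, iha h]

theorem plug_eq_zero (i m v : ℕ) (t : Word) (h : i ∉ t.vars) : plug k i m v t = 0 := by
  induction t with
  | one => rfl
  | var j =>
    have h' : j ≠ i := by simpa [Word.vars, eq_comm] using h
    simp [plug, h']
  | mul a b iha ihb =>
    simp only [Word.vars, Multiset.mem_add, not_or] at h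
    simp [plug, iha h.1, ihb h.2]
  | br a b iha ihb =>
    simp only [Word.vars, Multiset.mem_add, not_or] at h
    simp [plug, iha h.1, ihb h.2]
  | del a iha => simp [plug, iha h]

theorem isMono_plug (i m : ℕ) (u t : Word) :
    IsMono (t.wt + u.wt) (plug k i m u.wt t (cls k u)) := by
  induction t with
  | one => exact IsMono.zero _
  | var j =>
    unfold plug
    split_ifs
    · have := IsMono.cls (k := k) (u.rename (· + i))
      rw [Word.wt_rename] at this
      simpa [Word.wt] using this
    · exact IsMono.zero _
  | mul a b iha ihb =>
    by_cases hb : i ∈ b.vars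
    · have := (isMono_avoid i m a).mul ihb
      simpa [plug, avoid_eq_zero i m b hb, Word.wt, add_assoc] using this
    · have := (iha.mul (isMono_avoid i m b)).smul ((-1 : k) ^ (u.wt * b.wt))
      simpa [plug, plug_eq_zero i m _ b hb, Word.wt, add_right_comm] using this
  | br a b iha ihb =>
    by_cases hb : i ∈ b.vars
    · have := (isMono_avoid i m a).br ihb
      simpa [plug, avoid_eq_zero i m b hb, Word.wt, add_assoc, add_left_comm, add_comm] using this
    · have := (iha.br (isMono_avoid i m b)).smul ((-1 : k) ^ (u.wt * (b.wt + 1)))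
      simpa [plug, plug_eq_zero i m _ b hb, Word.wt, add_assoc, add_left_comm, add_comm] using this
  | del a iha =>
    have := iha.del
    simpa [plug, Word.wt, add_right_comm] using this

theorem linearCombination_map {M N : Type*} [AddCommGroup M] [Module k M] [AddCommGroup N]
    [Module k N] (L : M →ₗ[k] N) (f : Word → M) (r : Word →₀ k) :
    Finsupp.linearCombination k (fun t => L (f t)) r = L (Finsupp.linearCombination k f r) :=
  (Finsupp.apply_linearCombination k L f r).symm

theorem avoid_relator (i m : ℕ) {r : Word →₀ k} (h : Relator k r) :
    Finsupp.linearCombination k (avoid k i m) r = 0 := by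
  have hm : ∀ t, IsMono t.wt (avoid k i m t) := isMono_avoid i m
  induction h with
  | one_mul a => simp [avoid, IsMono.one_mul]
  | mul_comm a b => simp [avoid, (hm a).mul_comm (hm b)]
  | mul_assoc a b c => simp [avoid, IsMono.mul_assoc]
  | antisymm a b => simp [avoid, (hm a).antisymm (hm b)]
  | jacobi a b c => simp [avoid, (hm a).jacobi (hm b)]
  | leibniz a b c => simp [avoid, (hm a).leibniz (hm b)]
  | del_del a => simp [avoid, IsMono.del_del]
  | del_mul a b => simp [avoid, (hm a).del_mul, add_sub_right_comm]
  | mul_left a _ ih =>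
    rw [Finsupp.linearCombination_mapDomain]
    exact (linearCombination_map (mulL (avoid k i m a)) _ _).trans (by rw [ih, map_zero])
  | mul_right a _ ih =>
    rw [Finsupp.linearCombination_mapDomain]
    exact (linearCombination_map (mulL.flip (avoid k i m a)) _ _).trans (by rw [ih, map_zero])
  | br_left a _ ih =>
    rw [Finsupp.linearCombination_mapDomain]
    exact (linearCombination_map (brL (avoid k i m a)) _ _).trans (by rw [ih, map_zero])
  | br_right a _ ih =>
    rw [Finsupp.linearCombination_mapDomain]
    exact (linearCombination_map (brL.flip (avoid k i m a)) _ _).trans (by rw [ih, map_zero])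
  | del _ ih =>
    rw [Finsupp.linearCombination_mapDomain]
    exact (linearCombination_map delL _ _).trans (by rw [ih, map_zero])

theorem relator_homogeneous {r : Word →₀ k} (h : Relator k r) :
    ∃ w, r ∈ Finsupp.supported k k {t : Word | t.wt = w} := by
  have hs : ∀ (t : Word) (w : ℕ), t.wt = w →
      Finsupp.single t (1 : k) ∈ Finsupp.supported k k {t : Word | t.wt = w} :=
    fun t w h => Finsupp.single_mem_supported k _ h
  have hc : ∀ (g : Word → Word) (w w' : ℕ) (r : Word →₀ k),
      r ∈ Finsupp.supported k k {t : Word | t.wt = w} → (∀ t, t.wt = w → (g t).wt = w') →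
      r.mapDomain g ∈ Finsupp.supported k k {t : Word | t.wt = w'} := by
    intro g w w' r hr hg
    classical
    rw [Finsupp.mem_supported] at hr ⊢
    intro t ht
    obtain ⟨t', ht', rfl⟩ := Finset.mem_image.1 (Finsupp.mapDomain_support ht)
    exact hg _ (hr ht')
  induction h with
  | one_mul a => exact ⟨a.wt, sub_mem (hs _ _ (by simp [Word.wt])) (hs _ _ rfl)⟩
  | mul_comm a b =>
    exact ⟨a.wt + b.wt, sub_mem (hs _ _ rfl)
      (Submodule.smul_mem _ _ (hs _ _ (by simp [Word.wt, add_comm])))⟩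
  | mul_assoc a b c =>
    exact ⟨a.wt + b.wt + c.wt, sub_mem (hs _ _ rfl) (hs _ _ (by simp [Word.wt, add_assoc]))⟩
  | antisymm a b =>
    exact ⟨a.wt + b.wt + 1, add_mem (hs _ _ rfl)
      (Submodule.smul_mem _ _ (hs _ _ (by simp [Word.wt, add_comm])))⟩
  | jacobi a b c =>
    exact ⟨a.wt + b.wt + c.wt + 2, sub_mem (sub_mem (hs _ _ (by simp [Word.wt]; ring))
      (hs _ _ (by simp [Word.wt]; ring)))
      (Submodule.smul_mem _ _ (hs _ _ (by simp [Word.wt]; ring)))⟩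
  | leibniz a b c =>
    exact ⟨a.wt + b.wt + c.wt + 1, sub_mem (sub_mem (hs _ _ (by simp [Word.wt]; ring))
      (hs _ _ (by simp [Word.wt]; ring)))
      (Submodule.smul_mem _ _ (hs _ _ (by simp [Word.wt]; ring)))⟩
  | del_del a => exact ⟨a.wt + 2, hs _ _ rfl⟩
  | del_mul a b =>
    exact ⟨a.wt + b.wt + 1, sub_mem (sub_mem (sub_mem (hs _ _ rfl)
      (hs _ _ (by simp [Word.wt]; ring)))
      (Submodule.smul_mem _ _ (hs _ _ (by simp [Word.wt]; ring))))
      (Submodule.smul_mem _ _ (hs _ _ (by simp [Word.wt])))⟩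
  | mul_left a _ ih => exact ih.elim fun w h => ⟨a.wt + w, hc _ w _ _ h fun t ht => by simp [Word.wt, ht]⟩
  | mul_right a _ ih => exact ih.elim fun w h => ⟨w + a.wt, hc _ w _ _ h fun t ht => by simp [Word.wt, ht]⟩
  | br_left a _ ih => exact ih.elim fun w h => ⟨a.wt + w + 1, hc _ w _ _ h fun t ht => by simp [Word.wt, ht]⟩
  | br_right a _ ih => exact ih.elim fun w h => ⟨w + a.wt + 1, hc _ w _ _ h fun t ht => by simp [Word.wt, ht]⟩
  | del _ ih => exact ih.elim fun w h => ⟨w + 1, hc _ w _ _ h fun t ht => by simp [Word.wt, ht]⟩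

theorem linearCombination_sign {M : Type*} [AddCommGroup M] [Module k M] (s : ℕ → k)
    (f : Word → M) {r : Word →₀ k} (hr : Relator k r)
    (h : Finsupp.linearCombination k f r = 0) :
    Finsupp.linearCombination k (fun t => s t.wt • f t) r = 0 := by
  obtain ⟨w, hw⟩ := relator_homogeneous hr
  have : Finsupp.linearCombination k (fun t => s t.wt • f t) r
      = s w • Finsupp.linearCombination k f r := by
    rw [Finsupp.linearCombination_apply, Finsupp.linearCombination_apply, Finsupp.smul_sum]
    refine Finset.sum_congr rfl fun t ht => ?_
    have : t.wt = w := hw ht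
    simp only [this]
    rw [smul_comm]
  rw [this, h, smul_zero]

theorem linearCombination_add_fun {M : Type*} [AddCommGroup M] [Module k M] (f g : Word → M)
    (r : Word →₀ k) : Finsupp.linearCombination k (fun t => f t + g t) r
      = Finsupp.linearCombination k f r + Finsupp.linearCombination k g r := by
  simp [Finsupp.linearCombination_apply, Finsupp.sum, Finset.sum_add_distrib]

open Finsupp in
set_option maxHeartbeats 1000000 in
theorem plug_mul_comm (i m : ℕ) (u a b : Word) :
    linearCombination k (fun t => plug k i m u.wt t (cls k u))
      (single (.mul a b) 1 - (-1 : k) ^ (a.wt * b.wt) • single (.mul b a) 1) = 0 := by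
  have hm : ∀ t, IsMono t.wt (avoid k i m t) := isMono_avoid i m
  have hp : ∀ t, IsMono (t.wt + u.wt) (plug k i m u.wt t (cls k u)) := isMono_plug i m u
  simp only [map_sub, map_add, map_smul, Finsupp.linearCombination_single, one_smul, plug, avoid,
    Word.wt, LinearMap.add_apply, LinearMap.smul_apply, LinearMap.comp_apply,
    LinearMap.flip_apply]
  rw [(hp a).mul_comm (hm b), (hm a).mul_comm (hp b)]
  rcases Nat.even_or_odd a.wt with h1 | h1 <;> rcases Nat.even_or_odd b.wt with h2 | h2 <;>
  rcases Nat.even_or_odd u.wt with h4 | h4 <;>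
  simp only [pow_add, pow_mul, mul_add, add_mul, mul_one, one_mul, pow_one, h1.neg_one_pow,
    h2.neg_one_pow, h4.neg_one_pow, one_pow, mul_neg, neg_mul, neg_neg, one_smul,
    neg_smul] <;> module

open Finsupp in
set_option maxHeartbeats 1000000 in
theorem plug_mul_assoc (i m : ℕ) (u a b c : Word) :
    linearCombination k (fun t => plug k i m u.wt t (cls k u))
      (single (.mul (.mul a b) c) 1 - single (.mul a (.mul b c)) 1) = 0 := by
  have hm : ∀ t, IsMono t.wt (avoid k i m t) := isMono_avoid i m
  have hp : ∀ t, IsMono (t.wt + u.wt) (plug k i m u.wt t (cls k u)) := isMono_plug i m u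
  simp only [map_sub, map_add, map_smul, Finsupp.linearCombination_single, one_smul, plug, avoid,
    Word.wt, LinearMap.add_apply, LinearMap.smul_apply, LinearMap.comp_apply,
    LinearMap.flip_apply]
  rw [IsMono.mul_assoc, IsMono.mul_assoc, IsMono.mul_assoc]
  rcases Nat.even_or_odd a.wt with h1 | h1 <;> rcases Nat.even_or_odd b.wt with h2 | h2 <;>
  rcases Nat.even_or_odd c.wt with h3 | h3 <;> rcases Nat.even_or_odd u.wt with h4 | h4 <;>
  simp only [pow_add, pow_mul, mul_add, add_mul, mul_one, one_mul, pow_one, h1.neg_one_pow,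
    h2.neg_one_pow, h3.neg_one_pow, h4.neg_one_pow, one_pow, mul_neg, neg_mul, neg_neg, one_smul,
    neg_smul] <;> module

open Finsupp in
set_option maxHeartbeats 1000000 in
theorem plug_antisymm (i m : ℕ) (u a b : Word) :
    linearCombination k (fun t => plug k i m u.wt t (cls k u))
      (single (.br a b) 1 + (-1 : k) ^ ((a.wt + 1) * (b.wt + 1)) • single (.br b a) 1) = 0 := by
  have hm : ∀ t, IsMono t.wt (avoid k i m t) := isMono_avoid i m
  have hp : ∀ t, IsMono (t.wt + u.wt) (plug k i m u.wt t (cls k u)) := isMono_plug i m u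
  simp only [map_sub, map_add, map_smul, Finsupp.linearCombination_single, one_smul, plug, avoid,
    Word.wt, LinearMap.add_apply, LinearMap.smul_apply, LinearMap.comp_apply,
    LinearMap.flip_apply]
  rw [(hp a).antisymm (hm b), (hm a).antisymm (hp b)]
  rcases Nat.even_or_odd a.wt with h1 | h1 <;> rcases Nat.even_or_odd b.wt with h2 | h2 <;>
  rcases Nat.even_or_odd u.wt with h4 | h4 <;>
  simp only [pow_add, pow_mul, mul_add, add_mul, mul_one, one_mul, pow_one, h1.neg_one_pow,
    h2.neg_one_pow, h4.neg_one_pow, one_pow, mul_neg, neg_mul, neg_neg, one_smul,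
    neg_smul] <;> module

open Finsupp in
set_option maxHeartbeats 1000000 in
theorem plug_jacobi (i m : ℕ) (u a b c : Word) :
    linearCombination k (fun t => plug k i m u.wt t (cls k u))
      (single (.br a (.br b c)) 1 - single (.br (.br a b) c) 1
        - (-1 : k) ^ ((a.wt + 1) * (b.wt + 1)) • single (.br b (.br a c)) 1) = 0 := by
  have hm : ∀ t, IsMono t.wt (avoid k i m t) := isMono_avoid i m
  have hp : ∀ t, IsMono (t.wt + u.wt) (plug k i m u.wt t (cls k u)) := isMono_plug i m u
  simp only [map_sub, map_add, map_smul, Finsupp.linearCombination_single, one_smul, plug, avoid,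
    Word.wt, LinearMap.add_apply, LinearMap.smul_apply, LinearMap.comp_apply,
    LinearMap.flip_apply]
  rw [(hp a).jacobi (hm b), (hm a).jacobi (hp b), (hm a).jacobi (hm b)]
  rcases Nat.even_or_odd a.wt with h1 | h1 <;> rcases Nat.even_or_odd b.wt with h2 | h2 <;>
  rcases Nat.even_or_odd c.wt with h3 | h3 <;> rcases Nat.even_or_odd u.wt with h4 | h4 <;>
  simp only [pow_add, pow_mul, mul_add, add_mul, mul_one, one_mul, pow_one, h1.neg_one_pow,
    h2.neg_one_pow, h3.neg_one_pow, h4.neg_one_pow, one_pow, mul_neg, neg_mul, neg_neg, one_smul,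
    neg_smul] <;> module

open Finsupp in
set_option maxHeartbeats 1000000 in
theorem plug_leibniz (i m : ℕ) (u a b c : Word) :
    linearCombination k (fun t => plug k i m u.wt t (cls k u))
      (single (.br a (.mul b c)) 1 - single (.mul (.br a b) c) 1
        - (-1 : k) ^ (b.wt * (a.wt + 1)) • single (.mul b (.br a c)) 1) = 0 := by
  have hm : ∀ t, IsMono t.wt (avoid k i m t) := isMono_avoid i m
  have hp : ∀ t, IsMono (t.wt + u.wt) (plug k i m u.wt t (cls k u)) := isMono_plug i m u
  simp only [map_sub, map_add, map_smul, Finsupp.linearCombination_single, one_smul, plug, avoid,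
    Word.wt, LinearMap.add_apply, LinearMap.smul_apply, LinearMap.comp_apply,
    LinearMap.flip_apply]
  rw [(hp a).leibniz (hm b), (hm a).leibniz (hp b), (hm a).leibniz (hm b)]
  rcases Nat.even_or_odd a.wt with h1 | h1 <;> rcases Nat.even_or_odd b.wt with h2 | h2 <;>
  rcases Nat.even_or_odd c.wt with h3 | h3 <;> rcases Nat.even_or_odd u.wt with h4 | h4 <;>
  simp only [pow_add, pow_mul, mul_add, add_mul, mul_one, one_mul, pow_one, h1.neg_one_pow,
    h2.neg_one_pow, h3.neg_one_pow, h4.neg_one_pow, one_pow, mul_neg, neg_mul, neg_neg, one_smul,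
    neg_smul] <;> module

open Finsupp in
set_option maxHeartbeats 1000000 in
theorem plug_del_mul (i m : ℕ) (u a b : Word) :
    linearCombination k (fun t => plug k i m u.wt t (cls k u))
      (single (.del (.mul a b)) 1 - single (.mul (.del a) b) 1
        - (-1 : k) ^ a.wt • single (.mul a (.del b)) 1 - (-1 : k) ^ a.wt • single (.br a b) 1) = 0 := by
  have hm : ∀ t, IsMono t.wt (avoid k i m t) := isMono_avoid i m
  have hp : ∀ t, IsMono (t.wt + u.wt) (plug k i m u.wt t (cls k u)) := isMono_plug i m u
  simp only [map_sub, map_add, map_smul, Finsupp.linearCombination_single, one_smul, plug, avoid,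
    Word.wt, LinearMap.add_apply, LinearMap.smul_apply, LinearMap.comp_apply,
    LinearMap.flip_apply]
  rw [(hp a).del_mul, (hm a).del_mul]
  rcases Nat.even_or_odd a.wt with h1 | h1 <;> rcases Nat.even_or_odd b.wt with h2 | h2 <;>
  rcases Nat.even_or_odd u.wt with h4 | h4 <;>
  simp only [pow_add, pow_mul, mul_add, add_mul, mul_one, one_mul, pow_one, h1.neg_one_pow,
    h2.neg_one_pow, h4.neg_one_pow, one_pow, mul_neg, neg_mul, neg_neg, one_smul,
    neg_smul] <;> module

theorem plug_relator (i m : ℕ) (u : Word) {r : Word →₀ k} (h : Relator k r) :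
    Finsupp.linearCombination k (fun t => plug k i m u.wt t (cls k u)) r = 0 := by
  have hm : ∀ t, IsMono t.wt (avoid k i m t) := isMono_avoid i m
  have hp : ∀ t, IsMono (t.wt + u.wt) (plug k i m u.wt t (cls k u)) := isMono_plug i m u
  induction h with
  | one_mul a => simp [plug, avoid, IsMono.one_mul]
  | mul_comm a b => exact plug_mul_comm i m u a b
  | mul_assoc a b c => exact plug_mul_assoc i m u a b c
  | antisymm a b => exact plug_antisymm i m u a b
  | jacobi a b c => exact plug_jacobi i m u a b c
  | leibniz a b c => exact plug_leibniz i m u a b c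
  | del_del a => simp [plug, IsMono.del_del]
  | del_mul a b => exact plug_del_mul i m u a b
  | @mul_left a r hr ih =>
    rw [Finsupp.linearCombination_mapDomain]
    have h1 := linearCombination_sign (fun w => (-1 : k) ^ (u.wt * w))
      (fun t => mulL (plug k i m u.wt a (cls k u)) (avoid k i m t)) hr (by
        rw [linearCombination_map (mulL (plug k i m u.wt a (cls k u))) (avoid k i m),
          avoid_relator i m hr, map_zero])
    have h2 := linearCombination_map (mulL (avoid k i m a))
      (fun t => plug k i m u.wt t (cls k u)) r
    rw [ih, map_zero] at h2
    have h3 := congrArg₂ (· + ·) h1 h2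
    simp only [add_zero] at h3
    rw [← linearCombination_add_fun] at h3
    exact h3
  | @mul_right a r hr ih =>
    rw [Finsupp.linearCombination_mapDomain]
    have h1 := linearCombination_map ((-1 : k) ^ (u.wt * a.wt) • mulL.flip (avoid k i m a))
      (fun t => plug k i m u.wt t (cls k u)) r
    have h2 := linearCombination_map (mulL.flip (plug k i m u.wt a (cls k u))) (avoid k i m) r
    rw [ih, map_zero] at h1
    rw [avoid_relator i m hr, map_zero] at h2
    have h3 := congrArg₂ (· + ·) h1 h2
    simp only [add_zero] at h3
    rw [← linearCombination_add_fun] at h3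
    exact h3
  | @br_left a r hr ih =>
    rw [Finsupp.linearCombination_mapDomain]
    have h1 := linearCombination_sign (fun w => (-1 : k) ^ (u.wt * (w + 1)))
      (fun t => brL (plug k i m u.wt a (cls k u)) (avoid k i m t)) hr (by
        rw [linearCombination_map (brL (plug k i m u.wt a (cls k u))) (avoid k i m),
          avoid_relator i m hr, map_zero])
    have h2 := linearCombination_map (brL (avoid k i m a))
      (fun t => plug k i m u.wt t (cls k u)) r
    rw [ih, map_zero] at h2
    have h3 := congrArg₂ (· + ·) h1 h2
    simp only [add_zero] at h3
    rw [← linearCombination_add_fun] at h3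
    exact h3
  | @br_right a r hr ih =>
    rw [Finsupp.linearCombination_mapDomain]
    have h1 := linearCombination_map ((-1 : k) ^ (u.wt * (a.wt + 1)) • brL.flip (avoid k i m a))
      (fun t => plug k i m u.wt t (cls k u)) r
    have h2 := linearCombination_map (brL.flip (plug k i m u.wt a (cls k u))) (avoid k i m) r
    rw [ih, map_zero] at h1
    rw [avoid_relator i m hr, map_zero] at h2
    have h3 := congrArg₂ (· + ·) h1 h2
    simp only [add_zero] at h3
    rw [← linearCombination_add_fun] at h3
    exact h3
  | del _ ih =>
    rw [Finsupp.linearCombination_mapDomain]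
    exact (linearCombination_map delL _ _).trans (by rw [ih, map_zero])

variable (k) in
/-- The span of the words of weight `w` whose multiset of generators is `M`. -/
def multiPart (M : Multiset ℕ) (w : ℕ) : Submodule k (FreeBV k) :=
  Submodule.span k {x | ∃ t : Word, t.vars = M ∧ t.wt = w ∧ x = cls k t}

variable (k) in
/-- The part of weight `w` (that is, of degree `-e * w`) of the `n`-th component of the operad of
`e`-Batalin-Vilkovisky algebras (`e` odd): the span of all expressions containing each of the
generators `x_0, …, x_{n-1}` exactly once. -/
def BV (n w : ℕ) : Submodule k (FreeBV k) := multiPart k (Multiset.range n) w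

theorem cls_mem_multiPart (t : Word) : cls k t ∈ multiPart k t.vars t.wt :=
  Submodule.subset_span ⟨t, rfl, rfl, rfl⟩

theorem multiPart_induction {M : Multiset ℕ} {w : ℕ} {N : Submodule k (FreeBV k)}
    (f : FreeBV k →ₗ[k] FreeBV k)
    (h : ∀ t : Word, t.vars = M → t.wt = w → f (cls k t) ∈ N) {x : FreeBV k}
    (hx : x ∈ multiPart k M w) : f x ∈ N := by
  have : multiPart k M w ≤ N.comap f := by
    refine Submodule.span_le.2 ?_
    rintro _ ⟨t, h1, h2, rfl⟩
    exact h t h1 h2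
  exact this hx

theorem mulL_mem {M N : Multiset ℕ} {w v : ℕ} {x y : FreeBV k} (hx : x ∈ multiPart k M w)
    (hy : y ∈ multiPart k N v) : mulL x y ∈ multiPart k (M + N) (w + v) := by
  refine multiPart_induction (mulL x) (fun t ht hw => ?_) hy
  refine multiPart_induction (mulL.flip (cls k t)) (fun s hs hv => ?_) hx
  subst ht hw hs hv
  rw [LinearMap.flip_apply, mulL_cls]
  exact cls_mem_multiPart (k := k) (.mul s t)

theorem brL_mem {M N : Multiset ℕ} {w v : ℕ} {x y : FreeBV k} (hx : x ∈ multiPart k M w)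
    (hy : y ∈ multiPart k N v) : brL x y ∈ multiPart k (M + N) (w + v + 1) := by
  refine multiPart_induction (brL x) (fun t ht hw => ?_) hy
  refine multiPart_induction (brL.flip (cls k t)) (fun s hs hv => ?_) hx
  subst ht hw hs hv
  rw [LinearMap.flip_apply, brL_cls]
  exact cls_mem_multiPart (k := k) (.br s t)

theorem delL_mem {M : Multiset ℕ} {w : ℕ} {x : FreeBV k} (hx : x ∈ multiPart k M w) :
    delL x ∈ multiPart k M (w + 1) := by
  refine multiPart_induction delL (fun t ht hw => ?_) hx
  subst ht hw
  rw [delL_cls]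
  exact cls_mem_multiPart (k := k) (.del t)

theorem avoid_mem (i m : ℕ) (t : Word) :
    avoid k i m t ∈ multiPart k (t.vars.map (newIndex i m)) t.wt := by
  induction t with
  | one => exact cls_mem_multiPart .one
  | var j =>
    unfold avoid
    split_ifs
    · exact zero_mem _
    · exact cls_mem_multiPart (.var _)
  | mul a b iha ihb => simpa [Word.vars, Word.wt, avoid] using mulL_mem iha ihb
  | br a b iha ihb => simpa [Word.vars, Word.wt, avoid] using brL_mem iha ihb
  | del a iha => exact delL_mem iha

theorem plug_mem (i m : ℕ) (u t : Word) :
    plug k i m u.wt t (cls k u) ∈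
      multiPart k ((t.vars.erase i).map (newIndex i m) + u.vars.map (· + i)) (t.wt + u.wt) := by
  induction t with
  | one => exact zero_mem _
  | var j =>
    unfold plug
    split_ifs with h
    · have := cls_mem_multiPart (k := k) (u.rename (· + i))
      simpa [Word.vars, Word.wt, Word.wt_rename, Word.vars_rename, h] using this
    · exact zero_mem _
  | mul a b iha ihb =>
    by_cases hb : i ∈ b.vars
    · have := mulL_mem (avoid_mem i m a) ihb
      simpa [plug, avoid_eq_zero i m b hb, Word.wt, Word.vars, add_assoc,
        Multiset.erase_add_right_pos _ hb] using this
    · by_cases ha : i ∈ a.vars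
      · have := Submodule.smul_mem _ ((-1 : k) ^ (u.wt * b.wt)) (mulL_mem iha (avoid_mem i m b))
        simpa [plug, plug_eq_zero i m _ b hb, Word.wt, Word.vars, add_right_comm,
          Multiset.erase_add_left_pos _ ha] using this
      · simp [plug, plug_eq_zero i m _ b hb, plug_eq_zero i m _ a ha]
  | br a b iha ihb =>
    by_cases hb : i ∈ b.vars
    · have := brL_mem (avoid_mem i m a) ihb
      simpa [plug, avoid_eq_zero i m b hb, Word.wt, Word.vars, add_assoc, add_comm 1 u.wt,
        Multiset.erase_add_right_pos _ hb] using this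
    · by_cases ha : i ∈ a.vars
      · have := Submodule.smul_mem _ ((-1 : k) ^ (u.wt * (b.wt + 1)))
          (brL_mem iha (avoid_mem i m b))
        simpa [plug, plug_eq_zero i m _ b hb, Word.wt, Word.vars, add_right_comm,
          Multiset.erase_add_left_pos _ ha] using this
      · simp [plug, plug_eq_zero i m _ b hb, plug_eq_zero i m _ a ha]
  | del a iha => simpa [plug, Word.wt, Word.vars, add_right_comm] using delL_mem iha

theorem range_insert {i l m : ℕ} (hi : i < l) :
    ((Multiset.range l).erase i).map (newIndex i m) + (Multiset.range m).map (· + i)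
      = Multiset.range (l + m - 1) := by
  have h1 : (((Multiset.range l).erase i).map (newIndex i m)).Nodup := by
    refine Multiset.Nodup.map_on ?_ ((Multiset.nodup_range l).erase i)
    intro x hx y hy h
    rw [(Multiset.nodup_range l).mem_erase_iff] at hx hy
    unfold newIndex at h
    have := hx.1
    have := hy.1
    split_ifs at h <;> omega
  have h2 : ((Multiset.range m).map (· + i)).Nodup :=
    (Multiset.nodup_range m).map fun x y h => by simpa using h
  refine (Multiset.Nodup.ext ?_ (Multiset.nodup_range _)).2 ?_
  · rw [Multiset.nodup_add]
    refine ⟨h1, h2, Multiset.disjoint_left.2 ?_⟩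
    intro a ha hb
    obtain ⟨x, hx, rfl⟩ := Multiset.mem_map.1 ha
    obtain ⟨y, hy, h⟩ := Multiset.mem_map.1 hb
    rw [(Multiset.nodup_range l).mem_erase_iff] at hx
    rw [Multiset.mem_range] at hy
    have := hx.1
    unfold newIndex at h
    split_ifs at h <;> omega
  · intro a
    simp only [Multiset.mem_add, Multiset.mem_map, (Multiset.nodup_range l).mem_erase_iff,
      Multiset.mem_range, newIndex]
    constructor
    · rintro (⟨x, ⟨h1, h2⟩, rfl⟩ | ⟨x, h1, rfl⟩)
      · split_ifs <;> omega
      · omega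
    · intro h
      by_cases h1 : a < i
      · exact Or.inl ⟨a, by omega, by simp [h1]⟩
      · by_cases h2 : a < i + m
        · exact Or.inr ⟨a - i, by omega, by omega⟩
        · refine Or.inl ⟨a + 1 - m, by omega, ?_⟩
          rw [if_neg (by omega)]
          omega

/-- The partial composition `x ∘_i y = x(id, …, id, y, id, …, id)` of the operad of
Batalin-Vilkovisky algebras, where `y` has `m` inputs and weight `v` and is inserted into the
input `x_i` of `x`. -/
def comp (i m v : ℕ) : FreeBV k →ₗ[k] BV k m v →ₗ[k] FreeBV k :=
  FreeBV.lift (fun t => (plug k i m v t).domRestrict (BV k m v)) fun r hr => by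
    ext ⟨y, hy⟩
    have h : ∀ y : BV k m v,
        Finsupp.linearCombination k (fun t => (plug k i m v t).domRestrict (BV k m v)) r y
        = Finsupp.linearCombination k (fun t => plug k i m v t) r y := by
      intro y
      simp [Finsupp.linearCombination_apply, Finsupp.sum, LinearMap.sum_apply]
    rw [h, LinearMap.zero_apply, ← Submodule.mem_bot k]
    refine multiPart_induction _ (fun u hu hv => ?_) hy
    subst hv
    rw [Submodule.mem_bot]
    have := plug_relator i m u hr
    simpa [Finsupp.linearCombination_apply, Finsupp.sum, LinearMap.sum_apply] using this

theorem comp_cls (i m v : ℕ) (t : Word) (y : BV k m v) :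
    comp i m v (cls k t) y = plug k i m v t y := by
  simp [comp]

theorem comp_mem {i l w m v : ℕ} (hi : i < l) (x : BV k l w) (y : BV k m v) :
    comp i m v x.1 y ∈ BV k (l + m - 1) (w + v) := by
  obtain ⟨x, hx⟩ := x
  refine multiPart_induction ((comp i m v).flip y) (fun t ht hw => ?_) hx
  rw [LinearMap.flip_apply, comp_cls]
  obtain ⟨y, hy⟩ := y
  refine multiPart_induction (plug k i m v t) (fun u hu hv => ?_) hy
  subst hw hv
  have := plug_mem (k := k) i m u t
  rwa [ht, hu, range_insert hi] at this

/-- The operation `x ∘ y = x{y}`, the sum over all `i` of the partial compositions of `x` with `y`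
at the `i`-th input with the sign `(-1)^ε`, `ε = n_y * r + n_x * (degree of y)`; here
`n_x = l - 1`, `n_y = m - 1`, `r` is the number of inputs of `x` after the `i`-th one, and `y` has
degree `-e * v`. -/
def circ (e : ℤ) (l w m v : ℕ) : BV k l w →ₗ[k] BV k m v →ₗ[k] FreeBV k :=
  ∑ i ∈ Finset.range l,
    Int.negOnePow (((m : ℤ) - 1) * ((l : ℤ) - 1 - i) + ((l : ℤ) - 1) * (-e * v)) •
      comp i m v ∘ₗ (BV k l w).subtype

/-- The grading `|x| = (degree of x) + n - 1` for `x` with `n` inputs and weight `w`. -/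
def absDeg (e : ℤ) (n w : ℕ) : ℤ := -e * w + n - 1

/-- The graded Lie bracket `[x, y] = x ∘ y - (-1)^(|x||y|) y ∘ x` on the operad. -/
def lieBracket (e : ℤ) (l w m v : ℕ) : BV k l w →ₗ[k] BV k m v →ₗ[k] FreeBV k :=
  circ e l w m v - Int.negOnePow (absDeg e l w * absDeg e m v) • (circ e m v l w).flip

theorem circ_mem (e : ℤ) {l w m v : ℕ} (x : BV k l w) (y : BV k m v) :
    circ e l w m v x y ∈ BV k (l + m - 1) (w + v) := by
  rw [circ, LinearMap.sum_apply, LinearMap.sum_apply]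
  refine Submodule.sum_mem _ fun i hi => ?_
  have := comp_mem (Finset.mem_range.1 hi) x y
  rcases Int.units_eq_one_or (Int.negOnePow (((m : ℤ) - 1) * ((l : ℤ) - 1 - i) + ((l : ℤ) - 1) * (-e * v)))
    with h | h
  · rw [h]; simpa using this
  · rw [h]; simpa using this

theorem lieBracket_mem (e : ℤ) {l w m v : ℕ} (x : BV k l w) (y : BV k m v) :
    lieBracket e l w m v x y ∈ BV k (l + m - 1) (w + v) := by
  have h1 := circ_mem e x y
  have h2 := circ_mem e y x
  rw [add_comm m l, add_comm v w] at h2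
  unfold lieBracket
  rcases Int.units_eq_one_or (Int.negOnePow (absDeg e l w * absDeg e m v)) with h | h
  · rw [h]; simpa using sub_mem h1 h2
  · rw [h]; simpa using add_mem h1 h2

variable (k) in
/-- The multiplication `m = x_0 x_1`, the image of the product of the associative operad. -/
def mulElt : BV k 2 0 :=
  ⟨cls k (.mul (.var 0) (.var 1)), Submodule.subset_span ⟨_, by decide, rfl, rfl⟩⟩

/-- The Hochschild differential `∂ x = [m, x]`. -/
def bdry (e : ℤ) (n w : ℕ) : BV k n w →ₗ[k] BV k (n + 1) w :=
  (lieBracket e 2 0 n w (mulElt k)).codRestrict (BV k (n + 1) w) fun x => by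
    have := lieBracket_mem e (mulElt k) x
    rwa [show 2 + n - 1 = n + 1 by omega, zero_add] at this

/-- Substitution of words for the generators. -/
def Word.bind (f : ℕ → Word) : Word → Word
  | .one => .one
  | .var j => f j
  | .mul a b => .mul (bind f a) (bind f b)
  | .br a b => .br (bind f a) (bind f b)
  | .del a => .del (bind f a)

theorem Word.bind_bind (f g : ℕ → Word) (t : Word) :
    (t.bind f).bind g = t.bind fun j => (f j).bind g := by
  induction t <;> simp_all [Word.bind]

theorem Word.rename_eq_bind (f : ℕ → ℕ) (t : Word) : t.rename f = t.bind fun j => .var (f j) := by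
  induction t <;> simp_all [Word.bind, Word.rename]

theorem cls_bind_congr (t : Word) {f g : ℕ → Word}
    (h : ∀ j ∈ t.vars, cls k (f j) = cls k (g j)) : cls k (t.bind f) = cls k (t.bind g) := by
  induction t with
  | one => rfl
  | var j => exact h j (by simp [Word.vars])
  | mul a b iha ihb =>
    simp only [Word.bind, ← mulL_cls]
    rw [iha fun j hj => h j (by simp [Word.vars, hj]), ihb fun j hj => h j (by simp [Word.vars, hj])]
  | br a b iha ihb =>
    simp only [Word.bind, ← brL_cls]
    rw [iha fun j hj => h j (by simp [Word.vars, hj]), ihb fun j hj => h j (by simp [Word.vars, hj])]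
  | del a iha =>
    simp only [Word.bind, ← delL_cls]
    rw [iha h]

theorem Word.bind_var (t : Word) : t.bind Word.var = t := by
  induction t <;> simp_all [Word.bind]

/-- Doubling of the `i`-th input. -/
def dbl (i j : ℕ) : Word :=
  if j < i then .var j else if j = i then .mul (.var j) (.var (j + 1)) else .var (j + 1)

/-- The `i`-th coface of a word with `n` inputs. -/
def face (n i : ℕ) (t : Word) : Word :=
  if i = 0 then .mul (.var 0) (t.bind fun j => .var (j + 1))
  else if i = n + 1 then .mul t (.var n) else t.bind (dbl (i - 1))

theorem cls_mul_assoc (a b c : Word) : cls k (.mul (.mul a b) c) = cls k (.mul a (.mul b c)) := by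
  simp only [← mulL_cls, IsMono.mul_assoc]

theorem cls_mul_congr {a b c d : Word} (h : cls k a = cls k c) (h' : cls k b = cls k d) :
    cls k (.mul a b) = cls k (.mul c d) := by
  simp only [← mulL_cls, h, h']

theorem face_face {n i j : ℕ} (hij : i < j) (hj : j ≤ n + 2) (t : Word)
    (ht : ∀ x ∈ t.vars, x < n) :
    cls k (face (n + 1) j (face n i t)) = cls k (face (n + 1) i (face n (j - 1) t)) := by
  rcases Nat.eq_zero_or_pos i with rfl | hi
  · rcases Nat.lt_or_ge 1 j with h1 | h1
    · rcases Nat.lt_or_ge j (n + 2) with h2 | h2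
      · simp only [face, if_true, if_neg (show ¬ j = 0 by omega),
          if_neg (show ¬ j = n + 1 + 1 by omega), if_neg (show ¬ j - 1 = 0 by omega),
          if_neg (show ¬ j - 1 = n + 1 by omega), Word.bind, Word.bind_bind]
        refine cls_mul_congr ?_ (cls_bind_congr t fun x _ => ?_)
        · simp [dbl, show 0 < j - 1 by omega]
        · unfold dbl
          split_ifs <;> first | omega | rfl
      · obtain rfl : j = n + 2 := by omega
        simp only [face, if_true, Word.bind, show n + 2 - 1 = n + 1 by omega,
          if_neg (show ¬ n + 2 = 0 by omega), if_neg (show ¬ n + 1 = 0 by omega)]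
        exact cls_mul_assoc _ _ _
    · obtain rfl : j = 1 := by omega
      simp only [face, if_true, Word.bind, Word.bind_bind, if_neg (show ¬ 1 = 0 by omega),
        if_neg (show ¬ 1 = n + 1 + 1 by omega), Nat.sub_self]
      rw [show dbl 0 0 = .mul (.var 0) (.var 1) by rfl, cls_mul_assoc]
      rfl
  · rcases Nat.lt_or_ge j (n + 2) with h2 | h2
    · simp only [face, if_neg (show ¬ j = 0 by omega), if_neg (show ¬ i = 0 by omega),
        if_neg (show ¬ j = n + 1 + 1 by omega), if_neg (show ¬ j - 1 = 0 by omega),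
        if_neg (show ¬ j - 1 = n + 1 by omega), if_neg (show ¬ i = n + 1 by omega),
        if_neg (show ¬ i = n + 1 + 1 by omega), Word.bind_bind]
      refine cls_bind_congr t fun x _ => ?_
      by_cases hx : x = i - 1 ∧ j - 1 = i
      · obtain ⟨rfl, h⟩ := hx
        simp [dbl, Word.bind, h, hi, show i - 1 + 1 = i by omega, cls_mul_assoc,
          show ¬ i < i - 1 by omega, show ¬ i = i - 1 by omega]
      · unfold dbl
        split_ifs <;> simp only [Word.bind] <;> split_ifs <;> first | rfl | omega
    · obtain rfl : j = n + 2 := by omega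
      simp only [face, if_neg (show ¬ n + 2 = 0 by omega), if_neg (show ¬ i = 0 by omega),
        if_neg (show ¬ n + 1 = 0 by omega), if_neg (show ¬ i = n + 1 + 1 by omega),
        show n + 2 - 1 = n + 1 by omega, if_true]
      by_cases h3 : i = n + 1
      · subst h3
        simp only [if_true, Word.bind, Nat.add_sub_cancel]
        rw [show dbl n n = .mul (.var n) (.var (n + 1)) by simp [dbl], cls_mul_assoc]
        refine cls_mul_congr ?_ rfl
        conv_lhs => rw [← Word.bind_var t]
        refine cls_bind_congr t fun x hx => ?_
        simp [dbl, ht x hx]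
      · simp only [if_neg h3, Word.bind]
        refine cls_mul_congr rfl ?_
        have : ¬ n < i - 1 := by omega
        have : ¬ n = i - 1 := by omega
        simp [dbl, *]

theorem alternating_sum_eq_zero {M : Type*} [AddCommGroup M] (N : ℕ) (f : ℕ → ℕ → M)
    (h : ∀ i j, i < j → j ≤ N → f i j = f (j - 1) i) :
    ∑ i ∈ Finset.range N, ∑ j ∈ Finset.range (N + 1), (-1 : ℤ) ^ (i + j) • f i j = 0 := by
  rw [← Finset.sum_product']
  refine Finset.sum_involution
    (fun a _ => if a.1 < a.2 then (a.2 - 1, a.1) else (a.2, a.1 + 1)) ?_ ?_ ?_ ?_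
  · rintro ⟨i, j⟩ ha
    simp only [Finset.mem_product, Finset.mem_range] at ha
    dsimp only
    split_ifs with hij
    · dsimp only
      rw [← h i j hij (by omega), ← add_smul,
        show i + j = (j - 1 + i) + 1 by omega, pow_succ]
      simp
    · dsimp only
      rw [h j (i + 1) (by omega) (by omega), Nat.add_sub_cancel, ← add_smul, ← add_assoc, pow_succ, add_comm j i]
      simp
  · rintro ⟨i, j⟩ _ _
    dsimp only
    split_ifs with hij <;> simp only [ne_eq, Prod.mk.injEq, not_and] <;> omega
  · rintro ⟨i, j⟩ ha
    simp only [Finset.mem_product, Finset.mem_range] at ha ⊢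
    split_ifs with hij <;> dsimp only <;> omega
  · rintro ⟨i, j⟩ ha
    by_cases hij : i < j
    · simp only [if_pos hij, if_neg (show ¬ j - 1 < i by omega), Prod.mk.injEq, true_and]
      omega
    · simp only [if_neg hij, if_pos (show j < i + 1 by omega), Nat.add_sub_cancel]

theorem avoid_eq_cls (i : ℕ) (t : Word) (h : i ∉ t.vars) :
    avoid k i 2 t = cls k (t.bind (dbl i)) := by
  induction t with
  | one => rfl
  | var j =>
    have h' : j ≠ i := by simpa [Word.vars, eq_comm] using h
    simp only [avoid, if_neg h', Word.bind, dbl, newIndex]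
    split_ifs <;> rfl
  | mul a b iha ihb =>
    simp only [Word.vars, Multiset.mem_add, not_or] at h
    simp [avoid, iha h.1, ihb h.2, Word.bind]
  | br a b iha ihb =>
    simp only [Word.vars, Multiset.mem_add, not_or] at h
    simp [avoid, iha h.1, ihb h.2, Word.bind]
  | del a iha => simp [avoid, iha h, Word.bind]

theorem plug_mulElt (i : ℕ) (t : Word) (h : t.vars.count i = 1) :
    plug k i 2 0 t (mulElt k) = cls k (t.bind (dbl i)) := by
  induction t with
  | one => simp [Word.vars] at h
  | var j =>
    have h' : i = j := by
      by_contra hne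
      simp [Word.vars, hne] at h
    subst h'
    simp [plug, mulElt, Word.bind, dbl, Word.rename, add_comm]
  | mul a b iha ihb =>
    simp only [Word.vars, Multiset.count_add] at h
    by_cases hb : i ∈ b.vars
    · have := Multiset.count_pos.2 hb
      have ha : i ∉ a.vars := Multiset.count_eq_zero.1 (by omega)
      simp [plug, avoid_eq_zero i 2 b hb, ihb (by omega), avoid_eq_cls i a ha, Word.bind]
    · have hb' := Multiset.count_eq_zero.2 hb
      simp [plug, plug_eq_zero i 2 0 b hb, iha (by omega), avoid_eq_cls i b hb, Word.bind]
  | br a b iha ihb =>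
    simp only [Word.vars, Multiset.count_add] at h
    by_cases hb : i ∈ b.vars
    · have := Multiset.count_pos.2 hb
      have ha : i ∉ a.vars := Multiset.count_eq_zero.1 (by omega)
      simp [plug, avoid_eq_zero i 2 b hb, ihb (by omega), avoid_eq_cls i a ha, Word.bind]
    · have hb' := Multiset.count_eq_zero.2 hb
      simp [plug, plug_eq_zero i 2 0 b hb, iha (by omega), avoid_eq_cls i b hb, Word.bind]
  | del a iha => simp [plug, iha h, Word.bind]

theorem cls_mem_BV {t : Word} {n w : ℕ} (hv : t.vars = Multiset.range n) (hw : t.wt = w) :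
    cls k t ∈ BV k n w := Submodule.subset_span ⟨t, hv, hw, rfl⟩

theorem negOnePow_smul_eq {M : Type*} [AddCommGroup M] (n : ℕ) (x : M) :
    Int.negOnePow (n : ℤ) • x = (-1 : ℤ) ^ n • x := by
  rw [Int.negOnePow_def, zpow_natCast, Units.smul_def]
  simp

theorem bdry_cls (e : ℤ) {n w : ℕ} (t : Word) (hv : t.vars = Multiset.range n) (hw : t.wt = w) :
    (bdry e n w ⟨cls k t, cls_mem_BV hv hw⟩ : FreeBV k) =
      Int.negOnePow (-e * w) •
        ∑ i ∈ Finset.range (n + 2), (-1 : ℤ) ^ i • cls k (face n i t) := by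
  have h1 : ∀ i ∈ Finset.range n, plug k i 2 0 t (mulElt k) = cls k (face n (i + 1) t) := by
    intro i hi
    have hi' := Finset.mem_range.1 hi
    rw [plug_mulElt i t (by
      rw [hv, Multiset.count_eq_one_of_mem (Multiset.nodup_range n) (Multiset.mem_range.2 hi')])]
    simp [face, hi'.ne]
  have hs0 : ∀ x : FreeBV k, Int.negOnePow ((n : ℤ) - 1) • x = (-1 : ℤ) ^ (n + 1) • x := by
    intro x
    rw [← negOnePow_smul_eq]
    congr 1
    rw [Int.negOnePow_eq_iff]
    push_cast
    exact ⟨-1, by ring⟩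
  have hs1 : ∀ i : ℕ, ∀ x : FreeBV k,
      Int.negOnePow (absDeg e 2 0 * absDeg e n w) •
        Int.negOnePow ((((2 : ℕ) : ℤ) - 1) * ((n : ℤ) - 1 - i) + ((n : ℤ) - 1) * (-e * (0 : ℕ))) • x
      = Int.negOnePow (-e * w) • (-1 : ℤ) ^ i • x := by
    intro i x
    rw [← negOnePow_smul_eq, smul_smul, smul_smul, ← Int.negOnePow_add, ← Int.negOnePow_add]
    congr 1
    rw [Int.negOnePow_eq_iff]
    refine ⟨(n : ℤ) - 1 - i, ?_⟩
    simp only [absDeg]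
    push_cast
    ring
  rw [Finset.sum_range_succ, Finset.sum_range_succ', smul_add, smul_add]
  simp only [bdry, LinearMap.codRestrict_apply, lieBracket, LinearMap.sub_apply, circ,
    LinearMap.sum_apply, LinearMap.smul_apply, LinearMap.comp_apply, Submodule.subtype_apply,
    LinearMap.flip_apply, Finset.sum_range_succ, Finset.sum_range_zero, zero_add, Finset.smul_sum]
  have hA : comp 0 n w (mulElt k : FreeBV k) ⟨cls k t, cls_mem_BV hv hw⟩
      = cls k (face n (n + 1) t) := by
    have : t.rename (fun x => x) = t := by
      rw [Word.rename_eq_bind]; exact Word.bind_var t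
    rw [mulElt, comp_cls]
    simp [plug, avoid, Word.wt, face, newIndex, this]
  have hB : comp 1 n w (mulElt k : FreeBV k) ⟨cls k t, cls_mem_BV hv hw⟩
      = cls k (face n 0 t) := by
    rw [mulElt, comp_cls]
    simp [plug, avoid, face, newIndex, Word.rename_eq_bind]
  have hC : ∀ i ∈ Finset.range n, (Int.negOnePow (absDeg e 2 0 * absDeg e n w) •
        Int.negOnePow ((((2 : ℕ) : ℤ) - 1) * ((n : ℤ) - 1 - i) + ((n : ℤ) - 1) * (-e * (0 : ℕ))) •
          comp i 2 0 (cls k t) (mulElt k))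
      = -(Int.negOnePow (-e * w) • (-1 : ℤ) ^ (i + 1) • cls k (face n (i + 1) t)) := by
    intro i hi
    rw [hs1, comp_cls, h1 i hi, pow_succ, mul_neg, mul_one, neg_smul, smul_neg, neg_neg]
  rw [Finset.sum_congr rfl hC, Finset.sum_neg_distrib, sub_neg_eq_add]
  simp only [LinearMap.add_apply, LinearMap.smul_apply, LinearMap.comp_apply,
    Submodule.subtype_apply, hA, hB]
  rw [show (((n : ℤ) - 1) * (((2 : ℕ) : ℤ) - 1 - ((0 : ℕ) : ℤ))
      + (((2 : ℕ) : ℤ) - 1) * (-e * w)) = -e * w + ((n : ℤ) - 1) by push_cast; ring,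
    show (((n : ℤ) - 1) * (((2 : ℕ) : ℤ) - 1 - ((1 : ℕ) : ℤ))
      + (((2 : ℕ) : ℤ) - 1) * (-e * w)) = -e * w by push_cast; ring,
    Int.negOnePow_add, ← smul_smul, hs0, pow_zero, one_smul]
  abel

theorem face_vars {n i : ℕ} (hi : i ≤ n + 1) {t : Word} (hv : t.vars = Multiset.range n) :
    (face n i t).vars = Multiset.range (n + 1) := by
  have hr : (t.bind fun j => .var (j + 1)).vars = t.vars.map (· + 1) := by
    rw [← Word.rename_eq_bind, Word.vars_rename]
  unfold face
  split_ifs with h1 h2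
  · simp only [Word.vars]
    rw [hr, hv]
    refine (Multiset.Nodup.ext ?_ (Multiset.nodup_range _)).2 fun a => ?_
    · simpa [Multiset.nodup_cons] using
        (Multiset.nodup_range n).map fun x y h => by simpa using h
    · simp only [Multiset.mem_add, Multiset.mem_singleton, Multiset.mem_map, Multiset.mem_range]
      constructor
      · rintro (rfl | ⟨x, hx, rfl⟩) <;> omega
      · intro h
        rcases Nat.eq_zero_or_pos a with rfl | ha
        · exact Or.inl rfl
        · exact Or.inr ⟨a - 1, by omega, by omega⟩
  · rw [Word.vars, hv, Word.vars, add_comm, Multiset.range_succ]; rfl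
  · have hd : ∀ t : Word, (t.bind (dbl (i - 1))).vars
        = t.vars.bind fun j => (dbl (i - 1) j).vars := by
      intro t
      induction t <;> simp_all [Word.bind, Word.vars]
    rw [hd, hv]
    have hlt : i - 1 < n := by omega
    have h := range_insert (m := 2) hlt
    rw [show n + 2 - 1 = n + 1 by omega] at h
    rw [← h]
    conv_lhs => rw [← Multiset.cons_erase (Multiset.mem_range.2 hlt)]
    rw [Multiset.cons_bind, add_comm]
    congr 1
    · rw [← Multiset.bind_singleton]
      refine Multiset.bind_congr fun j hj => ?_
      have := ((Multiset.nodup_range n).mem_erase_iff.1 hj).1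
      simp only [dbl, newIndex]
      split_ifs <;> rfl
    · have h2 : Multiset.range 2 = {0} + {1} := rfl
      rw [h2]
      simp [dbl, Word.vars, add_comm, -Multiset.singleton_add]

theorem face_wt (n i : ℕ) (t : Word) : (face n i t).wt = t.wt := by
  have hb : ∀ (f : ℕ → Word), (∀ j, (f j).wt = 0) → ∀ t : Word, (t.bind f).wt = t.wt := by
    intro f hf t
    induction t <;> simp_all [Word.bind, Word.wt]
  unfold face
  split_ifs
  · simp only [Word.wt, zero_add]
    exact hb _ (fun _ => rfl) t
  · rfl
  · refine hb _ (fun j => ?_) t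
    unfold dbl
    split_ifs <;> rfl

theorem bdry_bdry (e : ℤ) (n w : ℕ) : bdry (k := k) e (n + 1) w ∘ₗ bdry e n w = 0 := by
  refine LinearMap.ext fun x => Subtype.ext ?_
  obtain ⟨x, hx⟩ := x
  suffices h : ∀ t : Word, ∀ (hv : t.vars = Multiset.range n) (hw : t.wt = w),
      bdry e (n + 1) w (bdry e n w ⟨cls k t, cls_mem_BV hv hw⟩) = 0 by
    induction hx using Submodule.span_induction with
    | mem x hx =>
      obtain ⟨t, hv, hw, rfl⟩ := hx
      exact congrArg Subtype.val (h t hv hw)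
    | zero =>
      have : (⟨0, zero_mem _⟩ : BV k n w) = 0 := rfl
      simp [this]
    | add x y hx hy h1 h2 =>
      have : (⟨x + y, add_mem hx hy⟩ : BV k n w) = ⟨x, hx⟩ + ⟨y, hy⟩ := rfl
      have e1 := congrArg₂ (· + ·) h1 h2
      simpa [this] using e1
    | smul c x hx h1 =>
      have : (⟨c • x, Submodule.smul_mem _ c hx⟩ : BV k n w) = c • ⟨x, hx⟩ := rfl
      have e1 := congrArg (c • ·) h1
      simpa [this] using e1
  intro t hv hw
  have hf : ∀ i ∈ Finset.range (n + 2), (face n i t).vars = Multiset.range (n + 1) :=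
    fun i hi => face_vars (by have := Finset.mem_range.1 hi; omega) hv
  have key : bdry e n w ⟨cls k t, cls_mem_BV hv hw⟩ = Int.negOnePow (-e * w) •
      ∑ i ∈ (Finset.range (n + 2)).attach, (-1 : ℤ) ^ i.1 •
        (⟨cls k (face n i.1 t), cls_mem_BV (hf i.1 i.2) ((face_wt n i.1 t).trans hw)⟩ :
          BV k (n + 1) w) := by
    apply Subtype.ext
    rw [bdry_cls e t hv hw, ← Finset.sum_attach (Finset.range (n + 2))]
    simp [Units.smul_def]
  rw [key]
  have hlin : ∀ (u : ℤˣ) (x : BV k (n + 1) w), bdry e (n + 1) w (u • x)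
      = u • bdry e (n + 1) w x := by
    intro u x
    rw [Units.smul_def, Units.smul_def, map_zsmul]
  rw [hlin, map_sum]
  have hz : ∑ i ∈ (Finset.range (n + 2)).attach, bdry e (n + 1) w ((-1 : ℤ) ^ i.1 •
        (⟨cls k (face n i.1 t), cls_mem_BV (hf i.1 i.2) ((face_wt n i.1 t).trans hw)⟩ :
          BV k (n + 1) w)) = 0 := by
    apply Subtype.ext
    rw [Submodule.coe_sum]
    have hs := alternating_sum_eq_zero (n + 2)
      (fun i j => cls k (face (n + 1) j (face n i t))) fun i j hij hj => face_face hij hj t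
        fun x hx => by rw [hv] at hx; exact Multiset.mem_range.1 hx
    have : ∀ i : {i // i ∈ Finset.range (n + 2)}, (bdry e (n + 1) w ((-1 : ℤ) ^ i.1 •
        (⟨cls k (face n i.1 t), cls_mem_BV (hf i.1 i.2) ((face_wt n i.1 t).trans hw)⟩ :
          BV k (n + 1) w)) : FreeBV k) = Int.negOnePow (-e * w) •
        ∑ j ∈ Finset.range (n + 3), (-1 : ℤ) ^ (i.1 + j) •
          cls k (face (n + 1) j (face n i.1 t)) := by
      intro i
      rw [map_zsmul, Submodule.coe_smul_of_tower,
        bdry_cls e (face n i.1 t) (hf i.1 i.2) ((face_wt n i.1 t).trans hw), smul_comm,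
        Finset.smul_sum]
      simp only [smul_smul, pow_add]
    rw [Finset.sum_congr rfl fun i _ => this i, ← Finset.smul_sum,
      Finset.sum_attach (Finset.range (n + 2)) (fun i => ∑ j ∈ Finset.range (n + 3),
        (-1 : ℤ) ^ (i + j) • cls k (face (n + 1) j (face n i t))), hs, smul_zero]
    rfl
  rw [hz, smul_zero]

/-- Pairs `(n, w)` such that elements with `n` inputs and weight `w`, hence of degree `-e * w`, have
`deg = |x| + 1 = -e * w + n` equal to `p`. -/
@[ext]
structure Idx (e p : ℤ) : Type where
  n : ℕ
  w : ℕ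
  deg_eq : -e * w + n = p

instance (e p : ℤ) : DecidableEq (Idx e p) := fun a b =>
  decidable_of_iff (a.n = b.n ∧ a.w = b.w) Idx.ext_iff.symm

/-- The index of `∂ x` for `x` of index `a`. -/
abbrev Idx.next {e p : ℤ} (a : Idx e p) : Idx e (p + 1) :=
  ⟨a.n + 1, a.w, by have := a.deg_eq; push_cast; linarith⟩

variable (k) in
/-- The part of `deg = p` of the total space `⨁ n, BV_e(n)` of the operad. -/
def Total (e p : ℤ) : Type u := DirectSum (Idx e p) fun a => BV k a.n a.w

instance (e p : ℤ) : AddCommGroup (Total k e p) :=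
  inferInstanceAs (AddCommGroup (DirectSum (Idx e p) fun a => BV k a.n a.w))

instance (e p : ℤ) : Module k (Total k e p) :=
  inferInstanceAs (Module k (DirectSum (Idx e p) fun a => BV k a.n a.w))

variable (k) in
/-- The inclusion of a summand into the total space. -/
def Total.incl {e p : ℤ} (a : Idx e p) : BV k a.n a.w →ₗ[k] Total k e p :=
  DirectSum.lof k (Idx e p) (fun a => BV k a.n a.w) a

variable (k) in
/-- The Hochschild differential on the total space of the operad. -/
def totalBdry (e p : ℤ) : Total k e p →ₗ[k] Total k e (p + 1) :=
  DirectSum.toModule k (Idx e p) (Total k e (p + 1)) fun a =>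
    Total.incl k a.next ∘ₗ bdry e a.n a.w

theorem totalBdry_incl {e p : ℤ} (a : Idx e p) (x : BV k a.n a.w) :
    totalBdry k e p (Total.incl k a x) = Total.incl k a.next (bdry e a.n a.w x) :=
  DirectSum.toModule_lof k (M := fun a : Idx e p => BV k a.n a.w) (N := Total k e (p + 1))
    (φ := fun a => Total.incl k a.next ∘ₗ bdry e a.n a.w) a x

theorem totalBdry_totalBdry (e p : ℤ) : totalBdry k e (p + 1) ∘ₗ totalBdry k e p = 0 := by
  refine DirectSum.linearMap_ext k fun a => LinearMap.ext fun x => ?_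
  have h : bdry e (a.n + 1) a.w (bdry e a.n a.w x) = 0 :=
    LinearMap.congr_fun (bdry_bdry e a.n a.w) x
  change totalBdry k e (p + 1) (totalBdry k e p (Total.incl k a x)) = 0
  rw [totalBdry_incl, totalBdry_incl]
  exact (congrArg (Total.incl k a.next.next) h).trans (map_zero _)

open CategoryTheory

variable (k) in
/-- The Hochschild complex of the operad of `e`-Batalin-Vilkovisky algebras (`e` odd) over `k`,
graded by `deg`. -/
def hochschild (e : ℤ) : CochainComplex (ModuleCat.{u} k) ℤ :=
  CochainComplex.of (fun p => ModuleCat.of k (Total k e p))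
    (fun p => ModuleCat.ofHom (totalBdry k e p)) fun p => by
      rw [← ModuleCat.ofHom_comp, totalBdry_totalBdry]; rfl

/-- A family of submodules of the Hochschild complex is invariant under the differential. -/
def Invariant {e : ℤ} (S : ∀ p, Submodule k (Total k e p)) : Prop :=
  ∀ p, ∀ x ∈ S p, totalBdry k e p x ∈ S (p + 1)

/-- The subcomplex of the Hochschild complex given by an invariant family of submodules. -/
def subcomplex {e : ℤ} (S : ∀ p, Submodule k (Total k e p)) (hS : Invariant S) :
    CochainComplex (ModuleCat.{u} k) ℤ :=
  CochainComplex.of (fun p => ModuleCat.of k (S p))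
    (fun p => ModuleCat.ofHom ((totalBdry k e p).restrict (hS p))) fun p => by
      rw [← ModuleCat.ofHom_comp]
      ext x
      exact LinearMap.congr_fun (totalBdry_totalBdry e p) x.1

/-- The inclusion of a subcomplex. -/
def inclusion {e : ℤ} (S : ∀ p, Submodule k (Total k e p)) (hS : Invariant S) :
    subcomplex S hS ⟶ hochschild k e :=
  CochainComplex.ofHom (fun p => ModuleCat.ofHom (S p).subtype) fun p => by
    simp only [subcomplex, hochschild, CochainComplex.of_d]
    rfl

/-- A star-partition of the set of the `n` inputs `0, …, n-1`: a partition together with a subset,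
whose elements are called stars. -/
structure StarPartition (n : ℕ) where
  parts : Finpartition (Finset.range n)
  stars : Finset ℕ
  stars_subset : stars ⊆ Finset.range n

/-- The number of singletons of a star-partition not marked by a star. -/
def StarPartition.unstarred {n : ℕ} (P : StarPartition n) : ℕ :=
  {i ∈ Finset.range n | {i} ∈ P.parts.parts ∧ i ∉ P.stars}.card

namespace Word

/-- A word is a bracket (possibly trivial) in the letters `x_i` and `δ(x_i)`. -/
def IsBracket : Word → Prop
  | var _ => True
  | del (var _) => True
  | br a b => IsBracket a ∧ IsBracket b
  | _ => False

/-- The indices `i` that occur as `δ(x_i)`. -/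
def stars : Word → Finset ℕ
  | one => ∅
  | var _ => ∅
  | mul a b => stars a ∪ stars b
  | br a b => stars a ∪ stars b
  | del (var i) => {i}
  | del a => stars a

/-- The product of a list of words. -/
def prod : List Word → Word := List.foldr mul one

end Word

variable (k) in
/-- The part of weight `w` of the summand `BV(A, S, n)` of a star-partition: the span of the products
of brackets in `x_i` and `δ(x_i)`, one bracket for each block of the partition and containing
exactly the indices from this block (each of them once), where `i` is presented by `δ(x_i)` if and
only if it is a star. -/
def summand {n : ℕ} (P : StarPartition n) (w : ℕ) : Submodule k (FreeBV k) :=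
  Submodule.span k {x | ∃ L : List Word, (∀ b ∈ L, b.IsBracket) ∧
    (Word.prod L).vars = Multiset.range n ∧
    (L.map fun b => b.vars.toFinset : Multiset (Finset ℕ)) = P.parts.parts.val ∧
    (Word.prod L).stars = P.stars ∧ (Word.prod L).wt = w ∧ x = cls k (Word.prod L)}

variable (k) in
/-- The subspace `E_i` (in `deg = p`): the sum of the summands over all star-partitions having
exactly `i` singletons not marked by a star. -/
def E (e : ℤ) (i : ℕ) (p : ℤ) : Submodule k (Total k e p) :=
  ⨆ (a : Idx e p) (P : StarPartition a.n) (_ : P.unstarred = i),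
    ((summand k P a.w).comap (BV k a.n a.w).subtype).map
      (Total.incl k a)

variable (k) in
/-- The subspace `F_i`, the sum of all `E_j` with `j ≥ i` (in `deg = p`). -/
def F (e : ℤ) (i : ℕ) (p : ℤ) : Submodule k (Total k e p) := ⨆ j ≥ i, E k e j p

end HochschildBV

end

noncomputable section

namespace HochschildBV

/-! For a fixed weight `w` the modules `BV k n w` form a cosimplicial module. The outer cofaces
multiply by a new first or last generator, the inner ones substitute a product of two generators for
one generator, and the codegeneracies substitute the unit for a generator. Up to the sign
`(-1)^(e*w)`, which is constant along the complex, `∂` is the alternating sum of the cofaces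
(`bdry_eq`). The proposition thus becomes the normalization theorem for cosimplicial modules, once
`E_0` is recognized as the normalized part, the common kernel of the codegeneracies.

The normalization is explicit. The map `step q`, which is the identity minus `(-1)^q (∂ s_q + s_q
∂)`, is a chain map homotopic to the identity; it sends elements killed by the first `q`
codegeneracies to elements killed by the first `q + 1` (`step_mem`) and fixes normalized elements.
Composing the steps gives a projection onto the normalized part, and the homotopies add up
(`homotopy_spec`).

The identification of `E_0` and `F_1` rests on three facts. By the Leibniz rules, the derivation
property of `δ` on brackets and `δ² = 0`, every word is a combination of products of brackets in the
letters `x_i` and `δ(x_i)` (`cls_mem_bracketSpan`). Since `[1, x] = 0` and `δ(1) = 0`, substituting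
`1` for `x_i` kills such a product unless `x_i` itself is a factor (`codegL_prod`); so `E_0` is
normalized, while `F_1` is the span `factorPart` of the words with a generator as a factor. Finally,
the operators "put `x_i = 1`, then multiply by `x_i`" commute; the product of their complements `1 -
extract k i` is the identity on normalized elements and zero on `factorPart`, so these two meet
trivially (`disjoint_normalized_factorPart`). As all star-partitions together span, they are
complementary and `E_0` is the whole normalized part.

Cofaces preserve factors, so `F_1` is a subcomplex. Compressing the homotopy by the projection onto
`F_1` along `E_0` contracts it. -/

/-! ### Normalization of cosimplicial modules. -/

/-- A cosimplicial module, given by cofaces and codegeneracies.  The codegeneracies are extended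
by zero to all indices. -/
structure CosimplicialModule (k : Type*) [CommRing k] (M : ℕ → Type*)
    [∀ n, AddCommGroup (M n)] [∀ n, Module k (M n)] where
  d : ∀ n, ℕ → M n →ₗ[k] M (n + 1)
  s : ∀ n, ℕ → M (n + 1) →ₗ[k] M n
  s_eq_zero : ∀ {n i}, n < i → s n i = 0
  d_d : ∀ {n i j} (x), i < j → j ≤ n + 2 → d (n + 1) j (d n i x) = d (n + 1) i (d n (j - 1) x)
  s_d_lt : ∀ {n i j} (x), j ≤ i → i ≤ n → s (n + 1) (i + 1) (d (n + 1) j x) = d n j (s n i x)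
  s_d_self : ∀ {n i} (x), i ≤ n → s n i (d n i x) = x
  s_d_succ : ∀ {n i} (x), i ≤ n → s n i (d n (i + 1) x) = x
  s_d_gt : ∀ {n i j} (x), i < j → j ≤ n + 1 →
    s (n + 1) i (d (n + 1) (j + 1) x) = d n j (s n i x)
  s_s : ∀ {n i j} (x), i ≤ j → j ≤ n → s n j (s (n + 1) i x) = s n i (s (n + 1) (j + 1) x)

/-- The equal terms `q` and `q + 1` have opposite signs and cancel; shifting the index of the later
terms costs one sign. Used for `g j = s_q d_j x`, where `s_q d_q = s_q d_{q+1} = 1`. -/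
theorem alternating_sum_of_eq {M : Type*} [AddCommGroup M] {q N : ℕ} (g : ℕ → M) (hq : q < N)
    (h0 : ∀ i < q, g i = 0) (h1 : g q = g (q + 1)) :
    ∑ i ∈ Finset.range (N + 1), (-1 : ℤ) ^ i • g i
      = -∑ j ∈ Finset.Ico (q + 1) N, (-1 : ℤ) ^ j • g (j + 1) := by
  rw [Finset.range_eq_Ico, ← Finset.sum_Ico_consecutive _ (Nat.zero_le q) (by omega),
    Finset.sum_eq_zero fun i hi => by rw [h0 i (Finset.mem_Ico.1 hi).2, smul_zero], zero_add,
    Finset.sum_eq_sum_Ico_succ_bot (by omega), Finset.sum_eq_sum_Ico_succ_bot (by omega), ← h1,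
    ← add_assoc, pow_succ, mul_neg_one, neg_smul, add_neg_cancel, zero_add,
    ← Finset.sum_Ico_add' (fun i => (-1 : ℤ) ^ i • g i) (q + 1) N 1, ← Finset.sum_neg_distrib]
  exact Finset.sum_congr rfl fun j _ => by rw [pow_succ, mul_neg_one, neg_smul]

namespace CosimplicialModule

variable {k : Type*} [CommRing k] {M : ℕ → Type*} [∀ n, AddCommGroup (M n)]
  [∀ n, Module k (M n)] (X : CosimplicialModule k M)

/-- The alternating sum of the cofaces. -/
def bdry (n : ℕ) : M n →ₗ[k] M (n + 1) := ∑ i ∈ Finset.range (n + 2), (-1 : ℤ) ^ i • X.d n i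

theorem bdry_apply {n : ℕ} (x : M n) :
    X.bdry n x = ∑ i ∈ Finset.range (n + 2), (-1 : ℤ) ^ i • X.d n i x := by
  simp [bdry, LinearMap.sum_apply]

theorem bdry_bdry {n : ℕ} (x : M n) : X.bdry (n + 1) (X.bdry n x) = 0 := by
  rw [bdry_apply X x, map_sum, ← alternating_sum_eq_zero (n + 2)
    (fun i j => X.d (n + 1) j (X.d n i x)) fun i j hij hj => X.d_d x hij hj]
  refine Finset.sum_congr rfl fun i _ => ?_
  rw [map_zsmul, bdry_apply, Finset.smul_sum]
  simp only [smul_smul, pow_add]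

/-- The elements killed by the first `q` codegeneracies. -/
def partialKer (q : ℕ) : ∀ n, Submodule k (M n)
  -- No codegeneracy starts at `M 0`, so the condition is empty there.
  | 0 => ⊤
  | n + 1 => ⨅ i < q, LinearMap.ker (X.s n i)

theorem mem_partialKer_succ {q n : ℕ} {x : M (n + 1)} :
    x ∈ X.partialKer q (n + 1) ↔ ∀ i < q, X.s n i x = 0 := by
  simp [partialKer]

/-- The normalized part of a cosimplicial module. -/
def normalized (n : ℕ) : Submodule k (M n) := X.partialKer n n

/-- Codegeneracies out of range are zero by convention, so `q` may be arbitrary, also larger than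
`n`. -/
theorem normalized_le (q n : ℕ) : X.normalized n ≤ X.partialKer q n := by
  cases n with
  | zero => exact le_top
  | succ n =>
    intro x hx
    rw [mem_partialKer_succ]
    intro i _
    rcases Nat.lt_or_ge n i with h | h
    · rw [X.s_eq_zero h, LinearMap.zero_apply]
    · exact X.mem_partialKer_succ.1 hx i (by omega)

/-- Passing to the right of the coface, `s_i` becomes `s_{i-1}`, so `i = q` is still allowed. -/
theorem s_d_eq_zero_of_lt {q n i j : ℕ} {y : M n} (hy : y ∈ X.partialKer q n) (hi : i ≤ q)
    (hj : j < i) : X.s n i (X.d n j y) = 0 := by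
  rcases Nat.lt_or_ge n i with h | h
  · rw [X.s_eq_zero h, LinearMap.zero_apply]
  obtain ⟨i, rfl⟩ : ∃ r, i = r + 1 := ⟨i - 1, by omega⟩
  obtain ⟨n, rfl⟩ : ∃ r, n = r + 1 := ⟨n - 1, by omega⟩
  rw [X.s_d_lt y (by omega) (by omega), X.mem_partialKer_succ.1 hy i (by omega), map_zero]

/-- Here `s_i` keeps its index when it passes the coface, hence the strict bound on `i`. -/
theorem s_d_eq_zero_of_gt {q n i j : ℕ} {y : M n} (hy : y ∈ X.partialKer q n) (hi : i < q)
    (hj : i < j) (hjn : j ≤ n) : X.s n i (X.d n (j + 1) y) = 0 := by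
  obtain ⟨n, rfl⟩ : ∃ r, n = r + 1 := ⟨n - 1, by omega⟩
  rw [X.s_d_gt y hj hjn, X.mem_partialKer_succ.1 hy i hi, map_zero]

/-- The alternating sum of the first cofaces. -/
def partialBdry (q n : ℕ) : M n →ₗ[k] M (n + 1) :=
  ∑ i ∈ Finset.range (q + 1), (-1 : ℤ) ^ i • X.d n i

/-- Only the cofaces `i` and `i + 1` survive under `s_i`, and they cancel; both occur in the sum
because `i < q`. -/
theorem s_partialBdry {q n i : ℕ} {y : M n} (hy : y ∈ X.partialKer q n) (hi : i < q)
    (hq : q ≤ n + 1) : X.s n i (X.partialBdry q n y) = 0 := by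
  rcases Nat.lt_or_ge n i with h | h
  · rw [X.s_eq_zero h, LinearMap.zero_apply]
  simp only [partialBdry, LinearMap.sum_apply, LinearMap.smul_apply, map_sum, map_zsmul]
  rw [alternating_sum_of_eq (fun j => X.s n i (X.d n j y)) hi
    (fun j hj => X.s_d_eq_zero_of_lt hy hi.le hj) ((X.s_d_self y h).trans (X.s_d_succ y h).symm),
    Finset.sum_eq_zero, neg_zero]
  intro j hj
  rw [Finset.mem_Ico] at hj
  rw [X.s_d_eq_zero_of_gt hy hi (by omega) (by omega), smul_zero]

/-- The sum stops at the coface `q`, so this term has no partner `q + 1` to cancel it and is the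
only one to survive. -/
theorem s_self_partialBdry {q n : ℕ} {y : M n} (hy : y ∈ X.partialKer q n) (hq : q ≤ n) :
    X.s n q (X.partialBdry q n y) = (-1 : ℤ) ^ q • y := by
  simp only [partialBdry, LinearMap.sum_apply, LinearMap.smul_apply, map_sum, map_zsmul]
  rw [Finset.sum_range_succ, X.s_d_self y hq, Finset.sum_eq_zero, zero_add]
  intro j hj
  rw [X.s_d_eq_zero_of_lt hy le_rfl (Finset.mem_range.1 hj), smul_zero]

/-- This is the identity `s_i s_q = s_{q-1} s_i` for `i < q`. -/
theorem s_mem_partialKer {q n : ℕ} {x : M (n + 1)} (hx : x ∈ X.partialKer q (n + 1)) :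
    X.s n q x ∈ X.partialKer q n := by
  cases n with
  | zero => exact Submodule.mem_top
  | succ n =>
    rw [mem_partialKer_succ] at hx ⊢
    intro i hi
    rcases Nat.lt_or_ge (n + 1) q with h | h
    · rw [X.s_eq_zero h, LinearMap.zero_apply, map_zero]
    obtain ⟨q, rfl⟩ : ∃ r, q = r + 1 := ⟨q - 1, by omega⟩
    rw [← X.s_s x (by omega) (by omega), hx i hi, map_zero]

/-- In `s_q ∂ x` the cofaces below `q` contribute zero and those at `q`, `q + 1` cancel. The others
give `d_j s_q x` for `j > q` with the sign reversed, which removes the tail of `∂ s_q x`. -/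
theorem bdry_s_add_s_bdry {q n : ℕ} {x : M (n + 1)} (hx : x ∈ X.partialKer q (n + 1)) :
    X.bdry n (X.s n q x) + X.s (n + 1) q (X.bdry (n + 1) x) = X.partialBdry q n (X.s n q x) := by
  rcases Nat.lt_or_ge (n + 1) q with h | h
  · simp [X.s_eq_zero h, X.s_eq_zero (show n < q by omega)]
  have h2 : X.s (n + 1) q (X.bdry (n + 1) x)
      = -∑ j ∈ Finset.Ico (q + 1) (n + 2), (-1 : ℤ) ^ j • X.d n j (X.s n q x) := by
    rw [bdry_apply, map_sum]
    simp only [map_zsmul]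
    rw [alternating_sum_of_eq (fun j => X.s (n + 1) q (X.d (n + 1) j x)) (by omega : q < n + 2)
      (fun j hj => X.s_d_eq_zero_of_lt hx le_rfl hj)
      ((X.s_d_self x h).trans (X.s_d_succ x h).symm)]
    congr 1
    refine Finset.sum_congr rfl fun j hj => ?_
    rw [Finset.mem_Ico] at hj
    rw [X.s_d_gt x (by omega) (by omega)]
  rw [h2, bdry_apply, ← Finset.sum_range_add_sum_Ico _ (by omega : q + 1 ≤ n + 2),
    add_neg_cancel_right]
  simp [partialBdry, LinearMap.sum_apply]

theorem s_bdry_zero {q : ℕ} (x : M 0) : X.s 0 q (X.bdry 0 x) = 0 := by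
  rcases Nat.eq_zero_or_pos q with rfl | h
  · rw [bdry_apply]
    simp only [Finset.sum_range_succ, Finset.sum_range_zero, map_add, map_zsmul, map_zero,
      X.s_d_self x le_rfl, X.s_d_succ x le_rfl]
    simp
  · rw [X.s_eq_zero h, LinearMap.zero_apply]

/-- If `s_q x = 0`, the formula for `∂ s_q + s_q ∂` reduces to `s_q ∂ x = 0`. -/
theorem bdry_mem_normalized {n : ℕ} {x : M n} (hx : x ∈ X.normalized n) :
    X.bdry n x ∈ X.normalized (n + 1) := by
  refine X.mem_partialKer_succ.2 fun q _ => ?_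
  cases n with
  | zero => exact X.s_bdry_zero x
  | succ n =>
    have h := X.bdry_s_add_s_bdry (X.normalized_le q _ hx)
    rwa [X.mem_partialKer_succ.1 (X.normalized_le (q + 1) _ hx) q (by omega), map_zero, map_zero,
      zero_add] at h

/-- The `q`-th step of the normalization: the identity minus the null-homotopic map given by
the `q`-th codegeneracy. -/
def step (q : ℕ) : ∀ n, M n →ₗ[k] M n
  -- There is no codegeneracy out of `M 0`, so only one half of the null-homotopic map remains.
  | 0 => LinearMap.id - (-1 : ℤ) ^ q • X.s 0 q ∘ₗ X.bdry 0
  | n + 1 => LinearMap.id -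
      (-1 : ℤ) ^ q • (X.bdry n ∘ₗ X.s n q + X.s (n + 1) q ∘ₗ X.bdry (n + 1))

theorem step_zero (q : ℕ) (x : M 0) : X.step q 0 x = x := by
  simp [step, s_bdry_zero]

theorem step_succ (q : ℕ) {n : ℕ} (x : M (n + 1)) : X.step q (n + 1) x = x -
    (-1 : ℤ) ^ q • (X.bdry n (X.s n q x) + X.s (n + 1) q (X.bdry (n + 1) x)) := rfl

theorem bdry_step (q : ℕ) {n : ℕ} (x : M n) :
    X.bdry n (X.step q n x) = X.step q (n + 1) (X.bdry n x) := by
  cases n with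
  | zero => rw [step_zero, step_succ, s_bdry_zero, bdry_bdry]; simp
  | succ n => simp [step_succ, bdry_bdry]

/-- The step subtracts `(-1)^q` times the partial boundary of `s_q x`. This is invisible to `s_i`
for `i < q`, and `s_q` maps it to exactly `s_q x`. -/
theorem step_mem {q n : ℕ} {x : M n} (hx : x ∈ X.partialKer q n) :
    X.step q n x ∈ X.partialKer (q + 1) n := by
  cases n with
  | zero => exact Submodule.mem_top
  | succ n =>
    rw [step_succ, X.bdry_s_add_s_bdry hx, mem_partialKer_succ]
    intro i hi
    have hy := X.s_mem_partialKer hx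
    -- For `q > n` the codegeneracy `s_q` is zero: the step changes nothing, and the new condition
    -- is empty.
    rcases Nat.lt_or_ge n q with h | h
    · rcases Nat.lt_succ_iff_lt_or_eq.1 hi with h1 | rfl
      · simp [X.s_eq_zero h, X.mem_partialKer_succ.1 hx i h1]
      · simp [X.s_eq_zero h]
    rw [map_sub, map_zsmul]
    rcases Nat.lt_succ_iff_lt_or_eq.1 hi with h1 | rfl
    · rw [X.s_partialBdry hy h1 (by omega), X.mem_partialKer_succ.1 hx i h1]
      simp
    · rw [X.s_self_partialBdry hy h, smul_smul, ← mul_pow]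
      simp

theorem step_eq_self {q n : ℕ} {x : M n} (hx : x ∈ X.normalized n) : X.step q n x = x := by
  cases n with
  | zero => exact X.step_zero q x
  | succ n =>
    rw [step_succ, X.bdry_s_add_s_bdry (X.normalized_le q _ hx),
      X.mem_partialKer_succ.1 (X.normalized_le (q + 1) _ hx) q (by omega)]
    simp

/-- The composition of the first steps of the normalization. -/
def steps (n : ℕ) : ℕ → M n →ₗ[k] M n
  | 0 => LinearMap.id
  | q + 1 => X.step q n ∘ₗ steps n q

/-- The homotopy from the identity to the first steps of the normalization. -/
def stepsHomotopy (n : ℕ) : ℕ → M (n + 1) →ₗ[k] M n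
  | 0 => 0
  | q + 1 => stepsHomotopy n q + (-1 : ℤ) ^ q • X.s n q ∘ₗ X.steps (n + 1) q

theorem bdry_steps (q : ℕ) {n : ℕ} (x : M n) :
    X.bdry n (X.steps n q x) = X.steps (n + 1) q (X.bdry n x) := by
  induction q with
  | zero => rfl
  | succ q ih => simp [steps, bdry_step, ih]

theorem steps_mem (q : ℕ) {n : ℕ} (x : M n) : X.steps n q x ∈ X.partialKer q n := by
  induction q with
  | zero => cases n <;> simp [partialKer]
  | succ q ih => exact X.step_mem ih

theorem steps_zero (q : ℕ) (x : M 0) : X.steps 0 q x = x := by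
  induction q with
  | zero => rfl
  | succ q ih => simp [steps, ih, step_zero]

theorem steps_eq_self (q : ℕ) {n : ℕ} {x : M n} (hx : x ∈ X.normalized n) :
    X.steps n q x = x := by
  induction q with
  | zero => rfl
  | succ q ih => simp [steps, ih, X.step_eq_self hx]

theorem stepsHomotopy_bdry_zero (q : ℕ) (x : M 0) : X.stepsHomotopy 0 q (X.bdry 0 x) = 0 := by
  induction q with
  | zero => rfl
  | succ q ih => simp [stepsHomotopy, ih, ← bdry_steps, s_bdry_zero]

/-- A telescoping sum: each step changes the previous composite by `(-1)^q (∂ s_q + s_q ∂)`, and the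
composites commute with `∂`. -/
theorem stepsHomotopy_spec (q : ℕ) {n : ℕ} (x : M (n + 1)) :
    X.bdry n (X.stepsHomotopy n q x) + X.stepsHomotopy (n + 1) q (X.bdry (n + 1) x)
      = x - X.steps (n + 1) q x := by
  induction q with
  | zero => simp [stepsHomotopy, steps]
  | succ q ih =>
    simp only [stepsHomotopy, steps, LinearMap.add_apply, LinearMap.smul_apply,
      LinearMap.comp_apply, map_add, map_zsmul, step_succ, ← bdry_steps, smul_add]
    rw [add_add_add_comm, ih]
    abel

theorem stepsHomotopy_stable {q n : ℕ} (hq : n < q) :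
    X.stepsHomotopy n (q + 1) = X.stepsHomotopy n q := by
  rw [stepsHomotopy, X.s_eq_zero hq]
  simp

/-- The projection onto the normalized part. -/
def proj (n : ℕ) : M n →ₗ[k] M n := X.steps n (n + 1)

/-- The homotopy from the identity to the projection onto the normalized part. -/
def homotopy (n : ℕ) : M (n + 1) →ₗ[k] M n := X.stepsHomotopy n (n + 1)

theorem proj_mem {n : ℕ} (x : M n) : X.proj n x ∈ X.normalized n := by
  cases n with
  | zero => exact Submodule.mem_top
  | succ n =>
    exact X.mem_partialKer_succ.2 fun i hi =>
      X.mem_partialKer_succ.1 (X.steps_mem (n + 2) x) i (by omega)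

theorem proj_eq_self {n : ℕ} {x : M n} (hx : x ∈ X.normalized n) : X.proj n x = x :=
  X.steps_eq_self _ hx

theorem proj_zero (x : M 0) : X.proj 0 x = x := X.steps_zero _ x

theorem homotopy_bdry_zero (x : M 0) : X.homotopy 0 (X.bdry 0 x) = 0 :=
  X.stepsHomotopy_bdry_zero _ x

theorem homotopy_spec {n : ℕ} (x : M (n + 1)) :
    X.bdry n (X.homotopy n x) + X.homotopy (n + 1) (X.bdry (n + 1) x)
      = x - X.proj (n + 1) x := by
  -- The two homotopies in the formula use `n + 1` and `n + 2` steps; the extra step of the first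
  -- one is zero, so both can be taken at `n + 2`.
  rw [homotopy, ← X.stepsHomotopy_stable (Nat.lt_succ_self n)]
  exact X.stepsHomotopy_spec (n + 2) x

/-- The number of steps in `proj` depends on the level, so this is not immediate from `bdry_steps`.
Instead, both sides equal `∂x - ∂ h ∂x`, by the homotopy formula for `∂x` and by `∂` applied to the
formula for `x`. -/
theorem bdry_proj {n : ℕ} (x : M n) : X.bdry n (X.proj n x) = X.proj (n + 1) (X.bdry n x) := by
  have h1 := X.homotopy_spec (X.bdry n x)
  rw [bdry_bdry, map_zero, add_zero] at h1
  rw [show X.proj (n + 1) (X.bdry n x) = X.bdry n x - X.bdry n (X.homotopy n (X.bdry n x)) by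
    rw [h1, sub_sub_cancel]]
  cases n with
  | zero => rw [proj_zero, homotopy_bdry_zero, map_zero, sub_zero]
  | succ n =>
    have h2 := congrArg (X.bdry (n + 1)) (X.homotopy_spec x)
    rw [map_add, bdry_bdry, zero_add, map_sub] at h2
    rw [h2, sub_sub_cancel]

end CosimplicialModule

/-! ### The cosimplicial structure on the operad, by substitutions. -/

variable {k : Type u} [CommRing k]

theorem Word.wt_bind {f : ℕ → Word} (hf : ∀ j, (f j).wt = 0) (t : Word) : (t.bind f).wt = t.wt := by
  induction t <;> simp_all [Word.bind, Word.wt]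

theorem Word.vars_bind (f : ℕ → Word) (t : Word) :
    (t.bind f).vars = t.vars.bind fun j => (f j).vars := by
  induction t <;> simp_all [Word.bind, Word.vars]

/-- The signs in the relators depend on the weights of the words involved; substituting words of
weight zero leaves them unchanged. -/
theorem relator_bind {f : ℕ → Word} (hf : ∀ j, (f j).wt = 0) {r : Word →₀ k} (h : Relator k r) :
    Relator k (r.mapDomain (Word.bind f)) := by
  have hw := Word.wt_bind hf
  have hs : ∀ (t : Word), (Finsupp.single t (1:k)).mapDomain (Word.bind f)
      = Finsupp.single (t.bind f) 1 := fun t => Finsupp.mapDomain_single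
  have hsub : ∀ a b : Word →₀ k, (a - b).mapDomain (Word.bind f)
      = a.mapDomain (Word.bind f) - b.mapDomain (Word.bind f) :=
    fun a b => map_sub (Finsupp.lmapDomain k k (Word.bind f)) a b
  have hc : ∀ (g g' : Word → Word), (∀ t, (g t).bind f = g' (t.bind f)) →
      ∀ r : Word →₀ k, (r.mapDomain g).mapDomain (Word.bind f)
        = (r.mapDomain (Word.bind f)).mapDomain g' := by
    intro g g' hg r
    rw [← Finsupp.mapDomain_comp, ← Finsupp.mapDomain_comp]
    congr 1
    funext t
    exact hg t
  induction h with
  | one_mul a => simpa [hs, hsub, Word.bind] using Relator.one_mul (a.bind f)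
  | mul_comm a b =>
    simpa [hs, hsub, Word.bind, Finsupp.mapDomain_smul, hw] using
      Relator.mul_comm (k := k) (a.bind f) (b.bind f)
  | mul_assoc a b c =>
    simpa [hs, hsub, Word.bind] using
      Relator.mul_assoc (k := k) (a.bind f) (b.bind f) (c.bind f)
  | antisymm a b =>
    simpa [hs, hsub, Word.bind, Finsupp.mapDomain_add, Finsupp.mapDomain_smul, hw] using
      Relator.antisymm (k := k) (a.bind f) (b.bind f)
  | jacobi a b c =>
    simpa [hs, hsub, Word.bind, Finsupp.mapDomain_smul, hw] using
      Relator.jacobi (k := k) (a.bind f) (b.bind f) (c.bind f)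
  | leibniz a b c =>
    simpa [hs, hsub, Word.bind, Finsupp.mapDomain_smul, hw] using
      Relator.leibniz (k := k) (a.bind f) (b.bind f) (c.bind f)
  | del_del a => simpa [hs, Word.bind] using Relator.del_del (k := k) (a.bind f)
  | del_mul a b =>
    simpa [hs, hsub, Word.bind, Finsupp.mapDomain_smul, hw] using
      Relator.del_mul (k := k) (a.bind f) (b.bind f)
  | mul_left a _ ih =>
    rw [hc _ (Word.mul (a.bind f)) (fun _ => rfl)]; exact ih.mul_left _
  | mul_right a _ ih =>
    rw [hc _ (fun t => Word.mul t (a.bind f)) (fun _ => rfl)]; exact ih.mul_right _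
  | br_left a _ ih =>
    rw [hc _ (Word.br (a.bind f)) (fun _ => rfl)]; exact ih.br_left _
  | br_right a _ ih =>
    rw [hc _ (fun t => Word.br t (a.bind f)) (fun _ => rfl)]; exact ih.br_right _
  | del _ ih => rw [hc _ Word.del (fun _ => rfl)]; exact ih.del

/-- Substitution of words of weight zero for the generators of the free algebra. -/
def substL (f : ℕ → Word) (hf : ∀ j, (f j).wt = 0) : FreeBV k →ₗ[k] FreeBV k :=
  FreeBV.lift (fun t => cls k (t.bind f)) fun _ h => cls_relator_map _ (relator_bind hf h)

@[simp] theorem substL_cls (f : ℕ → Word) (hf : ∀ j, (f j).wt = 0) (t : Word) :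
    substL f hf (cls k t) = cls k (t.bind f) := by simp [substL]

theorem multiPart_ext {N : Type*} [AddCommGroup N] [Module k N] {A : Multiset ℕ} {w : ℕ}
    {f g : FreeBV k →ₗ[k] N}
    (h : ∀ t : Word, t.vars = A → t.wt = w → f (cls k t) = g (cls k t)) {x : FreeBV k}
    (hx : x ∈ multiPart k A w) : f x = g x := by
  have : multiPart k A w ≤ LinearMap.eqLocus f g := by
    refine Submodule.span_le.2 ?_
    rintro _ ⟨t, h1, h2, rfl⟩
    exact h t h1 h2
  exact this hx

theorem cls_one_mul (t : Word) : cls k (.mul .one t) = cls k t := by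
  rw [← mulL_cls, IsMono.one_mul]

theorem cls_mul_one (t : Word) : cls k (.mul t .one) = cls k t := by
  rw [← mulL_cls, (IsMono.cls t).mul_comm (IsMono.cls .one), IsMono.one_mul]
  simp [Word.wt]

/-- Substitution of the unit for the `i`-th input, followed by renumbering. -/
def codeg (i j : ℕ) : Word :=
  if j < i then .var j else if j = i then .one else .var (j - 1)

theorem wt_codeg (i j : ℕ) : (codeg i j).wt = 0 := by
  unfold codeg
  split_ifs <;> rfl

theorem wt_dbl (i j : ℕ) : (dbl i j).wt = 0 := by
  unfold dbl
  split_ifs <;> rfl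

variable (k) in
/-- The codegeneracies on the free algebra. -/
def codegL (i : ℕ) : FreeBV k →ₗ[k] FreeBV k := substL (codeg i) (wt_codeg i)

variable (k) in
/-- The cofaces on the free algebra. -/
def faceL (n i : ℕ) : FreeBV k →ₗ[k] FreeBV k :=
  if i = 0 then mulL (cls k (.var 0)) ∘ₗ substL (fun j => .var (j + 1)) fun _ => rfl
  else if i = n + 1 then mulL.flip (cls k (.var n)) else substL (dbl (i - 1)) (wt_dbl _)

@[simp] theorem codegL_cls (i : ℕ) (t : Word) : codegL k i (cls k t) = cls k (t.bind (codeg i)) :=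
  substL_cls _ _ _

@[simp] theorem faceL_cls (n i : ℕ) (t : Word) : faceL k n i (cls k t) = cls k (face n i t) := by
  unfold faceL face
  split_ifs
  · exact (congrArg (mulL _) (substL_cls _ _ t)).trans (mulL_cls _ _)
  · exact mulL_cls _ _
  · exact substL_cls _ _ t

theorem vars_bind_codeg {n i : ℕ} (hi : i ≤ n) {t : Word} (hv : t.vars = Multiset.range (n + 1)) :
    (t.bind (codeg i)).vars = Multiset.range n := by
  have hlt : i < n + 1 := by omega
  have h := range_insert (m := 0) hlt
  rw [Multiset.range_zero, Multiset.map_zero, add_zero, Nat.add_zero, Nat.add_sub_cancel] at h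
  rw [Word.vars_bind, hv, ← h, ← Multiset.bind_singleton]
  conv_lhs => rw [← Multiset.cons_erase (Multiset.mem_range.2 hlt)]
  rw [Multiset.cons_bind, show (codeg i i).vars = 0 by simp [codeg, Word.vars], zero_add]
  refine Multiset.bind_congr fun j hj => ?_
  have := ((Multiset.nodup_range (n + 1)).mem_erase_iff.1 hj).1
  simp only [codeg, newIndex]
  split_ifs <;> rfl

theorem codegL_mem {n w i : ℕ} (hi : i ≤ n) {x : FreeBV k} (hx : x ∈ BV k (n + 1) w) :
    codegL k i x ∈ BV k n w := by
  refine multiPart_induction _ (fun t ht hw => ?_) hx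
  rw [codegL_cls]
  exact cls_mem_BV (vars_bind_codeg hi ht) ((Word.wt_bind (wt_codeg i) t).trans hw)

theorem faceL_mem {n w i : ℕ} (hi : i ≤ n + 1) {x : FreeBV k} (hx : x ∈ BV k n w) :
    faceL k n i x ∈ BV k (n + 1) w := by
  refine multiPart_induction _ (fun t ht hw => ?_) hx
  rw [faceL_cls]
  exact cls_mem_BV (face_vars hi ht) ((face_wt n i t).trans hw)

/-- Codegeneracies and inner cofaces are substitutions, and the outer cofaces are a substitution
followed by a multiplication. Each cosimplicial identity is therefore checked on a single generator,
according to its position relative to the two indices. -/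
theorem codeg_face_lt {n i j : ℕ} (hj : j ≤ i) (hi : i ≤ n) (t : Word) :
    cls k ((face (n + 1) j t).bind (codeg (i + 1))) = cls k (face n j (t.bind (codeg i))) := by
  rcases Nat.eq_zero_or_pos j with rfl | h
  · simp only [face, if_true, Word.bind, Word.bind_bind]
    refine cls_mul_congr (by simp [codeg]) (cls_bind_congr t fun x _ => ?_)
    simp only [codeg, add_lt_add_iff_right, add_left_inj]
    split_ifs <;> simp only [Word.bind]
    congr 2; omega
  · simp only [face, if_neg h.ne', if_neg (show ¬ j = n + 1 + 1 by omega),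
      if_neg (show ¬ j = n + 1 by omega), Word.bind_bind]
    refine cls_bind_congr t fun x _ => ?_
    rcases lt_trichotomy x (j - 1) with h1 | h1 | h1
    · simp [codeg, dbl, Word.bind, h1, show x < i by omega, show x < i + 1 by omega]
    · subst h1
      simp [codeg, dbl, Word.bind, show j - 1 < i by omega, show j - 1 < i + 1 by omega]
    · rcases lt_trichotomy x i with h2 | h2 | h2
      · simp [codeg, dbl, Word.bind, h2, show ¬ x < j - 1 by omega, show ¬ x = j - 1 by omega]
      · simp [codeg, dbl, Word.bind, h2, show ¬ i < j - 1 by omega, show ¬ i = j - 1 by omega]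
      · simp [codeg, dbl, Word.bind, show ¬ x < j - 1 by omega, show ¬ x = j - 1 by omega,
          show ¬ x < i by omega, show ¬ x = i by omega, show ¬ x - 1 < j - 1 by omega,
          show ¬ x - 1 = j - 1 by omega, show x - 1 + 1 = x by omega]

theorem codeg_face_self {n i : ℕ} (hi : i ≤ n) (t : Word) :
    cls k ((face n i t).bind (codeg i)) = cls k t := by
  rcases Nat.eq_zero_or_pos i with rfl | h
  · simp only [face, if_true, Word.bind, Word.bind_bind]
    conv_rhs => rw [← Word.bind_var t]
    exact cls_one_mul _
  · simp only [face, if_neg h.ne', if_neg (show ¬ i = n + 1 by omega), Word.bind_bind]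
    conv_rhs => rw [← Word.bind_var t]
    refine cls_bind_congr t fun x _ => ?_
    rcases lt_trichotomy x (i - 1) with h1 | h1 | h1
    · simp [codeg, dbl, Word.bind, h1, show x < i by omega]
    · subst h1
      simp [codeg, dbl, Word.bind, h, show i - 1 + 1 = i by omega, cls_mul_one]
    · simp [codeg, dbl, Word.bind, show ¬ x < i - 1 by omega, show ¬ x = i - 1 by omega,
        show ¬ x + 1 < i by omega, show ¬ x + 1 = i by omega]

/-- The bound on the generators matters for the last coface: the codegeneracy must remove the new
factor `x_n` without touching `t`. -/
theorem codeg_face_succ {n i : ℕ} (hi : i ≤ n) {t : Word} (ht : ∀ x ∈ t.vars, x < n) :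
    cls k ((face n (i + 1) t).bind (codeg i)) = cls k t := by
  by_cases h : i = n
  · subst h
    simp only [face, if_neg (Nat.succ_ne_zero i), if_true, Word.bind]
    rw [show codeg i i = .one by simp [codeg], cls_mul_one]
    conv_rhs => rw [← Word.bind_var t]
    refine cls_bind_congr t fun x hx => ?_
    simp [codeg, ht x hx]
  · simp only [face, if_neg (Nat.succ_ne_zero i), if_neg (show ¬ i + 1 = n + 1 by omega),
      Word.bind_bind, Nat.add_sub_cancel]
    conv_rhs => rw [← Word.bind_var t]
    refine cls_bind_congr t fun x _ => ?_
    rcases lt_trichotomy x i with h1 | h1 | h1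
    · simp [codeg, dbl, Word.bind, h1]
    · subst h1
      simp [codeg, dbl, Word.bind, cls_one_mul]
    · simp [codeg, dbl, Word.bind, show ¬ x < i by omega, show ¬ x = i by omega,
        show ¬ x + 1 < i by omega, show ¬ x + 1 = i by omega]

theorem codeg_face_gt {n i j : ℕ} (hi : i < j) (hj : j ≤ n + 1) (t : Word) :
    cls k ((face (n + 1) (j + 1) t).bind (codeg i)) = cls k (face n j (t.bind (codeg i))) := by
  by_cases h : j = n + 1
  · subst h
    simp [face, Word.bind, codeg, show ¬ n + 1 < i by omega, show ¬ n + 1 = i by omega]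
  · simp only [face, if_neg (Nat.succ_ne_zero j), if_neg (show ¬ j + 1 = n + 1 + 1 by omega),
      if_neg (show ¬ j = 0 by omega), if_neg h, Word.bind_bind, Nat.add_sub_cancel]
    refine cls_bind_congr t fun x _ => ?_
    rcases lt_trichotomy x i with h1 | h1 | h1
    · rcases Nat.lt_or_ge x (j - 1) with h2 | h2
      · simp [codeg, dbl, Word.bind, h1, h2, show x < j by omega]
      · omega
    · subst h1
      simp [codeg, dbl, Word.bind, hi]
    · rcases lt_trichotomy x j with h2 | h2 | h2
      · simp [codeg, dbl, Word.bind, h2, show ¬ x < i by omega, show ¬ x = i by omega,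
          show x - 1 < j - 1 by omega]
      · subst h2
        simp [codeg, dbl, Word.bind, show ¬ x < i by omega, show ¬ x = i by omega,
          show ¬ x + 1 < i by omega, show ¬ x + 1 = i by omega, show x - 1 + 1 = x by omega]
      · simp [codeg, dbl, Word.bind, show ¬ x < i by omega, show ¬ x = i by omega,
          show ¬ x < j by omega, show ¬ x = j by omega, show ¬ x + 1 < i by omega,
          show ¬ x + 1 = i by omega, show ¬ x - 1 < j - 1 by omega,
          show ¬ x - 1 = j - 1 by omega, show x - 1 + 1 = x by omega]

theorem codeg_codeg {i j : ℕ} (hi : i ≤ j) (t : Word) :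
    cls k ((t.bind (codeg i)).bind (codeg j)) = cls k ((t.bind (codeg (j + 1))).bind (codeg i)) := by
  simp only [Word.bind_bind]
  refine cls_bind_congr t fun x _ => ?_
  rcases lt_trichotomy x i with h1 | h1 | h1
  · simp [codeg, Word.bind, h1, show x < j by omega, show x < j + 1 by omega]
  · subst h1
    simp [codeg, Word.bind, show x < j + 1 by omega]
  · rcases lt_trichotomy x (j + 1) with h2 | h2 | h2
    · simp [codeg, Word.bind, h2, show ¬ x < i by omega, show ¬ x = i by omega,
        show x - 1 < j by omega]
    · subst h2
      simp [codeg, Word.bind, show ¬ j + 1 < i by omega, show ¬ j + 1 = i by omega]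
    · simp [codeg, Word.bind, show ¬ x < i by omega, show ¬ x = i by omega,
          show ¬ x < j + 1 by omega, show ¬ x = j + 1 by omega, show ¬ x - 1 < i by omega,
          show ¬ x - 1 = i by omega, show ¬ x - 1 < j by omega, show ¬ x - 1 = j by omega]

variable (k) in
/-- The coface from `n` to `n + 1` inputs. -/
def coface (w n i : ℕ) : BV k n w →ₗ[k] BV k (n + 1) w :=
  if h : i ≤ n + 1 then (faceL k n i).restrict fun _ => faceL_mem h else 0

variable (k) in
/-- The codegeneracy from `n + 1` to `n` inputs. -/
def codegeneracy (w n i : ℕ) : BV k (n + 1) w →ₗ[k] BV k n w :=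
  if h : i ≤ n then (codegL k i).restrict fun _ => codegL_mem h else 0

theorem coe_coface {w n i : ℕ} (h : i ≤ n + 1) (x : BV k n w) :
    (coface k w n i x : FreeBV k) = faceL k n i x := by
  rw [coface, dif_pos h]; rfl

theorem coe_codegeneracy {w n i : ℕ} (h : i ≤ n) (x : BV k (n + 1) w) :
    (codegeneracy k w n i x : FreeBV k) = codegL k i x := by
  rw [codegeneracy, dif_pos h]; rfl

variable (k) in
/-- The cosimplicial structure on the components of the operad. -/
def cosimplicial (w : ℕ) : CosimplicialModule k fun n => BV k n w where
  d := coface k w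
  s := codegeneracy k w
  s_eq_zero h := dif_neg (by omega)
  d_d {n i j} x hij hj := by
    apply Subtype.ext
    rw [coe_coface hj, coe_coface (by omega), coe_coface (by omega), coe_coface (by omega)]
    refine multiPart_ext (f := faceL k (n + 1) j ∘ₗ faceL k n i)
      (g := faceL k (n + 1) i ∘ₗ faceL k n (j - 1)) (fun t ht _ => ?_) x.2
    simpa using face_face hij hj t fun x hx => Multiset.mem_range.1 (ht ▸ hx)
  s_d_lt {n i j} x hj hi := by
    apply Subtype.ext
    rw [coe_codegeneracy (by omega), coe_coface (by omega), coe_coface (by omega),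
      coe_codegeneracy hi]
    refine multiPart_ext (f := codegL k (i + 1) ∘ₗ faceL k (n + 1) j)
      (g := faceL k n j ∘ₗ codegL k i) (fun t ht _ => ?_) x.2
    simpa using codeg_face_lt hj hi t
  s_d_self {n i} x hi := by
    apply Subtype.ext
    rw [coe_codegeneracy hi, coe_coface (by omega)]
    refine multiPart_ext (f := codegL k i ∘ₗ faceL k n i) (g := LinearMap.id)
      (fun t ht _ => ?_) x.2
    simpa using codeg_face_self hi t
  s_d_succ {n i} x hi := by
    apply Subtype.ext
    rw [coe_codegeneracy hi, coe_coface (by omega)]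
    refine multiPart_ext (f := codegL k i ∘ₗ faceL k n (i + 1)) (g := LinearMap.id)
      (fun t ht _ => ?_) x.2
    simpa using codeg_face_succ hi fun x hx => Multiset.mem_range.1 (ht ▸ hx)
  s_d_gt {n i j} x hi hj := by
    apply Subtype.ext
    rw [coe_codegeneracy (by omega), coe_coface (by omega), coe_coface (by omega),
      coe_codegeneracy (by omega)]
    refine multiPart_ext (f := codegL k i ∘ₗ faceL k (n + 1) (j + 1))
      (g := faceL k n j ∘ₗ codegL k i) (fun t ht _ => ?_) x.2
    simpa using codeg_face_gt hi hj t
  s_s {n i j} x hi hj := by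
    apply Subtype.ext
    rw [coe_codegeneracy hj, coe_codegeneracy (by omega), coe_codegeneracy (by omega),
      coe_codegeneracy (by omega)]
    refine multiPart_ext (f := codegL k j ∘ₗ codegL k i)
      (g := codegL k i ∘ₗ codegL k (j + 1)) (fun t ht _ => ?_) x.2
    simpa using codeg_codeg hi t

/-! ### Comparison with the Hochschild differential. -/

theorem BV_ext {N : Type*} [AddCommGroup N] [Module k N] {n w : ℕ} {f g : BV k n w →ₗ[k] N}
    (h : ∀ (t : Word) (hv : t.vars = Multiset.range n) (hw : t.wt = w),
      f ⟨cls k t, cls_mem_BV hv hw⟩ = g ⟨cls k t, cls_mem_BV hv hw⟩) : f = g := by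
  ext ⟨x, hx⟩
  induction hx using Submodule.span_induction with
  | mem x hx =>
    obtain ⟨t, hv, hw, rfl⟩ := hx
    exact h t hv hw
  | zero => exact (map_zero f).trans (map_zero g).symm
  | add x y hx hy h1 h2 =>
    exact (map_add f ⟨x, hx⟩ ⟨y, hy⟩).trans
      ((congrArg₂ (· + ·) h1 h2).trans (map_add g ⟨x, hx⟩ ⟨y, hy⟩).symm)
  | smul c x hx h1 =>
    exact (map_smul f c ⟨x, hx⟩).trans
      ((congrArg (c • ·) h1).trans (map_smul g c ⟨x, hx⟩).symm)

/-- The Hochschild differential is up to a sign the alternating sum of the cofaces. -/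
theorem bdry_eq (e : ℤ) {n w : ℕ} (x : BV k n w) :
    bdry e n w x = Int.negOnePow (-e * w) • (cosimplicial k w).bdry n x := by
  revert x
  suffices bdry (k := k) e n w = Int.negOnePow (-e * w) • (cosimplicial k w).bdry n from
    LinearMap.congr_fun this
  refine BV_ext fun t hv hw => Subtype.ext ?_
  rw [bdry_cls e t hv hw, LinearMap.smul_apply, CosimplicialModule.bdry_apply, Units.smul_def,
    Units.smul_def, Submodule.coe_smul_of_tower, Submodule.coe_sum]
  congr 1
  refine Finset.sum_congr rfl fun i hi => ?_
  rw [Submodule.coe_smul_of_tower]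
  congr 1
  have := Finset.mem_range.1 hi
  exact ((coe_coface (by omega) _).trans (faceL_cls n i t)).symm

/-! ### Operations on the unit, and spanning by products of brackets. -/

theorem mul_one' (x : FreeBV k) : mulL x (cls k .one) = x := by
  suffices mulL.flip (cls k .one) = LinearMap.id from LinearMap.congr_fun this x
  exact FreeBV.hom_ext fun t => by simp [cls_mul_one]

/-- The Leibniz rule for `1 = 1 · 1` gives `[x, 1] = [x, 1] + [x, 1]`. -/
theorem br_one (x : FreeBV k) : brL x (cls k .one) = 0 := by
  suffices brL.flip (cls k .one) = 0 from LinearMap.congr_fun this x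
  refine FreeBV.hom_ext fun t => ?_
  have h := (IsMono.cls (k := k) t).leibniz (IsMono.cls .one) (cls k .one)
  rw [IsMono.one_mul, mul_one', IsMono.one_mul, Word.wt, zero_mul, pow_zero, one_smul] at h
  simpa using h

theorem one_br (x : FreeBV k) : brL (cls k .one) x = 0 := by
  suffices brL (cls k .one) = 0 from LinearMap.congr_fun this x
  refine FreeBV.hom_ext fun t => ?_
  rw [(IsMono.cls .one).antisymm (IsMono.cls t), br_one]
  simp

/-- From `δ(1 · 1)`, where the bracket term `[1, 1]` is already zero. -/
theorem del_one : delL (cls k .one) = 0 := by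
  have h := (IsMono.cls (k := k) .one).del_mul (cls k .one)
  rw [IsMono.one_mul, mul_one', IsMono.one_mul, one_br, Word.wt, pow_zero, one_smul, smul_zero,
    add_zero] at h
  simpa using h

/-- Expanding `δ²(xy) = 0` by the product formula: the terms `δ(x)δ(y)` cancel, and what remains
says that `δ` is a derivation of the bracket. -/
theorem IsMono.del_br {p : ℕ} {x : FreeBV k} (hx : IsMono p x) (y : FreeBV k) :
    delL (brL x y) = brL (delL x) y - (-1 : k) ^ p • brL x (delL y) := by
  have h := IsMono.del_del (mulL x y)
  rw [hx.del_mul, map_add, map_add, hx.del.del_mul, map_smul, map_smul, hx.del_mul] at h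
  simp only [IsMono.del_del, map_zero, LinearMap.zero_apply, smul_zero] at h
  rcases Nat.even_or_odd p with hp | hp <;>
    simp only [pow_succ, hp.neg_one_pow, mul_neg, mul_one, neg_neg, neg_smul, one_smul]
      at h ⊢
  · rw [← sub_eq_zero, ← h]
    abel
  · rw [← sub_eq_zero, ← neg_eq_zero, ← h]
    abel

variable (k) in
/-- The span of the products of brackets of weight `w` with a given multiset of generators. -/
def bracketSpan (A : Multiset ℕ) (w : ℕ) : Submodule k (FreeBV k) :=
  Submodule.span k {x | ∃ L : List Word, (∀ b ∈ L, b.IsBracket) ∧ (Word.prod L).vars = A ∧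
    (Word.prod L).wt = w ∧ x = cls k (Word.prod L)}

theorem bracketSpan_induction {A : Multiset ℕ} {w : ℕ} {N : Submodule k (FreeBV k)}
    (f : FreeBV k →ₗ[k] FreeBV k)
    (h : ∀ L : List Word, (∀ b ∈ L, b.IsBracket) → (Word.prod L).vars = A → (Word.prod L).wt = w →
      f (cls k (Word.prod L)) ∈ N) {x : FreeBV k} (hx : x ∈ bracketSpan k A w) : f x ∈ N := by
  have : bracketSpan k A w ≤ N.comap f := by
    refine Submodule.span_le.2 ?_
    rintro _ ⟨L, h0, h1, h2, rfl⟩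
    exact h L h0 h1 h2
  exact this hx

theorem mem_bracketSpan_of_eq {A B : Multiset ℕ} {w v : ℕ} {x : FreeBV k}
    (hx : x ∈ bracketSpan k A w) (hA : A = B) (hw : w = v) : x ∈ bracketSpan k B v := by
  subst hA hw; exact hx

theorem prod_mem_bracketSpan {L : List Word} (hL : ∀ b ∈ L, b.IsBracket) :
    cls k (Word.prod L) ∈ bracketSpan k (Word.prod L).vars (Word.prod L).wt :=
  Submodule.subset_span ⟨L, hL, rfl, rfl, rfl⟩

theorem prod_append (L L' : List Word) :
    cls k (Word.prod (L ++ L')) = cls k (.mul (Word.prod L) (Word.prod L')) := by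
  induction L with
  | nil => exact (cls_one_mul _).symm
  | cons b L ih =>
    change cls k (.mul b (Word.prod (L ++ L'))) = cls k (.mul (.mul b (Word.prod L)) (Word.prod L'))
    rw [cls_mul_assoc]
    exact cls_mul_congr rfl ih

theorem mul_mem_bracketSpan {A B : Multiset ℕ} {w v : ℕ} {x y : FreeBV k}
    (hx : x ∈ bracketSpan k A w) (hy : y ∈ bracketSpan k B v) :
    mulL x y ∈ bracketSpan k (A + B) (w + v) := by
  refine bracketSpan_induction (mulL x) (fun L hL hv hw => ?_) hy
  refine bracketSpan_induction (mulL.flip (cls k (Word.prod L))) (fun L' hL' hv' hw' => ?_) hx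
  have hvars : ∀ L L' : List Word,
      (Word.prod (L' ++ L)).vars = (Word.prod L').vars + (Word.prod L).vars ∧
      (Word.prod (L' ++ L)).wt = (Word.prod L').wt + (Word.prod L).wt := by
    intro L L'
    induction L' with
    | nil => simp [Word.prod, Word.vars, Word.wt]
    | cons b L' ih =>
      change b.vars + (Word.prod (L' ++ L)).vars = b.vars + (Word.prod L').vars + _ ∧
        b.wt + (Word.prod (L' ++ L)).wt = b.wt + (Word.prod L').wt + _
      rw [ih.1, ih.2, add_assoc, add_assoc]
      exact ⟨rfl, rfl⟩
  rw [LinearMap.flip_apply, mulL_cls, ← prod_append]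
  refine mem_bracketSpan_of_eq (prod_mem_bracketSpan ?_) ?_ ?_
  · intro b hb
    rcases List.mem_append.1 hb with h | h
    exacts [hL' b h, hL b h]
  · rw [(hvars L L').1, hv, hv']
  · rw [(hvars L L').2, hw, hw']

theorem bracket_mem_bracketSpan {b : Word} (hb : b.IsBracket) :
    cls k b ∈ bracketSpan k b.vars b.wt := by
  have h := prod_mem_bracketSpan (k := k) (L := [b]) (by simpa using hb)
  have h2 : cls k (Word.prod [b]) = cls k b := cls_mul_one b
  rw [h2] at h
  exact mem_bracketSpan_of_eq h (add_zero _) (add_zero _)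

/-- The Leibniz rule distributes the bracket with `b` over the factors; each term replaces one
factor `c` by the bracket `[b, c]`. -/
theorem br_bracket_prod_mem {b : Word} (hb : b.IsBracket) {L : List Word}
    (hL : ∀ b ∈ L, b.IsBracket) : brL (cls k b) (cls k (Word.prod L)) ∈
      bracketSpan k (b.vars + (Word.prod L).vars) (b.wt + (Word.prod L).wt + 1) := by
  induction L with
  | nil =>
    rw [show Word.prod [] = .one from rfl, br_one]
    exact zero_mem _
  | cons c L ih =>
    have hc : c.IsBracket := hL c (by simp)
    have hL' : ∀ b ∈ L, b.IsBracket := fun b hb => hL b (by simp [hb])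
    rw [show Word.prod (c :: L) = .mul c (Word.prod L) from rfl, ← mulL_cls,
      (IsMono.cls b).leibniz (IsMono.cls c), brL_cls]
    refine add_mem ?_ (Submodule.smul_mem _ _ ?_)
    · refine mem_bracketSpan_of_eq (mul_mem_bracketSpan
        (bracket_mem_bracketSpan (b := .br b c) ⟨hb, hc⟩) (prod_mem_bracketSpan hL')) ?_ ?_
      · simp only [Word.vars]; abel
      · simp only [Word.wt]; ring
    · refine mem_bracketSpan_of_eq (mul_mem_bracketSpan
        (bracket_mem_bracketSpan hc) (ih hL')) ?_ ?_
      · simp only [Word.vars]; abel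
      · simp only [Word.wt]; ring

/-- The Leibniz rule is given in the second argument only, so antisymmetry moves the product there
and moves the resulting brackets back. -/
theorem br_prod_prod_mem {L L' : List Word} (hL : ∀ b ∈ L, b.IsBracket)
    (hL' : ∀ b ∈ L', b.IsBracket) : brL (cls k (Word.prod L)) (cls k (Word.prod L')) ∈
      bracketSpan k ((Word.prod L).vars + (Word.prod L').vars)
        ((Word.prod L).wt + (Word.prod L').wt + 1) := by
  induction L with
  | nil =>
    rw [show Word.prod [] = .one from rfl, one_br]
    exact zero_mem _
  | cons c L ih =>
    have hc : c.IsBracket := hL c (by simp)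
    have hL2 : ∀ b ∈ L, b.IsBracket := fun b hb => hL b (by simp [hb])
    rw [(IsMono.cls (Word.prod (c :: L))).antisymm (IsMono.cls (Word.prod L')),
      show Word.prod (c :: L) = .mul c (Word.prod L) from rfl, ← mulL_cls,
      (IsMono.cls (Word.prod L')).leibniz (IsMono.cls c),
      (IsMono.cls (Word.prod L')).antisymm (IsMono.cls c),
      (IsMono.cls (Word.prod L')).antisymm (IsMono.cls (Word.prod L))]
    simp only [map_neg, map_smul, LinearMap.neg_apply, LinearMap.smul_apply]
    refine neg_mem (Submodule.smul_mem _ _ (add_mem (neg_mem (Submodule.smul_mem _ _ ?_))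
      (Submodule.smul_mem _ _ (neg_mem (Submodule.smul_mem _ _ ?_)))))
    · refine mem_bracketSpan_of_eq (mul_mem_bracketSpan
        (br_bracket_prod_mem hc hL') (prod_mem_bracketSpan hL2)) ?_ ?_
      · simp only [Word.vars]; abel
      · simp only [Word.wt]; ring
    · refine mem_bracketSpan_of_eq (mul_mem_bracketSpan
        (bracket_mem_bracketSpan hc) (ih hL2)) ?_ ?_
      · simp only [Word.vars]; abel
      · simp only [Word.wt]; ring

theorem br_mem_bracketSpan {A B : Multiset ℕ} {w v : ℕ} {x y : FreeBV k}
    (hx : x ∈ bracketSpan k A w) (hy : y ∈ bracketSpan k B v) :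
    brL x y ∈ bracketSpan k (A + B) (w + v + 1) := by
  refine bracketSpan_induction (brL x) (fun L hL hv hw => ?_) hy
  refine bracketSpan_induction (brL.flip (cls k (Word.prod L))) (fun L' hL' hv' hw' => ?_) hx
  subst hv hw hv' hw'
  exact br_prod_prod_mem hL' hL

/-- As a derivation of the bracket, `δ` moves down to the letters, where `δ(x_i)` is again a letter
and `δ(δ(x_i)) = 0`. -/
theorem del_bracket_mem {b : Word} (hb : b.IsBracket) :
    delL (cls k b) ∈ bracketSpan k b.vars (b.wt + 1) := by
  induction b with
  | one => exact hb.elim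
  | var j => exact delL_cls (k := k) _ ▸ bracket_mem_bracketSpan (b := .del (.var j)) trivial
  | mul a b => exact hb.elim
  | br a b iha ihb =>
    rw [← brL_cls, (IsMono.cls a).del_br]
    refine sub_mem ?_ (Submodule.smul_mem _ _ ?_)
    · refine mem_bracketSpan_of_eq
        (br_mem_bracketSpan (iha hb.1) (bracket_mem_bracketSpan hb.2)) rfl ?_
      simp only [Word.wt]; ring
    · exact mem_bracketSpan_of_eq
        (br_mem_bracketSpan (bracket_mem_bracketSpan hb.1) (ihb hb.2)) rfl rfl
  | del a =>
    rw [← delL_cls, IsMono.del_del]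
    exact zero_mem _

theorem del_mem_bracketSpan {A : Multiset ℕ} {w : ℕ} {x : FreeBV k}
    (hx : x ∈ bracketSpan k A w) : delL x ∈ bracketSpan k A (w + 1) := by
  refine bracketSpan_induction delL (fun L hL hv hw => ?_) hx
  subst hv hw
  -- After the substitution `hx` mentions `L`, and it would otherwise enter the induction
  -- hypothesis.
  clear hx
  induction L with
  | nil =>
    rw [show Word.prod [] = .one from rfl, del_one]
    exact zero_mem _
  | cons c L ih =>
    have hc : c.IsBracket := hL c (by simp)
    have hL2 : ∀ b ∈ L, b.IsBracket := fun b hb => hL b (by simp [hb])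
    have hP := prod_mem_bracketSpan (k := k) hL2
    rw [show Word.prod (c :: L) = .mul c (Word.prod L) from rfl, ← mulL_cls,
      (IsMono.cls c).del_mul]
    refine add_mem (add_mem ?_ (Submodule.smul_mem _ _ ?_)) (Submodule.smul_mem _ _ ?_)
    · refine mem_bracketSpan_of_eq (mul_mem_bracketSpan (del_bracket_mem hc) hP) rfl ?_
      simp only [Word.wt]; ring
    · exact mem_bracketSpan_of_eq (mul_mem_bracketSpan (bracket_mem_bracketSpan hc)
        (ih hL2)) rfl rfl
    · exact mem_bracketSpan_of_eq
        (br_mem_bracketSpan (bracket_mem_bracketSpan hc) hP) rfl rfl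

/-- Every word is a linear combination of products of brackets. -/
theorem cls_mem_bracketSpan (t : Word) : cls k t ∈ bracketSpan k t.vars t.wt := by
  induction t with
  | one => exact prod_mem_bracketSpan (L := []) (by simp)
  | var j => exact bracket_mem_bracketSpan trivial
  | mul a b iha ihb => exact mulL_cls (k := k) a b ▸ mul_mem_bracketSpan iha ihb
  | br a b iha ihb => exact brL_cls (k := k) a b ▸ br_mem_bracketSpan iha ihb
  | del a iha => exact delL_cls (k := k) a ▸ del_mem_bracketSpan iha

/-! ### Star-partitions of products of brackets. -/

namespace Word

theorem stars_subset_vars (t : Word) : t.stars ⊆ t.vars.toFinset := by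
  induction t with
  | one => simp [stars]
  | var j => simp [stars]
  | mul a b iha ihb =>
    simpa [stars, vars, Multiset.toFinset_add] using Finset.union_subset_union iha ihb
  | br a b iha ihb =>
    simpa [stars, vars, Multiset.toFinset_add] using Finset.union_subset_union iha ihb
  | del a iha =>
    cases a with
    | one => simp [stars]
    | var j => simp [stars, vars]
    | _ => exact iha

theorem IsBracket.card_vars_pos {b : Word} (hb : b.IsBracket) : 0 < b.vars.card := by
  induction b with
  | one => exact hb.elim
  | var j => simp [vars]
  | mul a b => exact hb.elim
  | br a b iha ihb =>
    have := iha hb.1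
    simp only [vars, Multiset.card_add]
    omega
  | del a =>
    cases a <;> first | exact hb.elim | simp [vars]

/-- A genuine bracket contains at least two letters, one on each side. -/
theorem IsBracket.eq_of_vars_eq_singleton {b : Word} (hb : b.IsBracket) {i : ℕ}
    (h : b.vars = {i}) : b = var i ∨ b = del (var i) := by
  cases b with
  | one => exact hb.elim
  | var j =>
    left
    rw [show j = i by simpa [vars] using h]
  | mul a b => exact hb.elim
  | br a b =>
    have h1 := hb.1.card_vars_pos
    have h2 := hb.2.card_vars_pos
    have h3 := congrArg Multiset.card h
    simp only [vars, Multiset.card_add, Multiset.card_singleton] at h3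
    omega
  | del a =>
    right
    cases a with
    | var j => rw [show j = i by simpa [vars] using h]
    | _ => exact hb.elim

theorem vars_le_vars_prod {b : Word} {L : List Word} (hb : b ∈ L) : b.vars ≤ (prod L).vars := by
  induction L with
  | nil => simp at hb
  | cons c L ih =>
    change b.vars ≤ c.vars + (prod L).vars
    rcases List.mem_cons.1 hb with rfl | h
    · exact Multiset.le_add_right _ _
    · exact (ih h).trans (Multiset.le_add_left _ _)

theorem mem_vars_prod {i : ℕ} {L : List Word} : i ∈ (prod L).vars ↔ ∃ b ∈ L, i ∈ b.vars := by
  induction L with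
  | nil => simp [prod, vars]
  | cons c L ih =>
    change i ∈ c.vars + (prod L).vars ↔ _
    rw [Multiset.mem_add, ih]
    simp

theorem mem_stars_prod {i : ℕ} {L : List Word} : i ∈ (prod L).stars ↔ ∃ b ∈ L, i ∈ b.stars := by
  induction L with
  | nil => simp [prod, stars]
  | cons c L ih =>
    change i ∈ c.stars ∪ (prod L).stars ↔ _
    rw [Finset.mem_union, ih]
    simp

theorem pairwise_disjoint_of_nodup {L : List Word} (h : (prod L).vars.Nodup) :
    L.Pairwise fun a b => Disjoint a.vars.toFinset b.vars.toFinset := by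
  induction L with
  | nil => exact List.Pairwise.nil
  | cons c L ih =>
    change (c.vars + (prod L).vars).Nodup at h
    rw [Multiset.nodup_add] at h
    refine List.Pairwise.cons (fun b hb => ?_) (ih h.2.1)
    rw [Finset.disjoint_left]
    intro i hi hi'
    rw [Multiset.mem_toFinset] at hi hi'
    exact Multiset.disjoint_left.1 h.2.2 hi (mem_vars_prod.2 ⟨b, hb, hi'⟩)

theorem eq_of_mem_vars {L : List Word} (h : (prod L).vars.Nodup) {a b : Word} (ha : a ∈ L)
    (hb : b ∈ L) {i : ℕ} (hia : i ∈ a.vars) (hib : i ∈ b.vars) : a = b := by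
  by_contra hne
  have : Std.Symm fun a b : Word => Disjoint a.vars.toFinset b.vars.toFinset :=
    ⟨fun _ _ h => h.symm⟩
  have := (pairwise_disjoint_of_nodup h).forall ha hb hne
  exact Finset.disjoint_left.1 this (Multiset.mem_toFinset.2 hia) (Multiset.mem_toFinset.2 hib)

/-- The star-partition of a product of brackets. -/
theorem exists_starPartition {n : ℕ} {L : List Word} (hL : ∀ b ∈ L, b.IsBracket)
    (hv : (prod L).vars = Multiset.range n) :
    ∃ P : StarPartition n, (L.map fun b => b.vars.toFinset : Multiset (Finset ℕ)) =
      P.parts.parts.val ∧ (prod L).stars = P.stars := by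
  have hnd : (prod L).vars.Nodup := hv ▸ Multiset.nodup_range n
  have hp := pairwise_disjoint_of_nodup hnd
  have hne : ∀ b ∈ L, b.vars.toFinset ≠ ∅ := fun b hb h => by
    rw [Multiset.toFinset_eq_empty] at h
    have := (hL b hb).card_vars_pos
    simp [h] at this
  have hm : (L.map fun b => b.vars.toFinset).Nodup := by
    rw [List.Nodup, List.pairwise_map]
    refine hp.imp_of_mem fun {a b} ha hb hab heq => hne a ha ?_
    rw [← heq] at hab
    exact Finset.disjoint_self_iff_empty _ |>.1 hab
  refine ⟨⟨⟨⟨_, Multiset.coe_nodup.2 hm⟩, ?_, ?_, ?_⟩, (prod L).stars, ?_⟩, rfl, rfl⟩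
  · rw [Finset.supIndep_iff_pairwiseDisjoint]
    intro x hx y hy hxy
    simp only [Finset.mem_coe, Finset.mem_mk, Multiset.mem_coe, List.mem_map] at hx hy
    obtain ⟨a, ha, rfl⟩ := hx
    obtain ⟨b, hb, rfl⟩ := hy
    have : Std.Symm fun a b : Word => Disjoint a.vars.toFinset b.vars.toFinset :=
      ⟨fun _ _ h => h.symm⟩
    exact hp.forall ha hb fun h => hxy (by rw [h])
  · ext i
    simp only [Finset.mem_sup, Finset.mem_mk, Multiset.mem_coe, List.mem_map, id]
    rw [Finset.mem_range, ← Multiset.mem_range, ← hv, mem_vars_prod]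
    constructor
    · rintro ⟨_, ⟨b, hb, rfl⟩, hi⟩
      exact ⟨b, hb, Multiset.mem_toFinset.1 hi⟩
    · rintro ⟨b, hb, hi⟩
      exact ⟨_, ⟨b, hb, rfl⟩, Multiset.mem_toFinset.2 hi⟩
  · simp only [Finset.mem_mk, Multiset.mem_coe, List.mem_map, not_exists, not_and]
    exact fun b hb => hne b hb
  · refine (stars_subset_vars _).trans fun i hi => ?_
    rwa [Multiset.mem_toFinset, hv, Multiset.mem_range, ← Finset.mem_range] at hi

/-- The factor belonging to a singleton block `{i}` is either `x_i` or `δ(x_i)`, and the star tells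
which. This translates the combinatorial condition defining `E_0` and `F_1` into the presence of a
bare generator as a factor. -/
theorem unstarred_pos_iff {n : ℕ} {L : List Word} (hL : ∀ b ∈ L, b.IsBracket)
    (hv : (prod L).vars = Multiset.range n) {P : StarPartition n}
    (hP : (L.map fun b => b.vars.toFinset : Multiset (Finset ℕ)) = P.parts.parts.val)
    (hS : (prod L).stars = P.stars) : 1 ≤ P.unstarred ↔ ∃ i, var i ∈ L := by
  have hnd : (prod L).vars.Nodup := hv ▸ Multiset.nodup_range n
  have hmem : ∀ s, s ∈ P.parts.parts ↔ ∃ b ∈ L, b.vars.toFinset = s := fun s => by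
    rw [← Finset.mem_val, ← hP]
    simp
  rw [StarPartition.unstarred, Nat.one_le_iff_ne_zero, ← Nat.pos_iff_ne_zero, Finset.card_pos]
  constructor
  · rintro ⟨i, hi⟩
    simp only [Finset.mem_filter, hmem, ← hS] at hi
    obtain ⟨_, ⟨b, hb, hbi⟩, his⟩ := hi
    -- The block only records the set of indices; the multiset is recovered because no index is
    -- repeated.
    have hbv : b.vars = {i} := by
      have h1 := (Multiset.nodup_of_le (vars_le_vars_prod hb) hnd).dedup
      rw [← h1, ← Multiset.toFinset_val, hbi, Finset.singleton_val]
    rcases (hL b hb).eq_of_vars_eq_singleton hbv with rfl | rfl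
    · exact ⟨i, hb⟩
    · exact absurd (mem_stars_prod.2 ⟨_, hb, by simp [stars]⟩) his
  · rintro ⟨i, hi⟩
    have hiv : i ∈ (var i).vars := by simp [vars]
    refine ⟨i, ?_⟩
    simp only [Finset.mem_filter, hmem, ← hS, Finset.mem_range]
    refine ⟨?_, ⟨_, hi, by simp [vars]⟩, fun h => ?_⟩
    · rw [← Multiset.mem_range, ← hv]
      exact mem_vars_prod.2 ⟨_, hi, hiv⟩
    · obtain ⟨b, hb, hbs⟩ := mem_stars_prod.1 h
      have := eq_of_mem_vars hnd hi hb hiv (Multiset.mem_toFinset.1 (stars_subset_vars b hbs))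
      subst this
      simp [stars] at hbs

end Word

/-! ### Substituting the unit, and splitting off generators. -/

theorem codegL_bracket {b : Word} (hb : b.IsBracket) {i : ℕ} (hi : i ∈ b.vars)
    (hne : b ≠ .var i) : cls k (b.bind (codeg i)) = 0 := by
  have hvar : codeg i i = .one := by simp [codeg]
  -- One side of a bracket contains `x_i`. If it is `x_i` itself it becomes the unit, which brackets
  -- to zero; otherwise it vanishes by induction.
  have key : ∀ a : Word, (a.IsBracket → i ∈ a.vars → a ≠ .var i → cls k (a.bind (codeg i)) = 0) →
      a.IsBracket → i ∈ a.vars → a.bind (codeg i) = .one ∨ cls k (a.bind (codeg i)) = 0 := by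
    intro a h ha hia
    by_cases h1 : a = .var i
    · left
      rw [h1, Word.bind, hvar]
    · exact Or.inr (h ha hia h1)
  induction b with
  | one => exact hb.elim
  | var j =>
    have : i = j := by simpa [Word.vars] using hi
    exact absurd (by rw [this]) hne
  | mul a b => exact hb.elim
  | br a b iha ihb =>
    rw [Word.bind, ← brL_cls]
    rcases Multiset.mem_add.1 hi with h | h
    · rcases key a iha hb.1 h with h1 | h1
      · rw [h1, one_br]
      · rw [h1, map_zero, LinearMap.zero_apply]
    · rcases key b ihb hb.2 h with h1 | h1
      · rw [h1, br_one]
      · rw [h1, map_zero]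
  | del a =>
    cases a with
    | var j =>
      have : i = j := by simpa [Word.vars] using hi
      subst this
      rw [Word.bind, Word.bind, hvar, ← delL_cls, del_one]
    | _ => exact hb.elim

theorem codegL_prod {L : List Word} (hL : ∀ b ∈ L, b.IsBracket) {i : ℕ}
    (hi : i ∈ (Word.prod L).vars) (hne : .var i ∉ L) :
    cls k ((Word.prod L).bind (codeg i)) = 0 := by
  induction L with
  | nil => simp [Word.prod, Word.vars] at hi
  | cons c L ih =>
    change cls k (.mul (c.bind (codeg i)) ((Word.prod L).bind (codeg i))) = 0
    rw [← mulL_cls]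
    rcases Multiset.mem_add.1 hi with h | h
    · rw [codegL_bracket (hL c (by simp)) h fun h => hne (by simp [h]), map_zero,
        LinearMap.zero_apply]
    · rw [ih (fun b hb => hL b (by simp [hb])) h fun h => hne (by simp [h]), map_zero]

theorem cls_mul_left_comm_var (i : ℕ) (a s : Word) :
    cls k (.mul a (.mul (.var i) s)) = cls k (.mul (.var i) (.mul a s)) := by
  rw [← cls_mul_assoc, ← cls_mul_assoc]
  refine cls_mul_congr ?_ rfl
  rw [← mulL_cls, (IsMono.cls a).mul_comm (IsMono.cls (.var i)), mulL_cls]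
  simp [Word.wt]

/-- Generators have degree zero, so `x_i` moves to the front without a sign. -/
theorem exists_prod_eq_var_mul {L : List Word} {i : ℕ} (hi : .var i ∈ L) :
    ∃ s : Word, (Word.prod L).vars = {i} + s.vars ∧ (Word.prod L).wt = s.wt ∧
      cls k (Word.prod L) = cls k (.mul (.var i) s) := by
  induction L with
  | nil => simp at hi
  | cons c L ih =>
    rcases List.mem_cons.1 hi with h | h
    · subst h
      exact ⟨Word.prod L, rfl, zero_add _, rfl⟩
    · obtain ⟨s, h1, h2, h3⟩ := ih h
      refine ⟨.mul c s, ?_, ?_, ?_⟩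
      · change c.vars + (Word.prod L).vars = {i} + (c.vars + s.vars)
        rw [h1, add_left_comm]
      · change c.wt + (Word.prod L).wt = c.wt + s.wt
        rw [h2]
      · rw [← cls_mul_left_comm_var]
        exact cls_mul_congr rfl h3

/-- Substitution of the unit for the `i`-th generator. -/
def unitAt (i j : ℕ) : Word := if j = i then .one else .var j

theorem wt_unitAt (i j : ℕ) : (unitAt i j).wt = 0 := by
  unfold unitAt
  split_ifs <;> rfl

variable (k) in
/-- The idempotent operator which replaces `x_i` by the unit and multiplies by `x_i`. -/
def extract (i : ℕ) : FreeBV k →ₗ[k] FreeBV k :=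
  mulL (cls k (.var i)) ∘ₗ substL (unitAt i) (wt_unitAt i)

theorem extract_cls (i : ℕ) (t : Word) :
    extract k i (cls k t) = cls k (.mul (.var i) (t.bind (unitAt i))) := by
  rw [extract, LinearMap.comp_apply, substL_cls, mulL_cls]

theorem extract_comm (i j : ℕ) : extract k i ∘ₗ extract k j = extract k j ∘ₗ extract k i := by
  refine FreeBV.hom_ext fun t => ?_
  by_cases h : i = j
  · rw [h]
  simp only [LinearMap.comp_apply, extract_cls, Word.bind]
  rw [show unitAt i j = .var j by simp [unitAt, Ne.symm h],
    show unitAt j i = .var i by simp [unitAt, h], cls_mul_left_comm_var]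
  refine cls_mul_congr rfl (cls_mul_congr rfl ?_)
  rw [Word.bind_bind, Word.bind_bind]
  refine cls_bind_congr t fun x _ => ?_
  by_cases h1 : x = i
  · subst h1
    simp [unitAt, Word.bind, h]
  · by_cases h2 : x = j
    · subst h2
      simp [unitAt, Word.bind, h1]
    · simp [unitAt, Word.bind, h1, h2]

/-- Putting `x_i = 1` removes the factor, and multiplying by `x_i` restores it. -/
theorem extract_var_mul {i : ℕ} {s : Word} (hi : i ∉ s.vars) :
    extract k i (cls k (.mul (.var i) s)) = cls k (.mul (.var i) s) := by
  rw [extract_cls]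
  refine cls_mul_congr rfl ?_
  change cls k (.mul (unitAt i i) (s.bind (unitAt i))) = cls k s
  rw [show unitAt i i = .one by simp [unitAt], cls_one_mul]
  conv_rhs => rw [← Word.bind_var s]
  refine cls_bind_congr s fun x hx => ?_
  have h : x ≠ i := fun h => hi (h ▸ hx)
  rw [unitAt, if_neg h]

/-- Renumbering of the generators that skips the index `i`. -/
def skip (i j : ℕ) : Word := .var (if j < i then j else j + 1)

theorem wt_skip (i j : ℕ) : (skip i j).wt = 0 := rfl

/-- Putting `x_i = 1` without renumbering is the codegeneracy followed by the renumbering `skip i`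
that reopens the gap at `i`, so it factors through `codegL k i`. -/
theorem extract_eq_zero {i : ℕ} {x : FreeBV k} (hx : codegL k i x = 0) : extract k i x = 0 := by
  have h : substL (k := k) (unitAt i) (wt_unitAt i)
      = substL (skip i) (wt_skip i) ∘ₗ codegL k i := by
    refine FreeBV.hom_ext fun t => ?_
    simp only [LinearMap.comp_apply, substL_cls, codegL_cls, Word.bind_bind]
    refine cls_bind_congr t fun x _ => ?_
    rcases lt_trichotomy x i with h1 | h1 | h1
    · simp [unitAt, codeg, skip, Word.bind, h1, h1.ne]
    · simp [unitAt, codeg, Word.bind, h1]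
    · simp [unitAt, codeg, skip, Word.bind, h1.ne', h1.not_gt, show ¬ x - 1 < i by omega,
        show x - 1 + 1 = x by omega]
  rw [extract, h, LinearMap.comp_apply, LinearMap.comp_apply, hx, map_zero, map_zero]

variable (k) in
/-- The product of the operators `1 - extract k i` for `i < n`. -/
def eliminate : ℕ → FreeBV k →ₗ[k] FreeBV k
  | 0 => LinearMap.id
  | n + 1 => (LinearMap.id - extract k n) ∘ₗ eliminate n

theorem eliminate_extract (n i : ℕ) (x : FreeBV k) :
    eliminate k n (extract k i x) = extract k i (eliminate k n x) := by
  induction n with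
  | zero => rfl
  | succ n ih =>
    have h := LinearMap.congr_fun (extract_comm (k := k) n i) (eliminate k n x)
    simp only [LinearMap.comp_apply] at h
    simp [eliminate, ih, h]

theorem eliminate_eq_self {n : ℕ} {x : FreeBV k} (hx : ∀ i < n, extract k i x = 0) :
    eliminate k n x = x := by
  induction n with
  | zero => rfl
  | succ n ih =>
    simp [eliminate, ih fun i hi => hx i (by omega), hx n (by omega)]

/-- The factor `1 - extract k i` kills `x`, and `extract k i` commutes with the other factors. -/
theorem eliminate_eq_zero {n i : ℕ} (hi : i < n) {x : FreeBV k} (hx : extract k i x = x) :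
    eliminate k n x = 0 := by
  induction n with
  | zero => omega
  | succ n ih =>
    rcases Nat.lt_succ_iff_lt_or_eq.1 hi with h | rfl
    · simp [eliminate, ih h]
    · simp only [eliminate, LinearMap.comp_apply, LinearMap.sub_apply, LinearMap.id_apply]
      rw [← eliminate_extract, hx, sub_self]

/-! ### The normalized part and its complement. -/

theorem mem_normalized_iff {n w : ℕ} {x : BV k n w} :
    x ∈ (cosimplicial k w).normalized n ↔ ∀ i < n, codegL k i x = 0 := by
  cases n with
  | zero => exact ⟨fun _ i hi => by omega, fun _ => Submodule.mem_top⟩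
  | succ n =>
    rw [CosimplicialModule.normalized, CosimplicialModule.mem_partialKer_succ]
    refine forall_congr' fun i => forall_congr' fun hi => ?_
    rw [← coe_codegeneracy (by omega), Submodule.coe_eq_zero]
    rfl

variable (k) in
/-- The span of the expressions having one of the generators as a factor. -/
def factorPart (n w : ℕ) : Submodule k (BV k n w) :=
  Submodule.span k {x | ∃ i s, (Word.mul (.var i) s).vars = Multiset.range n ∧ s.wt = w ∧
    (x : FreeBV k) = cls k (.mul (.var i) s)}

variable (k) in
/-- The part of a summand of the operad that comes from a star-partition. -/
abbrev starPart {n : ℕ} (P : StarPartition n) (w : ℕ) : Submodule k (BV k n w) :=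
  (summand k P w).comap (BV k n w).subtype

theorem mem_of_coe_mem_map {n w : ℕ} {S : Submodule k (BV k n w)} {x : BV k n w}
    (h : (x : FreeBV k) ∈ S.map (BV k n w).subtype) : x ∈ S := by
  obtain ⟨y, hy, hyx⟩ := h
  rwa [← Subtype.ext hyx]

theorem starPart_le_normalized {n : ℕ} {P : StarPartition n} (w : ℕ) (hP : P.unstarred = 0) :
    starPart k P w ≤ (cosimplicial k w).normalized n := by
  intro x hx
  rw [mem_normalized_iff]
  intro i hi
  have : summand k P w ≤ LinearMap.ker (codegL k i) := by
    refine Submodule.span_le.2 ?_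
    rintro _ ⟨L, hL, hv, hp, hs, _, rfl⟩
    rw [SetLike.mem_coe, LinearMap.mem_ker, codegL_cls]
    refine codegL_prod hL (by rw [hv]; exact Multiset.mem_range.2 hi) fun h => ?_
    have := (Word.unstarred_pos_iff hL hv hp hs).2 ⟨i, h⟩
    omega
  exact this hx

theorem starPart_le_factorPart {n : ℕ} {P : StarPartition n} (w : ℕ) (hP : 1 ≤ P.unstarred) :
    starPart k P w ≤ factorPart k n w := by
  intro x hx
  refine mem_of_coe_mem_map ?_
  have : summand k P w ≤ (factorPart k n w).map (BV k n w).subtype := by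
    refine Submodule.span_le.2 ?_
    rintro _ ⟨L, hL, hv, hp, hs, hw, rfl⟩
    obtain ⟨i, hi⟩ := (Word.unstarred_pos_iff hL hv hp hs).1 hP
    obtain ⟨s, h1, h2, h3⟩ := exists_prod_eq_var_mul (k := k) hi
    exact ⟨⟨_, cls_mem_BV hv hw⟩, Submodule.subset_span ⟨i, s, h1.symm.trans hv,
      h2.symm.trans hw, h3⟩, rfl⟩
  exact this hx

theorem cls_prod_mem_starPart {n w : ℕ} {L : List Word} (hL : ∀ b ∈ L, b.IsBracket)
    (hv : (Word.prod L).vars = Multiset.range n) (hw : (Word.prod L).wt = w) :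
    ∃ P : StarPartition n, (1 ≤ P.unstarred ↔ ∃ i, .var i ∈ L) ∧
      (⟨cls k (Word.prod L), cls_mem_BV hv hw⟩ : BV k n w) ∈ starPart k P w := by
  obtain ⟨P, hp, hs⟩ := Word.exists_starPartition hL hv
  exact ⟨P, Word.unstarred_pos_iff hL hv hp hs,
    Submodule.subset_span ⟨L, hL, hv, hp, hs, hw, rfl⟩⟩

/-- Expand the cofactor of `x_i` in products of brackets. Prepending `x_i` to such a product gives
an element of a summand in which `{i}` is an unstarred singleton. -/
theorem factorPart_le {n w : ℕ} {S : Submodule k (BV k n w)}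
    (hS : ∀ P : StarPartition n, 1 ≤ P.unstarred → starPart k P w ≤ S) :
    factorPart k n w ≤ S := by
  refine Submodule.span_le.2 ?_
  rintro x ⟨i, s, hv, hw, hx⟩
  refine mem_of_coe_mem_map ?_
  rw [hx, ← mulL_cls]
  refine bracketSpan_induction _ (fun L hL hvL hwL => ?_) (cls_mem_bracketSpan s)
  obtain ⟨P, hP, hmem⟩ := cls_prod_mem_starPart (k := k) (L := .var i :: L) (n := n) (w := w)
    (by simpa [Word.IsBracket] using hL)
    ((congrArg (fun A => ({i} : Multiset ℕ) + A) hvL).trans hv)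
    ((zero_add _).trans (hwL.trans hw))
  refine ⟨_, hS P (hP.2 ⟨i, by simp⟩) hmem, ?_⟩
  rw [mulL_cls]
  rfl

theorem eq_top_of_starPart_le {n w : ℕ} {S : Submodule k (BV k n w)}
    (hS : ∀ P : StarPartition n, starPart k P w ≤ S) : S = ⊤ := by
  refine eq_top_iff.2 fun x _ => mem_of_coe_mem_map ?_
  refine multiPart_induction LinearMap.id (fun t hv hw => ?_) x.2
  refine bracketSpan_induction LinearMap.id (fun L hL hvL hwL => ?_) (cls_mem_bracketSpan t)
  obtain ⟨P, -, hmem⟩ := cls_prod_mem_starPart (k := k) hL (hvL.trans hv) (hwL.trans hw)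
  exact ⟨_, hS P hmem, rfl⟩

/-- The operator `eliminate k n` is the identity on the first submodule and zero on the second. -/
theorem disjoint_normalized_factorPart (n w : ℕ) :
    Disjoint ((cosimplicial k w).normalized n) (factorPart k n w) := by
  rw [Submodule.disjoint_def]
  intro x hx hx'
  rw [mem_normalized_iff] at hx
  have h1 := eliminate_eq_self fun i hi => extract_eq_zero (hx i hi)
  have h2 : factorPart k n w ≤ LinearMap.ker (eliminate k n ∘ₗ (BV k n w).subtype) := by
    refine Submodule.span_le.2 ?_
    rintro y ⟨i, s, hv, _, hy⟩
    rw [SetLike.mem_coe, LinearMap.mem_ker, LinearMap.comp_apply, Submodule.subtype_apply, hy]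
    have hnd : (Word.mul (.var i) s).vars.Nodup := hv ▸ Multiset.nodup_range n
    refine eliminate_eq_zero (i := i) ?_ (extract_var_mul ?_)
    · rw [← Multiset.mem_range, ← hv]
      simp [Word.vars]
    · exact (Multiset.nodup_cons.1 hnd).1
  exact Subtype.ext (h1.symm.trans (h2 hx'))

theorem isCompl_normalized_factorPart (n w : ℕ) :
    IsCompl ((cosimplicial k w).normalized n) (factorPart k n w) := by
  refine ⟨disjoint_normalized_factorPart n w, codisjoint_iff.2 (eq_top_of_starPart_le fun P => ?_)⟩
  rcases Nat.eq_zero_or_pos P.unstarred with h | h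
  · exact (starPart_le_normalized w h).trans le_sup_left
  · exact (starPart_le_factorPart w h).trans le_sup_right

/-- The sum `T` of the summands without unstarred singletons lies in the normalized part and spans
everything together with `factorPart`. As `factorPart` meets the normalized part trivially, `T` must
be all of the latter. -/
theorem normalized_le_of_starPart_le {n w : ℕ} {S : Submodule k (BV k n w)}
    (hS : ∀ P : StarPartition n, P.unstarred = 0 → starPart k P w ≤ S) :
    (cosimplicial k w).normalized n ≤ S := by
  set T : Submodule k (BV k n w) := ⨆ (P : StarPartition n) (_ : P.unstarred = 0), starPart k P w
  have hT : T ≤ (cosimplicial k w).normalized n :=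
    iSup₂_le fun P hP => starPart_le_normalized w hP
  have hTS : T ≤ S := iSup₂_le hS
  have htop : T ⊔ factorPart k n w = ⊤ := eq_top_of_starPart_le fun P => by
    rcases Nat.eq_zero_or_pos P.unstarred with h | h
    · exact (le_iSup₂ (f := fun (P : StarPartition n) (_ : P.unstarred = 0) => starPart k P w)
        P h).trans le_sup_left
    · exact (starPart_le_factorPart w h).trans le_sup_right
  intro x hx
  obtain ⟨y, hy, z, hz, rfl⟩ := Submodule.mem_sup.1 (htop ▸ Submodule.mem_top : x ∈ T ⊔ _)
  have : z = 0 := (Submodule.disjoint_def.1 (disjoint_normalized_factorPart n w)) z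
    (by simpa using sub_mem hx (hT hy)) hz
  rw [this, add_zero]
  exact hTS hy

/-! ### Invariance under the differential. -/

/-- Every coface leaves a bare generator as a factor: the new outer one, the old one renumbered, or
the first half of the doubled one. -/
theorem face_var_mul (n j i : ℕ) (s : Word) : ∃ i' s',
    cls k (face n j (.mul (.var i) s)) = cls k (.mul (.var i') s') ∧
      (Word.mul (.var i') s').vars = (face n j (.mul (.var i) s)).vars ∧ s'.wt = s.wt := by
  unfold face
  split_ifs
  · exact ⟨0, _, rfl, rfl, (Word.wt_bind (fun _ => rfl) _).trans (zero_add _)⟩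
  · exact ⟨i, .mul s (.var n), cls_mul_assoc _ _ _, (add_assoc _ _ _).symm, rfl⟩
  · have hw := Word.wt_bind (wt_dbl (j - 1)) s
    change ∃ i' s', cls k (.mul (dbl (j - 1) i) (s.bind (dbl (j - 1)))) = cls k (.mul (.var i') s') ∧
      _ = (Word.mul (dbl (j - 1) i) (s.bind (dbl (j - 1)))).vars ∧ _
    generalize s.bind (dbl (j - 1)) = t at hw ⊢
    unfold dbl
    split_ifs with h1 h2
    · exact ⟨_, _, rfl, rfl, hw⟩
    · exact ⟨_, .mul _ _, cls_mul_assoc _ _ _, (add_assoc _ _ _).symm, (zero_add _).trans hw⟩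
    · exact ⟨_, _, rfl, rfl, hw⟩

theorem coface_mem_factorPart {n w j : ℕ} (hj : j ≤ n + 1) {x : BV k n w}
    (hx : x ∈ factorPart k n w) : coface k w n j x ∈ factorPart k (n + 1) w := by
  suffices factorPart k n w ≤ (factorPart k (n + 1) w).comap (coface k w n j) from this hx
  refine Submodule.span_le.2 ?_
  rintro y ⟨i, s, hv, hw, hy⟩
  obtain ⟨i', s', h1, h2, h3⟩ := face_var_mul (k := k) n j i s
  refine Submodule.subset_span ⟨i', s', h2.trans (face_vars hj hv), h3.trans hw, ?_⟩
  rw [coe_coface hj, hy, faceL_cls, h1]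

theorem bdry_mem_normalized (e : ℤ) {n w : ℕ} {x : BV k n w}
    (hx : x ∈ (cosimplicial k w).normalized n) :
    bdry e n w x ∈ (cosimplicial k w).normalized (n + 1) := by
  rw [bdry_eq, Units.smul_def]
  exact zsmul_mem (CosimplicialModule.bdry_mem_normalized _ hx) _

theorem bdry_mem_factorPart (e : ℤ) {n w : ℕ} {x : BV k n w} (hx : x ∈ factorPart k n w) :
    bdry e n w x ∈ factorPart k (n + 1) w := by
  rw [bdry_eq, Units.smul_def, CosimplicialModule.bdry_apply]
  refine zsmul_mem (sum_mem fun j hj => zsmul_mem (coface_mem_factorPart ?_ hx) _) _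
  have := Finset.mem_range.1 hj
  omega

/-! ### From the components to the total space. -/

theorem Total.hom_ext {e p : ℤ} {N : Type*} [AddCommGroup N] [Module k N]
    {f g : Total k e p →ₗ[k] N}
    (h : ∀ (a : Idx e p) (x : BV k a.n a.w), f (Total.incl k a x) = g (Total.incl k a x)) : f = g := by
  refine DirectSum.linearMap_ext k fun a => LinearMap.ext fun x => ?_
  exact h a x

/-- The linear map on the total space given by its values on the summands. -/
def Total.lift {e p : ℤ} {N : Type*} [AddCommGroup N] [Module k N]
    (f : ∀ a : Idx e p, BV k a.n a.w →ₗ[k] N) : Total k e p →ₗ[k] N :=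
  DirectSum.toModule k (Idx e p) N f

@[simp] theorem Total.lift_incl {e p : ℤ} {N : Type*} [AddCommGroup N] [Module k N]
    (f : ∀ a : Idx e p, BV k a.n a.w →ₗ[k] N) (a : Idx e p) (x : BV k a.n a.w) :
    Total.lift f (Total.incl k a x) = f a x :=
  DirectSum.toModule_lof k (M := fun a : Idx e p => BV k a.n a.w) (N := N) (φ := f) a x

/-- The submodule of the total space given by submodules of the summands. -/
def totalSub (S : ∀ n w, Submodule k (BV k n w)) (e p : ℤ) : Submodule k (Total k e p) :=
  ⨆ a : Idx e p, (S a.n a.w).map (Total.incl k a)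

theorem incl_mem_totalSub {S : ∀ n w, Submodule k (BV k n w)} {e p : ℤ} (a : Idx e p)
    {x : BV k a.n a.w} (hx : x ∈ S a.n a.w) : Total.incl k a x ∈ totalSub S e p :=
  Submodule.mem_iSup_of_mem a ⟨x, hx, rfl⟩

theorem totalSub_le {S : ∀ n w, Submodule k (BV k n w)} {e p : ℤ} {T : Submodule k (Total k e p)}
    (h : ∀ (a : Idx e p) (x : BV k a.n a.w), x ∈ S a.n a.w → Total.incl k a x ∈ T) :
    totalSub S e p ≤ T :=
  iSup_le fun a => Submodule.map_le_iff_le_comap.2 (h a)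

variable (k) in
/-- The projection of the total space to a summand. -/
def Total.component {e p : ℤ} (a : Idx e p) : Total k e p →ₗ[k] BV k a.n a.w :=
  DirectSum.component k (Idx e p) (fun a => BV k a.n a.w) a

theorem Total.component_mem {S : ∀ n w, Submodule k (BV k n w)} {e p : ℤ} {x : Total k e p}
    (hx : x ∈ totalSub S e p) (a : Idx e p) : Total.component k a x ∈ S a.n a.w := by
  suffices totalSub S e p ≤ (S a.n a.w).comap (Total.component k a) from this hx
  refine totalSub_le fun b y hy => ?_
  have h : DirectSum.component k (Idx e p) (fun a => BV k a.n a.w) a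
      (DirectSum.lof k (Idx e p) (fun a => BV k a.n a.w) b y) ∈ S a.n a.w := by
    rw [DirectSum.component.of]
    split_ifs with hab
    · subst hab
      exact hy
    · exact zero_mem _
  exact h

theorem Total.ext_component {e p : ℤ} {x : Total k e p}
    (h : ∀ a, Total.component k a x = 0) : x = 0 :=
  DFinsupp.ext h

theorem isCompl_totalSub {S T : ∀ n w, Submodule k (BV k n w)}
    (h : ∀ n w, IsCompl (S n w) (T n w)) (e p : ℤ) :
    IsCompl (totalSub S e p) (totalSub T e p) := by
  constructor
  · rw [Submodule.disjoint_def]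
    intro x hx hx'
    exact Total.ext_component fun a => Submodule.disjoint_def.1 (h a.n a.w).disjoint _
      (Total.component_mem hx a) (Total.component_mem hx' a)
  -- Written as the kernel of a quotient map, the sum can be compared with the whole space on each
  -- summand separately.
  · rw [codisjoint_iff, ← Submodule.ker_mkQ (totalSub S e p ⊔ totalSub T e p),
      LinearMap.ker_eq_top]
    refine Total.hom_ext fun a x => ?_
    rw [LinearMap.zero_apply, Submodule.mkQ_apply, Submodule.Quotient.mk_eq_zero]
    have hx : x ∈ S a.n a.w ⊔ T a.n a.w := (h a.n a.w).sup_eq_top ▸ Submodule.mem_top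
    obtain ⟨y, hy, z, hz, rfl⟩ := Submodule.mem_sup.1 hx
    rw [map_add]
    exact Submodule.add_mem_sup (incl_mem_totalSub a hy) (incl_mem_totalSub a hz)

theorem invariant_totalSub {e : ℤ} {S : ∀ n w, Submodule k (BV k n w)}
    (h : ∀ n w, ∀ x ∈ S n w, bdry e n w x ∈ S (n + 1) w) : Invariant (totalSub S e) := by
  intro p
  refine totalSub_le (T := (totalSub S e (p + 1)).comap (totalBdry k e p)) fun a x hx => ?_
  rw [Submodule.mem_comap, totalBdry_incl]
  exact incl_mem_totalSub a.next (h _ _ x hx)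

theorem E_zero_eq (e p : ℤ) :
    E k e 0 p = totalSub (fun n w => (cosimplicial k w).normalized n) e p := by
  refine le_antisymm ?_ ?_
  · exact iSup_le fun a => iSup₂_le fun P hP =>
      (Submodule.map_mono (starPart_le_normalized a.w hP)).trans
        (le_iSup (fun a : Idx e p =>
          ((cosimplicial k a.w).normalized a.n).map (Total.incl k a)) a)
  · refine iSup_le fun a => Submodule.map_le_iff_le_comap.2
      (normalized_le_of_starPart_le fun P hP => Submodule.map_le_iff_le_comap.1 ?_)
    exact le_iSup_of_le a (le_iSup₂_of_le P hP le_rfl)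

/-- In both directions the only condition on a star-partition is that it has at least one unstarred
singleton; its number is the index `j` of the `E_j` in question. -/
theorem F_one_eq (e p : ℤ) : F k e 1 p = totalSub (factorPart k) e p := by
  refine le_antisymm ?_ ?_
  · refine iSup₂_le fun j hj => iSup_le fun a => iSup₂_le fun P hP =>
      (Submodule.map_mono (starPart_le_factorPart a.w ?_)).trans
        (le_iSup (fun a : Idx e p => (factorPart k a.n a.w).map (Total.incl k a)) a)
    rw [hP]
    exact hj
  · refine iSup_le fun a => Submodule.map_le_iff_le_comap.2
      (factorPart_le fun P hP => Submodule.map_le_iff_le_comap.1 ?_)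
    exact le_iSup₂_of_le P.unstarred hP (le_iSup_of_le a (le_iSup₂_of_le P rfl le_rfl))

/-! ### The projection and the homotopy on the total space. -/

variable (k) in
/-- The projection of the Hochschild complex onto its normalized part. -/
def totalProj (e p : ℤ) : Total k e p →ₗ[k] Total k e p :=
  Total.lift fun a => Total.incl k a ∘ₗ (cosimplicial k a.w).proj a.n

variable (k) in
/-- The homotopy between the identity and the projection onto the normalized part. -/
def totalHomotopy (e p : ℤ) : Total k e (p + 1) →ₗ[k] Total k e p :=
  Total.lift fun
    -- The homotopy removes one input, so it is zero on elements without inputs. In the other case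
    -- the sign by which `∂` differs from the cosimplicial differential is inserted; it squares to
    -- one.
    | ⟨0, _, _⟩ => 0
    | ⟨n + 1, w, h⟩ => Total.incl k (⟨n, w, by push_cast at h; linarith⟩ : Idx e p) ∘ₗ
        (((Int.negOnePow (-e * w) : ℤˣ) : ℤ) • (cosimplicial k w).homotopy n)

theorem totalProj_incl {e p : ℤ} (a : Idx e p) (x : BV k a.n a.w) :
    totalProj k e p (Total.incl k a x) = Total.incl k a ((cosimplicial k a.w).proj a.n x) :=
  Total.lift_incl _ a x

theorem totalProj_mem {e p : ℤ} (x : Total k e p) : totalProj k e p x ∈ E k e 0 p := by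
  rw [E_zero_eq, ← Submodule.Quotient.mk_eq_zero]
  suffices Submodule.mkQ _ ∘ₗ totalProj k e p = 0 from LinearMap.congr_fun this x
  refine Total.hom_ext fun a x => ?_
  rw [LinearMap.comp_apply, totalProj_incl, LinearMap.zero_apply, Submodule.mkQ_apply,
    Submodule.Quotient.mk_eq_zero]
  exact incl_mem_totalSub (S := fun n w => (cosimplicial k w).normalized n) a
    ((cosimplicial k a.w).proj_mem (n := a.n) x)

theorem totalProj_eq_self {e p : ℤ} {x : Total k e p} (hx : x ∈ E k e 0 p) :
    totalProj k e p x = x := by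
  rw [E_zero_eq] at hx
  refine totalSub_le (T := LinearMap.eqLocus (totalProj k e p) LinearMap.id)
    (fun a x hx => ?_) hx
  rw [LinearMap.mem_eqLocus, totalProj_incl, CosimplicialModule.proj_eq_self _ hx,
    LinearMap.id_apply]

theorem totalBdry_totalProj {e p : ℤ} (x : Total k e p) :
    totalBdry k e p (totalProj k e p x) = totalProj k e (p + 1) (totalBdry k e p x) := by
  suffices totalBdry k e p ∘ₗ totalProj k e p = totalProj k e (p + 1) ∘ₗ totalBdry k e p from
    LinearMap.congr_fun this x
  refine Total.hom_ext fun a x => ?_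
  rw [LinearMap.comp_apply, LinearMap.comp_apply, totalProj_incl, totalBdry_incl, totalBdry_incl,
    totalProj_incl, bdry_eq, bdry_eq, CosimplicialModule.bdry_proj, Units.smul_def,
    Units.smul_def]
  exact congrArg (Total.incl k a.next)
    (map_zsmul ((cosimplicial k a.w).proj (a.n + 1)) _ _).symm

theorem zsmul_map_zsmul {A B : Type*} [AddCommGroup A] [Module k A] [AddCommGroup B] [Module k B]
    (f : A →ₗ[k] B) {u : ℤ} (hu : u * u = 1) (x : A) : u • f (u • x) = f x := by
  rw [map_zsmul, smul_smul, hu, one_smul]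

/-- On each summand this is `homotopy_spec`: the sign of the differential and the sign of the
homotopy have product one, because neither map changes the weight. -/
theorem totalHomotopy_spec {e p : ℤ} (x : Total k e (p + 1)) :
    totalBdry k e p (totalHomotopy k e p x) + totalHomotopy k e (p + 1) (totalBdry k e (p + 1) x)
      = x - totalProj k e (p + 1) x := by
  suffices totalBdry k e p ∘ₗ totalHomotopy k e p +
      totalHomotopy k e (p + 1) ∘ₗ totalBdry k e (p + 1) =
      LinearMap.id - totalProj k e (p + 1) from LinearMap.congr_fun this x
  refine Total.hom_ext fun a x => ?_
  simp only [LinearMap.add_apply, LinearMap.comp_apply, LinearMap.sub_apply, LinearMap.id_apply]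
  rw [totalProj_incl, totalBdry_incl, ← map_sub]
  have hu : ∀ (w : ℕ), ((Int.negOnePow (-e * w) : ℤˣ) : ℤ) * (Int.negOnePow (-e * w) : ℤˣ) = 1 :=
    fun w => by rw [← Units.val_mul, Int.units_mul_self, Units.val_one]
  obtain ⟨n, w, ha⟩ := a
  dsimp only at x ⊢
  cases n with
  -- With no inputs the projection is the identity, and the homotopy vanishes on `∂x` because the
  -- two cofaces cancel after `s_0`.
  | zero =>
    rw [totalHomotopy, totalHomotopy, Total.lift_incl, Total.lift_incl, LinearMap.zero_apply,
      map_zero, zero_add, CosimplicialModule.proj_zero, sub_self, map_zero, LinearMap.comp_apply,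
      bdry_eq, Units.smul_def, map_zsmul, LinearMap.smul_apply,
      CosimplicialModule.homotopy_bdry_zero, smul_zero, smul_zero, map_zero]
  | succ n =>
    refine Eq.trans ?_ (congrArg (Total.incl k _) ((cosimplicial k w).homotopy_spec (n := n) x))
    rw [map_add, totalHomotopy, totalHomotopy,
      Total.lift_incl, Total.lift_incl, LinearMap.comp_apply, LinearMap.comp_apply, totalBdry_incl,
      bdry_eq, bdry_eq, Units.smul_def, Units.smul_def, LinearMap.smul_apply, LinearMap.smul_apply]
    exact congrArg₂ (· + ·)
      (congrArg (Total.incl k _) (zsmul_map_zsmul ((cosimplicial k w).bdry n) (hu w) _))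
      (congrArg (Total.incl k _) (zsmul_map_zsmul ((cosimplicial k w).homotopy (n + 1)) (hu w) _))

/-! ### The homotopy equivalence and the contraction. -/

open CategoryTheory

/-- A homotopy between maps of cochain complexes given by maps lowering the degree by one. -/
def homotopyOfSucc {V : Type*} [Category V] [Preadditive V] {C D : CochainComplex V ℤ}
    (f g : C ⟶ D) (h : ∀ q, C.X (q + 1) ⟶ D.X q)
    (hh : ∀ q, f.f (q + 1) = C.d (q + 1) (q + 1 + 1) ≫ h (q + 1) + h q ≫ D.d q (q + 1)
      + g.f (q + 1)) : Homotopy f g where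
  hom i j := if hij : j + 1 = i then eqToHom (by rw [hij]) ≫ h j else 0
  zero i j hij := dif_neg hij
  comm i := by
    -- Every integer is a successor, so data indexed by `q + 1` cover all degrees and no transport
    -- along `i - 1 + 1 = i` is needed.
    obtain ⟨q, rfl⟩ : ∃ q, i = q + 1 := ⟨i - 1, by ring⟩
    rw [dNext_eq _ (show (ComplexShape.up ℤ).Rel (q + 1) (q + 1 + 1) from rfl),
      prevD_eq _ (show (ComplexShape.up ℤ).Rel q (q + 1) from rfl), dif_pos rfl, dif_pos rfl,
      eqToHom_refl, eqToHom_refl, Category.id_comp, Category.id_comp, hh]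

theorem acyclic_of_homotopy {V : Type*} [Category V] [Abelian V] {C : CochainComplex V ℤ}
    (h : Homotopy (𝟙 C) 0) : C.Acyclic := by
  intro i
  rw [HomologicalComplex.exactAt_iff_isZero_homology, Limits.IsZero.iff_id_eq_zero,
    ← HomologicalComplex.homologyMap_id, h.homologyMap_eq, HomologicalComplex.homologyMap_zero]

theorem hochschild_d (e p : ℤ) :
    (hochschild k e).d p (p + 1) = ModuleCat.ofHom (totalBdry k e p) := by
  simp only [hochschild, CochainComplex.of_d]

theorem subcomplex_d {e : ℤ} (S : ∀ p, Submodule k (Total k e p)) (hS : Invariant S) (p : ℤ) :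
    (subcomplex S hS).d p (p + 1) = ModuleCat.ofHom ((totalBdry k e p).restrict (hS p)) := by
  simp only [subcomplex, CochainComplex.of_d]

/-- The retraction of the Hochschild complex onto its normalized part. -/
def retraction {e : ℤ} (hE : Invariant (E k e 0)) :
    hochschild k e ⟶ subcomplex (E k e 0) hE :=
  CochainComplex.ofHom
    (fun p => ModuleCat.ofHom ((totalProj k e p).codRestrict (E k e 0 p) totalProj_mem)) fun p => by
    rw [hochschild_d, subcomplex_d]
    refine ModuleCat.hom_ext (LinearMap.ext fun x => Subtype.ext ?_)
    exact totalBdry_totalProj x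

theorem inclusion_retraction {e : ℤ} (hE : Invariant (E k e 0)) :
    inclusion _ hE ≫ retraction hE = 𝟙 _ := by
  refine HomologicalComplex.hom_ext _ _ fun p =>
    ModuleCat.hom_ext (LinearMap.ext fun x => Subtype.ext ?_)
  exact totalProj_eq_self x.2

/-- The homotopy between the identity and the retraction onto the normalized part. -/
def retractionHomotopy {e : ℤ} (hE : Invariant (E k e 0)) :
    Homotopy (𝟙 (hochschild k e)) (retraction hE ≫ inclusion _ hE) :=
  homotopyOfSucc _ _ (fun q => ModuleCat.ofHom (totalHomotopy k e q)) fun q => by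
    rw [hochschild_d, hochschild_d]
    refine ModuleCat.hom_ext (LinearMap.ext fun (x : Total k e (q + 1)) => ?_)
    have h := totalHomotopy_spec x
    rw [eq_sub_iff_add_eq] at h
    refine h.symm.trans ?_
    rw [add_comm (totalBdry k e q _)]
    rfl

/-- The normalized part of the Hochschild complex is homotopy equivalent to it. -/
def homotopyEquiv {e : ℤ} (hE : Invariant (E k e 0)) :
    HomotopyEquiv (subcomplex _ hE) (hochschild k e) where
  hom := inclusion _ hE
  inv := retraction hE
  homotopyHomInvId := Homotopy.ofEq (inclusion_retraction hE)
  homotopyInvHomId := (retractionHomotopy hE).symm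

theorem isCompl_E_F (e p : ℤ) : IsCompl (E k e 0 p) (F k e 1 p) := by
  rw [E_zero_eq, F_one_eq]
  exact isCompl_totalSub (fun n w => isCompl_normalized_factorPart n w) e p

theorem invariant_E (e : ℤ) : Invariant (E k e 0) := by
  rw [show E k e 0 = totalSub _ e from funext (E_zero_eq e)]
  exact invariant_totalSub fun n w x hx => bdry_mem_normalized e hx

theorem invariant_F (e : ℤ) : Invariant (F k e 1) := by
  rw [show F k e 1 = totalSub _ e from funext (F_one_eq e)]
  exact invariant_totalSub fun n w x hx => bdry_mem_factorPart e hx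

variable (k) in
/-- The projection onto `F` along `E`. -/
def projF (e p : ℤ) : Total k e p →ₗ[k] F k e 1 p :=
  Submodule.projectionOnto _ _ (isCompl_E_F e p).symm

theorem projF_eq_self {e p : ℤ} (x : F k e 1 p) : projF k e p x = x :=
  Submodule.projectionOnto_apply_left _ x

theorem projF_eq_zero {e p : ℤ} {x : Total k e p} (hx : x ∈ E k e 0 p) : projF k e p x = 0 :=
  (Submodule.projectionOnto_apply_eq_zero_iff _).2 hx

/-- The projection is a chain map because both the image and the kernel are invariant under the
differential. -/
theorem projF_totalBdry {e p : ℤ} (x : Total k e p) :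
    (projF k e (p + 1) (totalBdry k e p x) : Total k e (p + 1))
      = totalBdry k e p (projF k e p x) := by
  have hx : x ∈ E k e 0 p ⊔ F k e 1 p := by
    rw [(isCompl_E_F e p).sup_eq_top]
    exact Submodule.mem_top
  obtain ⟨y, hy, z, hz, rfl⟩ := Submodule.mem_sup.1 hx
  rw [map_add, map_add, map_add, projF_eq_zero hy, projF_eq_zero (invariant_E e p y hy), zero_add,
    zero_add, projF_eq_self ⟨z, hz⟩, projF_eq_self ⟨_, invariant_F e p z hz⟩]

/-- The contraction of the complement of the normalized part. -/
def contraction {e : ℤ} (hF : Invariant (F k e 1)) : Homotopy (𝟙 (subcomplex _ hF)) 0 :=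
  homotopyOfSucc _ _
    (fun q => ModuleCat.ofHom (projF k e q ∘ₗ totalHomotopy k e q ∘ₗ (F k e 1 (q + 1)).subtype))
    fun q => by
      rw [subcomplex_d, subcomplex_d]
      refine ModuleCat.hom_ext (LinearMap.ext fun (x : F k e 1 (q + 1)) => Subtype.ext ?_)
      -- Apply the projection onto `F_1` to the homotopy formula: the normalized projection of `x`
      -- lies in `E_0` and disappears, leaving the identity on `F_1`.
      have h := congrArg (projF k e (q + 1)) (totalHomotopy_spec (x : Total k e (q + 1)))
      rw [map_add, map_sub, projF_eq_zero (totalProj_mem _), sub_zero, projF_eq_self] at h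
      have h2 := congrArg Subtype.val h
      rw [Submodule.coe_add, projF_totalBdry] at h2
      exact ((add_comm _ _).trans h2).symm.trans (add_zero _).symm

end HochschildBV

end

theorem proposition5p5 {k : Type u} [CommRing k] (d : ℤ) (hd : Even d) :
    (∀ p, IsCompl (HochschildBV.E k (d - 1) 0 p) (HochschildBV.F k (d - 1) 1 p)) ∧
    ∃ (hE : HochschildBV.Invariant (HochschildBV.E k (d - 1) 0))
      (hF : HochschildBV.Invariant (HochschildBV.F k (d - 1) 1)),
      (∃ f : HomotopyEquiv (HochschildBV.subcomplex _ hE) (HochschildBV.hochschild k (d - 1)),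
        f.hom = HochschildBV.inclusion _ hE) ∧
      QuasiIso (HochschildBV.inclusion _ hE) ∧
      Nonempty (Homotopy (CategoryTheory.CategoryStruct.id (HochschildBV.subcomplex _ hF)) 0) ∧
      (HochschildBV.subcomplex _ hF).Acyclic :=
  ⟨HochschildBV.isCompl_E_F (d - 1), HochschildBV.invariant_E _, HochschildBV.invariant_F _,
    ⟨HochschildBV.homotopyEquiv (HochschildBV.invariant_E _), rfl⟩,
    -- The inclusion is by definition the forward map of the homotopy equivalence, and such maps are
    -- quasi-isomorphisms.
    inferInstanceAs (QuasiIso (HochschildBV.homotopyEquiv (HochschildBV.invariant_E (k := k) (d - 1))).hom),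
    ⟨HochschildBV.contraction (HochschildBV.invariant_F _)⟩,
    HochschildBV.acyclic_of_homotopy (HochschildBV.contraction (HochschildBV.invariant_F _))⟩
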